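/- Let $d\ge 1$, let $\Omega\subset\mathbb R^d$ be open, bounded and connected with Lipschitz boundary, and let $\Sigma_v,\Sigma_p\subset\partial\Omega$ be relatively open and disjoint with $\partial\Omega=\overline{\Sigma_v\cup\Sigma_p}$. Let $2\le r<\infty$ and $s=\frac{r}{r-1}$. Let $\phi_1,\phi_2:[0,\infty)\to[0,\infty)$ be such that $\phi_1$ is continuous and nondecreasing on $[0,1]$, $\phi_2$ is continuous and nondecreasing on $[1,\infty)$, and for some $c,C>0$, $$c\,a^{\frac{r-2}{2}}\le\phi_2(a)\le C\bigl(1+a^{\frac{r-2}{2}}\bigr)\qquad\text{for all }a\ge 1 .$$ For $u\in L^r(\Omega)^d$ define the multivalued law $$\Lambda(u)=\bigl\{\phi_1(|u|^2)\,u\,\chi_{\{|u|<1\}}+\phi_2(|u|^2)\,u\,\chi_{\{|u|>1\}}+h\,\chi_{\{|u|=1\}} : h\in L^s(\Omega)^d\bigr\}\subset L^s(\Omega)^d .$$ Let $W_0^{1,s}(\Omega)$ be the set of $\xi\in W^{1,s}(\Omega)$ with $\int_\Omega\xi=0$ if $\mathcal H^{d-1}(\Sigma_p)=0$, and with zero trace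 on $\Sigma_p$ if $\mathcal H^{d-1}(\Sigma_p)>0$. Write $\langle g,\varphi\rangle=\int_\Omega g\cdot\varphi$ for $g\in L^s(\Omega)^d$, $\varphi\in L^r(\Omega)^d$, and $$V=\{\varphi\in L^r(\Omega)^d : \langle\nabla\psi,\varphi\rangle=0\ \text{ for all }\psi\in W_0^{1,s}(\Omega)\}.$$ Let $q\in L^r(\Omega)$, $u_0\in L^r(\Sigma_v)$ and $f_0\in L^s(\Omega)^d$. Given $\Lambda_u\in L^s(\Omega)^d$, consider for $(u,p)\in L^r(\Omega)^d\times W_0^{1,s}(\Omega)$ the equations $$\langle\Lambda_u,\varphi\rangle=-\langle\nabla p,\varphi\rangle+\langle f_0,\varphi\rangle,\qquad \langle\nabla\psi,u\rangle=-\int_\Omega q\psi+\int_{\Sigma_v}u_0\psi\qquad(\ast)$$ for all $\varphi\in L^r(\Omega)^d$ and $\psi\in W_0^{1,s}(\Omega)$. The mixed problem is to find $(u,p)\in L^r(\Omega)^d\times W_0^{1,s}(\Omega)$ such that $(\ast)$ holds for some $\Lambda_u\in\Lambda(u)$. Then there is a unique class in $L^r(\Omega)^d/V$ whose representatives $\hat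 u$ satisfy $$\langle\nabla\psi,\hat u\rangle=-\int_\Omega q\psi+\int_{\Sigma_v}u_0\psi\qquad\text{for all }\psi\in W_0^{1,s}(\Omega),$$ and for every such $\hat u$ the mixed problem is equivalent to the reduced problem of finding $v\in V$ such that there exists $\Lambda_v\in\Lambda(v+\hat u)$ with $$\langle\Lambda_v,\varphi\rangle=\langle f_0,\varphi\rangle\qquad\text{for all }\varphi\in V,$$ in the following sense: 1. if $(u,p)$ solves the mixed problem, then $v=u-\hat u$ solves the reduced problem; 2. if $v$ solves the reduced problem, then there is $p\in W_0^{1,s}(\Omega)$ such that $(v+\hat u,p)$ solves the mixed problem; 3. for every $v\in V$ and every $\Lambda_v\in\Lambda(v+\hat u)$ with $\langle\Lambda_v,\varphi\rangle=\langle f_0,\varphi\rangle$ for all $\varphi\in V$, there is exactly one $p\in W_0^{1,s}(\Omega)$ such that $(\ast)$ holds for $u=v+\hat u$ with $\Lambda_u=\Lambda_v$. -/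

import Mathlib

open MeasureTheory Filter Topology Set
open scoped ENNReal NNReal ContDiff

noncomputable section

namespace Fracture

/-- Euclidean space `ℝ^d`. -/
abbrev E (d : ℕ) := EuclideanSpace ℝ (Fin d)

/-- `Ω` has a Lipschitz boundary: near every boundary point, in suitable orthonormal coordinates
(with last coordinate axis spanned by the unit vector `e`), the set `Ω` is the strict epigraph of a
Lipschitz function of the remaining coordinates. -/
def HasLipschitzBoundary {d : ℕ} (Ω : Set (E d)) : Prop :=
  ∀ x ∈ frontier Ω, ∃ (e : E d) (K : ℝ≥0) (γ : (ℝ ∙ e)ᗮ → ℝ), ‖e‖ = 1 ∧ LipschitzWith K γ ∧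
    ∀ᶠ y in 𝓝 x, (y ∈ Ω ↔ γ ((ℝ ∙ e)ᗮ.orthogonalProjectionOnto y) < inner ℝ e y)

/-- `S` is a relatively open part of the boundary of `Ω`. -/
def IsRelOpenInBoundary {d : ℕ} (Ω S : Set (E d)) : Prop :=
  ∃ U : Set (E d), IsOpen U ∧ S = U ∩ frontier Ω

/-- Lebesgue measure on `Ω`. -/
abbrev vol {d : ℕ} (Ω : Set (E d)) : Measure (E d) := (volume : Measure (E d)).restrict Ω

/-- Surface measure of `∂Ω`: the `(d-1)`-dimensional Hausdorff measure, normalized to agree with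
Lebesgue measure on `(d-1)`-dimensional subspaces, restricted to `∂Ω`. -/
abbrev surf {d : ℕ} (Ω : Set (E d)) : Measure (E d) :=
  (Measure.euclideanHausdorffMeasure (d - 1) : Measure (E d)).restrict (frontier Ω)

/-- `G` is the weak gradient of `ψ` on `Ω`. -/
def IsWeakGradient {d : ℕ} (Ω : Set (E d)) (ψ : E d → ℝ) (G : E d → E d) : Prop :=
  ∀ η : E d → ℝ, ContDiff ℝ ∞ η → HasCompactSupport η → tsupport η ⊆ Ω →
    ∫ x in Ω, ψ x • gradient η x = - ∫ x in Ω, η x • G x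

section Spaces

variable {d : ℕ} (Ω : Set (E d)) (s : ℝ≥0∞)

/-- The Sobolev space `W^{1,s}(Ω)`. An element is a function of `L^s(Ω)` that has a weak gradient in
`L^s(Ω)`, recorded together with this (unique) weak gradient. -/
def sobolev [Fact (1 ≤ s)] : Submodule ℝ (Lp ℝ s (vol Ω) × Lp (E d) s (vol Ω)) where
  carrier := {ξ | IsWeakGradient Ω ξ.1 ξ.2}
  zero_mem' := by
    intro η _ _ _
    have h1 : ∫ x in Ω, ((0 : Lp ℝ s (vol Ω)) : E d → ℝ) x • gradient η x = 0 := by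
      refine integral_eq_zero_of_ae ?_
      filter_upwards [Lp.coeFn_zero ℝ s (vol Ω)] with x hx
      rw [hx]
      simp
    have h2 : ∫ x in Ω, η x • ((0 : Lp (E d) s (vol Ω)) : E d → E d) x = 0 := by
      refine integral_eq_zero_of_ae ?_
      filter_upwards [Lp.coeFn_zero (E d) s (vol Ω)] with x hx
      rw [hx]
      simp
    exact h1.trans (by rw [Prod.snd_zero, h2, neg_zero])
  add_mem' := by
    rintro ⟨a, A⟩ ⟨b, B⟩ ha hb η h1 h2 h3
    have hg : Continuous (gradient η) :=
      (InnerProductSpace.toDual ℝ (E d)).symm.continuous.comp (h1.continuous_fderiv (by simp))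
    have hgs : HasCompactSupport (gradient η) :=
      (h2.fderiv ℝ).comp_left (g := (InnerProductSpace.toDual ℝ (E d)).symm) (by simp)
    have l1 : ∀ c : Lp ℝ s (vol Ω), Integrable (fun x => c x • gradient η x) (vol Ω) := fun c =>
      ((Lp.memLp c).locallyIntegrable Fact.out).integrable_smul_right_of_hasCompactSupport hg hgs
    have l2 : ∀ c : Lp (E d) s (vol Ω), Integrable (fun x => η x • c x) (vol Ω) := fun c =>
      ((Lp.memLp c).locallyIntegrable Fact.out).integrable_smul_left_of_hasCompactSupport
        h1.continuous h2
    have e1 : ∫ x in Ω, (a + b : Lp ℝ s (vol Ω)) x • gradient η x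
        = (∫ x in Ω, a x • gradient η x) + ∫ x in Ω, b x • gradient η x := by
      rw [← integral_add (l1 a) (l1 b)]
      refine integral_congr_ae ?_
      filter_upwards [Lp.coeFn_add a b] with x hx
      rw [hx, Pi.add_apply, add_smul]
    have e2 : ∫ x in Ω, η x • (A + B : Lp (E d) s (vol Ω)) x
        = (∫ x in Ω, η x • A x) + ∫ x in Ω, η x • B x := by
      rw [← integral_add (l2 A) (l2 B)]
      refine integral_congr_ae ?_
      filter_upwards [Lp.coeFn_add A B] with x hx
      rw [hx, Pi.add_apply, smul_add]
    have ea := ha η h1 h2 h3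
    have eb := hb η h1 h2 h3
    simp only [Prod.mk_add_mk] at ea eb ⊢
    rw [e1, e2, ea, eb, neg_add]
  smul_mem' := by
    rintro c ⟨a, A⟩ ha η h1 h2 h3
    have e1 : ∫ x in Ω, (c • a : Lp ℝ s (vol Ω)) x • gradient η x
        = c • ∫ x in Ω, a x • gradient η x := by
      rw [← integral_smul]
      refine integral_congr_ae ?_
      filter_upwards [Lp.coeFn_smul c a] with x hx
      simp [hx, mul_smul]
    have e2 : ∫ x in Ω, η x • (c • A : Lp (E d) s (vol Ω)) x
        = c • ∫ x in Ω, η x • A x := by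
      rw [← integral_smul]
      refine integral_congr_ae ?_
      filter_upwards [Lp.coeFn_smul c A] with x hx
      simp [hx, smul_comm c]
    have ea := ha η h1 h2 h3
    simp only [Prod.smul_mk] at ea ⊢
    rw [e1, e2, ea, smul_neg]

variable {Ω s}

/-- The function underlying an element of `W^{1,s}(Ω)`. -/
def fn [Fact (1 ≤ s)] (ξ : sobolev Ω s) : Lp ℝ s (vol Ω) := ξ.1.1

/-- The weak gradient of an element of `W^{1,s}(Ω)`. -/
def grad [Fact (1 ≤ s)] (ξ : sobolev Ω s) : Lp (E d) s (vol Ω) := ξ.1.2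

/-- `g ∈ L^s(∂Ω)` is the boundary trace of `ξ ∈ W^{1,s}(Ω)`: some sequence of functions smooth up to
the boundary converges to `ξ` in `W^{1,s}(Ω)` while its boundary values converge to `g` in
`L^s(∂Ω)`. -/
def IsTrace [Fact (1 ≤ s)] (ξ : sobolev Ω s) (g : Lp ℝ s (surf Ω)) : Prop :=
  ∃ η : ℕ → E d → ℝ, (∀ n, ContDiff ℝ ∞ (η n)) ∧
    Tendsto (fun n => eLpNorm (fun x => η n x - fn ξ x) s (vol Ω)) atTop (𝓝 0) ∧
    Tendsto (fun n => eLpNorm (fun x => gradient (η n) x - grad ξ x) s (vol Ω)) atTop (𝓝 0) ∧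
    Tendsto (fun n => eLpNorm (fun x => η n x - g x) s (surf Ω)) atTop (𝓝 0)

open Classical in
/-- The trace operator `W^{1,s}(Ω) → L^s(∂Ω)`. On a bounded Lipschitz domain, with `1 ≤ s < ∞`, every
`ξ` has exactly one trace; the value `0` in the other branch is a mere convention. -/
def trace [Fact (1 ≤ s)] (ξ : sobolev Ω s) : Lp ℝ s (surf Ω) :=
  if h : ∃ g, IsTrace ξ g then h.choose else 0

variable (Ω s)

/-- The space `W_0^{1,s}(Ω)`: zero mean on `Ω` if the boundary part `Sp` is negligible, zero trace on
`Sp` otherwise. -/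
def sobolevZero [Fact (1 ≤ s)] (Sp : Set (E d)) : Set (sobolev Ω s) :=
  {ξ | (surf Ω Sp = 0 → ∫ x in Ω, fn ξ x = 0) ∧
    (0 < surf Ω Sp → ∀ᵐ x ∂((surf Ω).restrict Sp), trace ξ x = 0)}

variable {Ω s}
variable {r : ℝ≥0∞} [Fact (1 ≤ r)] [Fact (1 ≤ s)] [ENNReal.HolderConjugate s r]

/-- The duality pairing `⟨g, φ⟩ = ∫_Ω g · φ` on `L^s(Ω)^d × L^r(Ω)^d`. -/
def pairing : Lp (E d) s (vol Ω) →L[ℝ] Lp (E d) r (vol Ω) →L[ℝ] ℝ :=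
  (innerSL ℝ).lpPairing (vol Ω) s r

theorem pairing_eq_integral (g : Lp (E d) s (vol Ω)) (φ : Lp (E d) r (vol Ω)) :
    pairing g φ = ∫ x in Ω, inner ℝ (g x) (φ x) := by
  rw [pairing, ContinuousLinearMap.lpPairing_eq_integral]
  rfl

/-- The space `V` of fields in `L^r(Ω)^d` that annihilate all gradients of `W_0^{1,s}(Ω)`. -/
def V (Ω : Set (E d)) (r s : ℝ≥0∞) [Fact (1 ≤ r)] [Fact (1 ≤ s)] [ENNReal.HolderConjugate s r]
    (Sp : Set (E d)) : Submodule ℝ (Lp (E d) r (vol Ω)) where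
  carrier := {φ | ∀ ψ ∈ sobolevZero Ω s Sp, pairing (grad ψ) φ = 0}
  zero_mem' := by intro ψ _; simp
  add_mem' := by
    intro a b ha hb ψ hψ
    rw [map_add, ha ψ hψ, hb ψ hψ, add_zero]
  smul_mem' := by
    intro c a ha ψ hψ
    rw [map_smul, ha ψ hψ, smul_zero]

end Spaces

section Law

variable {d : ℕ}

/-- Low-speed region. -/
def lowSpeed (Ω : Set (E d)) (u : E d → E d) : Set (E d) := {x ∈ Ω | ‖u x‖ < 1}

/-- High-speed region. -/
def highSpeed (Ω : Set (E d)) (u : E d → E d) : Set (E d) := {x ∈ Ω | 1 < ‖u x‖}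

/-- Interface. -/
def interface (Ω : Set (E d)) (u : E d → E d) : Set (E d) := {x ∈ Ω | ‖u x‖ = 1}

/-- The field `φ(‖u‖²) u χ_A`. -/
def regionLaw (φ : ℝ≥0 → ℝ≥0) (u : E d → E d) (A : Set (E d)) : E d → E d :=
  A.indicator (fun x => φ (‖u x‖₊ ^ 2) • u x)

/-- The multivalued law
`Λ(u) = { φ₁(‖u‖²) u χ_{‖u‖<1} + φ₂(‖u‖²) u χ_{‖u‖>1} + h χ_{‖u‖=1} : h ∈ L^s(Ω)^d } ⊆ L^s(Ω)^d`. -/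
def law {Ω : Set (E d)} {r : ℝ≥0∞} (s : ℝ≥0∞) (φ₁ φ₂ : ℝ≥0 → ℝ≥0) (u : Lp (E d) r (vol Ω)) :
    Set (Lp (E d) s (vol Ω)) :=
  {g | ∃ h : Lp (E d) s (vol Ω),
    g =ᵐ[vol Ω] regionLaw φ₁ u (lowSpeed Ω u) + regionLaw φ₂ u (highSpeed Ω u)
      + (interface Ω u).indicator h}

/-- Assumptions on the two laws `φ₁, φ₂ : [0,∞) → [0,∞)` with growth exponent `r`. -/
structure IsAdmissible (r : ℝ≥0∞) (φ₁ φ₂ : ℝ≥0 → ℝ≥0) : Prop where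
  continuousOn_one : ContinuousOn φ₁ (Icc 0 1)
  monotoneOn_one : MonotoneOn φ₁ (Icc 0 1)
  continuousOn_two : ContinuousOn φ₂ (Ici 1)
  monotoneOn_two : MonotoneOn φ₂ (Ici 1)
  growth : ∃ c C : ℝ, 0 < c ∧ 0 < C ∧ ∀ a : ℝ≥0, 1 ≤ a →
    c * (a : ℝ) ^ ((r.toReal - 2) / 2) ≤ φ₂ a ∧
      (φ₂ a : ℝ) ≤ C * (1 + (a : ℝ) ^ ((r.toReal - 2) / 2))

end Law

section Problems

variable {d : ℕ} {Ω : Set (E d)} {r s : ℝ≥0∞} [Fact (1 ≤ r)] [Fact (1 ≤ s)]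
  [ENNReal.HolderConjugate s r]

/-- The data functional `ψ ↦ - ∫_Ω q ψ + ∫_{Sv} u₀ ψ`. -/
def dataFunctional (Sv : Set (E d)) (q : Lp ℝ r (vol Ω)) (u₀ : Lp ℝ r ((surf Ω).restrict Sv))
    (ψ : sobolev Ω s) : ℝ :=
  - (∫ x in Ω, q x * fn ψ x) + ∫ x, u₀ x * trace ψ x ∂((surf Ω).restrict Sv)

/-- The mass-conservation equation `⟨∇ψ, u⟩ = - ∫_Ω q ψ + ∫_{Sv} u₀ ψ` for all `ψ ∈ W_0^{1,s}(Ω)`. -/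
def IsLift (s : ℝ≥0∞) [Fact (1 ≤ s)] [ENNReal.HolderConjugate s r]
    (Sv Sp : Set (E d)) (q : Lp ℝ r (vol Ω)) (u₀ : Lp ℝ r ((surf Ω).restrict Sv))
    (u : Lp (E d) r (vol Ω)) : Prop :=
  ∀ ψ ∈ sobolevZero Ω s Sp, pairing (grad ψ) u = dataFunctional Sv q u₀ ψ

/-- `(u, p)` satisfies the two equations of the mixed weak formulation with the selection `Λu`. -/
def SolvesMixedWith (Sv Sp : Set (E d)) (q : Lp ℝ r (vol Ω))
    (u₀ : Lp ℝ r ((surf Ω).restrict Sv)) (f₀ : Lp (E d) s (vol Ω))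
    (Λu : Lp (E d) s (vol Ω)) (u : Lp (E d) r (vol Ω)) (p : sobolev Ω s) : Prop :=
  ∀ φ : Lp (E d) r (vol Ω), ∀ ψ ∈ sobolevZero Ω s Sp,
    pairing Λu φ = - pairing (grad p) φ + pairing f₀ φ ∧
      pairing (grad ψ) u = dataFunctional Sv q u₀ ψ

/-- `(u, p) ∈ L^r(Ω)^d × W_0^{1,s}(Ω)` solves the mixed weak formulation. -/
def SolvesMixed (Sv Sp : Set (E d)) (φ₁ φ₂ : ℝ≥0 → ℝ≥0) (q : Lp ℝ r (vol Ω))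
    (u₀ : Lp ℝ r ((surf Ω).restrict Sv)) (f₀ : Lp (E d) s (vol Ω))
    (u : Lp (E d) r (vol Ω)) (p : sobolev Ω s) : Prop :=
  p ∈ sobolevZero Ω s Sp ∧ ∃ Λu ∈ law s φ₁ φ₂ u, SolvesMixedWith Sv Sp q u₀ f₀ Λu u p

/-- `v` solves the reduced problem on `V`, for the lift `uhat`. -/
def SolvesReduced (Sp : Set (E d)) (φ₁ φ₂ : ℝ≥0 → ℝ≥0) (f₀ : Lp (E d) s (vol Ω))
    (uhat v : Lp (E d) r (vol Ω)) : Prop :=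
  v ∈ V Ω r s Sp ∧ ∃ Λv ∈ law s φ₁ φ₂ (v + uhat), ∀ φ ∈ V Ω r s Sp, pairing Λv φ = pairing f₀ φ

end Problems

end Fracture

end

/-! The argument is duality between `L^s` and `L^r` combined with a closed range. On `W_0^{1,s}`
Poincaré's inequality bounds the full Sobolev norm by the norm of the gradient, so `∇` is injective
there and `∇W_0^{1,s}` is a closed subspace of `L^s`. Since `1 < s ≤ 2` and `Ω` has finite measure,
every functional on `L^s` is the pairing with a field in `L^r`, and `V` is the annihilator of
`∇W_0^{1,s}`.

Two consequences of Hahn–Banach carry the theorem. A field of `L^s` that annihilates `V` must lie in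
the closed space `∇W_0^{1,s}` (`exists_grad_eq_of_annihilates`). The data functional is continuous
on `W^{1,s}`, so on `W_0^{1,s}` it factors through `∇` as a bounded functional on the range, which
extends to `L^s` and is represented by some `û` (`exists_isLift`). Lifts are thus a coset of `V`.
The first mixed equation says `∇p = f₀ - Λ_u` (`solvesMixedWith_iff`). Testing with `V` removes `p`;
conversely, if `f₀ - Λ_v` annihilates `V`, the pressure exists, and it is unique because `∇` is
injective. The selection of the law passes unchanged between the two problems.

The bulk of the file supplies the analysis on a bounded Lipschitz domain: the trace inequality, the
Poincaré–Wirtinger inequality, density of smooth functions in `W^{1,s}`, the trace operator, and the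
Riesz representation. The inequalities are proved for `C^1` functions on the whole space, as
inequalities between `[0,∞]`-valued integrals, and reach Sobolev functions by density. -/

namespace Fracture

/-! ### Increments of `C^1` functions and Poincaré's inequality on convex sets. -/

section Calculus

/-- Jensen's inequality for powers with exponent at least one. -/
theorem lintegral_rpow_le_of_prob {α : Type*} [MeasurableSpace α] {μ : Measure α}
    [IsProbabilityMeasure μ] {p : ℝ} (hp : 1 ≤ p) {f : α → ℝ≥0∞} (hf : AEMeasurable f μ) :
    (∫⁻ x, f x ∂μ) ^ p ≤ ∫⁻ x, f x ^ p ∂μ := by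
  have hp0 : 0 < p := by linarith
  have h := eLpNorm'_le_eLpNorm'_of_exponent_le (f := f) one_pos hp μ hf.aestronglyMeasurable
  simp only [eLpNorm', enorm_eq_self, ENNReal.rpow_one, div_one] at h
  calc (∫⁻ x, f x ∂μ) ^ p ≤ ((∫⁻ x, f x ^ p ∂μ) ^ (1 / p)) ^ p := by gcongr
    _ = _ := by rw [← ENNReal.rpow_mul, one_div, inv_mul_cancel₀ hp0.ne', ENNReal.rpow_one]

variable {d : ℕ}

theorem enorm_gradient (η : E d → ℝ) (x : E d) : ‖gradient η x‖ₑ = ‖fderiv ℝ η x‖ₑ := by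
  rw [gradient, LinearIsometryEquiv.enorm_map]

theorem continuous_gradient {η : E d → ℝ} (hη : ContDiff ℝ 1 η) : Continuous (gradient η) :=
  (InnerProductSpace.toDual ℝ (E d)).symm.continuous.comp (hη.continuous_fderiv (by simp))

theorem measurable_enorm_gradient_rpow {η : E d → ℝ} (hη : ContDiff ℝ 1 η) (p : ℝ) :
    Measurable fun x => ‖gradient η x‖ₑ ^ p :=
  ((continuous_gradient hη).measurable.enorm).pow_const p

/-- Increments along a segment are controlled by the gradient on the segment. -/
theorem enorm_sub_rpow_le_segment {p : ℝ} (hp : 1 ≤ p) {η : E d → ℝ} (hη : ContDiff ℝ 1 η)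
    (y v : E d) {t : ℝ} (ht : t ∈ Icc (0 : ℝ) 1) :
    ‖η (y + t • v) - η y‖ₑ ^ p ≤
      ‖v‖ₑ ^ p * ∫⁻ θ in Icc (0 : ℝ) 1, ‖gradient η (y + θ • v)‖ₑ ^ p := by
  have hp0 : 0 ≤ p := by linarith
  have hd : ∀ θ : ℝ, HasDerivAt (fun θ : ℝ => η (y + θ • v)) (fderiv ℝ η (y + θ • v) v) θ := by
    intro θ
    have h1 : HasDerivAt (fun θ : ℝ => y + θ • v) v θ := by
      simpa using ((hasDerivAt_id θ).smul_const v).const_add y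
    exact ((hη.differentiable (by simp)) _).hasFDerivAt.comp_hasDerivAt θ h1
  have h1 : ‖η (y + t • v) - η y‖ₑ ≤
      ∫⁻ θ in Icc (0 : ℝ) 1, ‖v‖ₑ * ‖gradient η (y + θ • v)‖ₑ := by
    have hc : ContDiff ℝ 1 (fun θ : ℝ => η (y + θ • v)) := by fun_prop
    have h := enorm_sub_le_lintegral_deriv_of_contDiffOn_Icc hc.contDiffOn ht.1
    simp only [zero_smul, add_zero] at h
    refine h.trans ((lintegral_mono_set (Icc_subset_Icc_right ht.2)).trans ?_)
    refine lintegral_mono fun θ => ?_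
    rw [(hd θ).deriv, enorm_gradient, mul_comm]
    exact ContinuousLinearMap.le_opENorm _ _
  have : IsProbabilityMeasure (volume.restrict (Icc (0 : ℝ) 1)) := ⟨by simp⟩
  have hm : Measurable fun θ : ℝ => ‖gradient η (y + θ • v)‖ₑ :=
    ((continuous_gradient hη).comp (by fun_prop)).measurable.enorm
  calc ‖η (y + t • v) - η y‖ₑ ^ p
      ≤ (∫⁻ θ in Icc (0 : ℝ) 1, ‖v‖ₑ * ‖gradient η (y + θ • v)‖ₑ) ^ p := by gcongr
    _ ≤ ∫⁻ θ in Icc (0 : ℝ) 1, (‖v‖ₑ * ‖gradient η (y + θ • v)‖ₑ) ^ p :=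
        lintegral_rpow_le_of_prob hp (hm.const_mul _).aemeasurable
    _ = _ := by
        rw [← lintegral_const_mul _ (hm.pow_const p)]
        exact lintegral_congr fun θ => ENNReal.mul_rpow_of_nonneg _ _ hp0

theorem measurable_uncurry_segment {g : E d → ℝ≥0∞} (hg : Measurable g) (v : E d) :
    Measurable fun z : E d × ℝ => g (z.1 + z.2 • v) :=
  hg.comp (by fun_prop)

/-- Increments by a fixed vector are controlled in the mean by the gradient. -/
theorem lintegral_translate_sub_rpow_le {p : ℝ} (hp : 1 ≤ p) {η : E d → ℝ} (hη : ContDiff ℝ 1 η)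
    {A O : Set (E d)} (v : E d) (hA : MeasurableSet A) (hO : MeasurableSet O)
    (h : ∀ y ∈ A, ∀ θ ∈ Icc (0 : ℝ) 1, y + θ • v ∈ O) :
    ∫⁻ y in A, ‖η (y + v) - η y‖ₑ ^ p ≤ ‖v‖ₑ ^ p * ∫⁻ x in O, ‖gradient η x‖ₑ ^ p := by
  have hgm := measurable_enorm_gradient_rpow hη p
  set g : E d → ℝ≥0∞ := O.indicator fun x => ‖gradient η x‖ₑ ^ p with hg
  have hgm' : Measurable g := hgm.indicator hO
  have hm := measurable_uncurry_segment hgm' v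
  calc ∫⁻ y in A, ‖η (y + v) - η y‖ₑ ^ p
      ≤ ∫⁻ y in A, ‖v‖ₑ ^ p * ∫⁻ θ in Icc (0 : ℝ) 1, g (y + θ • v) := by
        refine setLIntegral_mono' hA fun y hy => ?_
        have := enorm_sub_rpow_le_segment hp hη y v (t := 1) (by simp)
        rw [one_smul] at this
        refine this.trans (mul_le_mul_right (setLIntegral_mono' measurableSet_Icc
          fun θ hθ => ?_) _)
        rw [hg, indicator_of_mem (h y hy θ hθ)]
    _ = ‖v‖ₑ ^ p * ∫⁻ y in A, ∫⁻ θ in Icc (0 : ℝ) 1, g (y + θ • v) :=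
        lintegral_const_mul _ hm.lintegral_prod_right'
    _ = ‖v‖ₑ ^ p * ∫⁻ θ in Icc (0 : ℝ) 1, ∫⁻ y in A, g (y + θ • v) := by
        rw [lintegral_lintegral_swap hm.aemeasurable]
    _ ≤ ‖v‖ₑ ^ p * ∫⁻ θ in Icc (0 : ℝ) 1, ∫⁻ y, g y := by
        refine mul_le_mul_right (lintegral_mono fun θ => ?_) _
        exact (setLIntegral_le_lintegral _ _).trans_eq
          (lintegral_add_right_eq_self (μ := (volume : Measure (E d))) g (θ • v))
    _ = _ := by simp [hg, lintegral_indicator hO]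

theorem lintegral_comp_convexCombination {g : E d → ℝ≥0∞} (hg : Measurable g) (x : E d) {θ : ℝ}
    (hθ : 0 < θ) :
    ∫⁻ y, g (x + θ • (y - x)) = ENNReal.ofReal ((θ ^ d)⁻¹) * ∫⁻ y, g y := by
  have h1 : ∫⁻ y, g (x + θ • (y - x)) = ∫⁻ y, g (x + θ • y) :=
    lintegral_sub_right_eq_self (fun y => g (x + θ • y)) x
  have h2 : ∫⁻ y, g (x + θ • y) = ∫⁻ y, g (x + y) ∂(Measure.map (θ • ·) volume) := by
    rw [lintegral_map (by fun_prop) (by fun_prop)]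
  rw [h1, h2, Measure.map_addHaar_smul _ hθ.ne', lintegral_smul_measure,
    lintegral_add_left_eq_self]
  simp [abs_of_pos hθ]

/-- For fixed `x`, the map `y ↦ x + θ(y - x)` sends the convex set `B` into itself and scales volume
by `θ^d`. Keeping `θ ≥ 1/2` bounds the inverse Jacobian by `2^d`; near `θ = 0` it would blow up. -/
theorem lintegral_ball_convexCombination_le {B : Set (E d)} (hB : MeasurableSet B)
    (hc : Convex ℝ B) {g : E d → ℝ≥0∞} (hg : Measurable g) {θ : ℝ} (hθ : θ ∈ Icc (2⁻¹ : ℝ) 1) :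
    ∫⁻ x in B, ∫⁻ y in B, g (x + θ • (y - x)) ≤ volume B * (2 ^ d * ∫⁻ y in B, g y) := by
  have hθ0 : 0 < θ := lt_of_lt_of_le (by norm_num) hθ.1
  have key : ∀ x ∈ B, ∫⁻ y in B, g (x + θ • (y - x)) ≤ 2 ^ d * ∫⁻ y in B, g y := by
    intro x hx
    calc ∫⁻ y in B, g (x + θ • (y - x)) ≤ ∫⁻ y in B, B.indicator g (x + θ • (y - x)) := by
          refine setLIntegral_mono' hB fun y hy => ?_
          rw [indicator_of_mem (hc.add_smul_sub_mem hx hy ⟨hθ0.le, hθ.2⟩)]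
      _ ≤ ∫⁻ y, B.indicator g (x + θ • (y - x)) := setLIntegral_le_lintegral _ _
      _ = ENNReal.ofReal ((θ ^ d)⁻¹) * ∫⁻ y, B.indicator g y :=
          lintegral_comp_convexCombination (hg.indicator hB) x hθ0
      _ ≤ 2 ^ d * ∫⁻ y in B, g y := by
          rw [lintegral_indicator hB]
          gcongr
          have : (θ ^ d)⁻¹ ≤ 2 ^ d := by
            rw [← inv_pow]
            exact pow_le_pow_left₀ (by positivity) ((inv_le_comm₀ hθ0 two_pos).2 hθ.1) d
          calc ENNReal.ofReal ((θ ^ d)⁻¹) ≤ ENNReal.ofReal (2 ^ d) := ENNReal.ofReal_le_ofReal this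
            _ = 2 ^ d := by rw [ENNReal.ofReal_pow (by norm_num)]; simp
  calc _ ≤ ∫⁻ x in B, 2 ^ d * ∫⁻ y in B, g y := setLIntegral_mono' hB key
    _ = _ := by simp [mul_comm]

/-- Exchanging `x` and `y` turns `θ` into `1 - θ`, so one of the two parameters is always at least
`1/2` and the previous bound applies for every `θ`. Integrating over `θ` then costs nothing. -/
theorem lintegral_ball_segment_le {B : Set (E d)} (hB : MeasurableSet B)
    (hc : Convex ℝ B) {g : E d → ℝ≥0∞} (hg : Measurable g) :
    ∫⁻ x in B, ∫⁻ y in B, ∫⁻ θ in Icc (0 : ℝ) 1, g (x + θ • (y - x)) ≤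
      volume B * (2 ^ d * ∫⁻ y in B, g y) := by
  have hθ : ∀ θ ∈ Icc (0 : ℝ) 1, ∫⁻ x in B, ∫⁻ y in B, g (x + θ • (y - x)) ≤
      volume B * (2 ^ d * ∫⁻ y in B, g y) := by
    intro θ hθ
    by_cases h2 : 2⁻¹ ≤ θ
    · exact lintegral_ball_convexCombination_le hB hc hg ⟨h2, hθ.2⟩
    · have hmθ : Measurable fun z : E d × E d => g (z.1 + θ • (z.2 - z.1)) :=
        hg.comp (by fun_prop)
      rw [lintegral_lintegral_swap hmθ.aemeasurable]
      refine le_trans (le_of_eq ?_) (lintegral_ball_convexCombination_le hB hc hg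
        (θ := 1 - θ) ⟨by linarith, by linarith [hθ.1]⟩)
      refine lintegral_congr fun y => lintegral_congr fun x => ?_
      congr 1
      module
  have e1 : ∀ x, ∫⁻ y in B, ∫⁻ θ in Icc (0 : ℝ) 1, g (x + θ • (y - x)) =
      ∫⁻ θ in Icc (0 : ℝ) 1, ∫⁻ y in B, g (x + θ • (y - x)) := by
    intro x
    have hm : Measurable fun z : E d × ℝ => g (x + z.2 • (z.1 - x)) := hg.comp (by fun_prop)
    exact lintegral_lintegral_swap hm.aemeasurable
  have e2 : ∫⁻ x in B, ∫⁻ θ in Icc (0 : ℝ) 1, ∫⁻ y in B, g (x + θ • (y - x)) =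
      ∫⁻ θ in Icc (0 : ℝ) 1, ∫⁻ x in B, ∫⁻ y in B, g (x + θ • (y - x)) := by
    have hm : Measurable fun z : (E d × ℝ) × E d => g (z.1.1 + z.1.2 • (z.2 - z.1.1)) :=
      hg.comp (by fun_prop)
    have hm' : Measurable fun z : E d × ℝ => ∫⁻ y in B, g (z.1 + z.2 • (y - z.1)) :=
      hm.lintegral_prod_right'
    exact lintegral_lintegral_swap hm'.aemeasurable
  simp_rw [e1]
  rw [e2]
  calc _ ≤ ∫⁻ θ in Icc (0 : ℝ) 1, volume B * (2 ^ d * ∫⁻ y in B, g y) :=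
        setLIntegral_mono' measurableSet_Icc hθ
    _ = _ := by simp

/-- Poincaré's inequality on a bounded convex set, in double integral form. -/
theorem lintegral_lintegral_sub_rpow_le {p : ℝ} (hp : 1 ≤ p) {η : E d → ℝ} (hη : ContDiff ℝ 1 η)
    {B : Set (E d)} (hB : MeasurableSet B) (hc : Convex ℝ B) {D : ℝ≥0∞} (hDtop : D ≠ ⊤)
    (hD : ∀ x ∈ B, ∀ y ∈ B, ‖y - x‖ₑ ≤ D) :
    ∫⁻ x in B, ∫⁻ y in B, ‖η y - η x‖ₑ ^ p ≤
      D ^ p * (volume B * (2 ^ d * ∫⁻ y in B, ‖gradient η y‖ₑ ^ p)) := by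
  have hp0 : 0 ≤ p := by linarith
  refine le_trans ?_ (mul_le_mul_right (lintegral_ball_segment_le hB hc
    (measurable_enorm_gradient_rpow hη p)) (D ^ p))
  have hDp : D ^ p ≠ ⊤ := ENNReal.rpow_ne_top_of_nonneg hp0 hDtop
  rw [← lintegral_const_mul' _ _ hDp]
  refine setLIntegral_mono' hB fun x hx => ?_
  rw [← lintegral_const_mul' _ _ hDp]
  refine setLIntegral_mono' hB fun y hy => ?_
  have := enorm_sub_rpow_le_segment hp hη x (y - x) (t := 1) (by simp)
  rw [one_smul, add_sub_cancel] at this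
  exact this.trans (mul_le_mul_left (ENNReal.rpow_le_rpow (hD x hx y hy) hp0) _)

end Calculus

/-! ### Surface measure of Lipschitz graphs. -/

section Graph

variable {d : ℕ} {e : E d}

/-- Fubini's theorem for the decomposition of space into a line and its orthogonal complement. -/
theorem lintegral_eq_lintegral_orthogonal (he : ‖e‖ = 1) {g : E d → ℝ≥0∞} (hg : Measurable g) :
    ∫⁻ x, g x = ∫⁻ z : (ℝ ∙ e)ᗮ, ∫⁻ τ : ℝ, g ((z : E d) + τ • e) := by
  have h1 := (Submodule.measurePreserving_measurableEquivProd (ℝ ∙ e) (0 : E d)).symm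
  rw [InnerProductSpace.euclideanHausdorffMeasure_eq_volume] at h1
  have h2 := (LinearIsometryEquiv.toSpanUnitSingleton (𝕜 := ℝ) e he).measurePreserving
  have h3 := h1.comp (h2.prod (MeasurePreserving.id (volume : Measure (ℝ ∙ e)ᗮ)))
  have hm : Measurable fun a => g (((ℝ ∙ e).measurableEquivProd (0 : E d)).symm
      (Prod.map (LinearIsometryEquiv.toSpanUnitSingleton (𝕜 := ℝ) e he) id a)) :=
    hg.comp h3.measurable
  rw [← h3.lintegral_comp hg]
  simp only [Function.comp_apply]
  rw [lintegral_prod_symm' _ hm]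
  refine lintegral_congr fun z => lintegral_congr fun τ => ?_
  simp [add_comm]

/-- The parametrization of a graph over a hyperplane. -/
def graphMap (e : E d) (γ : (ℝ ∙ e)ᗮ → ℝ) (z : (ℝ ∙ e)ᗮ) : E d := (z : E d) + γ z • e

theorem lipschitzWith_graphMap (he : ‖e‖ = 1) {K : ℝ≥0} {γ : (ℝ ∙ e)ᗮ → ℝ}
    (hγ : LipschitzWith K γ) : LipschitzWith (1 + K) (graphMap e γ) := by
  have h1 : LipschitzWith 1 (fun z : (ℝ ∙ e)ᗮ => (z : E d)) := LipschitzWith.subtype_val _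
  have h2 : LipschitzWith K (fun z => γ z • e) := by
    refine LipschitzWith.of_dist_le_mul fun x y => ?_
    rw [dist_eq_norm, ← sub_smul, norm_smul, he, mul_one, ← dist_eq_norm]
    exact hγ.dist_le_mul x y
  exact h1.add h2

theorem finrank_orthogonal_span (he : ‖e‖ = 1) : Module.finrank ℝ (ℝ ∙ e)ᗮ = d - 1 := by
  have h0 : e ≠ 0 := by rintro rfl; simp at he
  have h := (ℝ ∙ e).finrank_add_finrank_orthogonal
  rw [finrank_span_singleton h0, finrank_euclideanSpace_fin] at h
  omega

/-- A `(1 + K)`-Lipschitz map enlarges `(d-1)`-dimensional Hausdorff measure by at most `(1 +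
K)^(d-1)`. The normalizing constant appears on both sides, and on the hyperplane the normalized
measure is Lebesgue measure. -/
theorem hausdorff_le_of_subset_range_graphMap (he : ‖e‖ = 1) {K : ℝ≥0} {γ : (ℝ ∙ e)ᗮ → ℝ}
    (hγ : LipschitzWith K γ) {B : Set (E d)} (hB : B ⊆ range (graphMap e γ)) :
    (Measure.euclideanHausdorffMeasure (d - 1) : Measure (E d)) B ≤
      ((1 + K) ^ (d - 1) : ℝ≥0) * volume (graphMap e γ ⁻¹' B) := by
  have h1 := (lipschitzWith_graphMap he hγ).hausdorffMeasure_image_le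
    (d := ((d - 1 : ℕ) : ℝ)) (by positivity) (graphMap e γ ⁻¹' B)
  rw [image_preimage_eq_of_subset hB] at h1
  have h2 : (volume : Measure (ℝ ∙ e)ᗮ) = Measure.euclideanHausdorffMeasure (d - 1) := by
    rw [← InnerProductSpace.euclideanHausdorffMeasure_eq_volume, finrank_orthogonal_span he]
  rw [h2, Measure.euclideanHausdorffMeasure_def, Measure.euclideanHausdorffMeasure_def,
    Measure.smul_apply, Measure.smul_apply, ENNReal.smul_def, ENNReal.smul_def, smul_eq_mul,
    smul_eq_mul, mul_left_comm]
  refine mul_le_mul_right (h1.trans (le_of_eq ?_)) _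
  simp

/-- Surface measure on `S` is dominated, as a measure, by a multiple of the image of Lebesgue
measure under the parametrization. Only this upper bound is needed, so no area formula enters. -/
theorem lintegral_graph_le (he : ‖e‖ = 1) {K : ℝ≥0} {γ : (ℝ ∙ e)ᗮ → ℝ}
    (hγ : LipschitzWith K γ) {S : Set (E d)}
    (hSr : S ⊆ range (graphMap e γ)) {F : E d → ℝ≥0∞} (hF : Measurable F) :
    ∫⁻ y in S, F y ∂(Measure.euclideanHausdorffMeasure (d - 1) : Measure (E d)) ≤
      ((1 + K) ^ (d - 1) : ℝ≥0) * ∫⁻ z in graphMap e γ ⁻¹' S, F (graphMap e γ z) := by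
  have hm : Measurable (graphMap e γ) := (lipschitzWith_graphMap he hγ).continuous.measurable
  have hle : (Measure.euclideanHausdorffMeasure (d - 1) : Measure (E d)).restrict S ≤
      (((1 + K) ^ (d - 1) : ℝ≥0) : ℝ≥0∞) •
        ((volume.restrict (graphMap e γ ⁻¹' S)).map (graphMap e γ)) := by
    refine Measure.le_intro fun B hB _ => ?_
    rw [Measure.restrict_apply hB, Measure.smul_apply, Measure.map_apply hm hB,
      Measure.restrict_apply (hm hB), smul_eq_mul, ← preimage_inter]
    exact hausdorff_le_of_subset_range_graphMap he hγ (inter_subset_right.trans hSr)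
  refine (lintegral_mono' hle le_rfl).trans ?_
  rw [lintegral_smul_measure, lintegral_map hF hm, smul_eq_mul]

/-- Integrating over a graph thickened in the vertical direction. -/
theorem lintegral_thickened_graph_le (he : ‖e‖ = 1) {K : ℝ≥0} {γ : (ℝ ∙ e)ᗮ → ℝ}
    (hγ : LipschitzWith K γ) {S O : Set (E d)} (hS : MeasurableSet S) (hO : MeasurableSet O)
    (hSr : S ⊆ range (graphMap e γ)) {h : ℝ} (hh : 0 < h)
    (hSO : ∀ y ∈ S, ∀ θ ∈ Ioc (0 : ℝ) 1, y + θ • h • e ∈ O) {g : E d → ℝ≥0∞} (hg : Measurable g) :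
    ∫⁻ y in S, (∫⁻ θ in Icc (0 : ℝ) 1, g (y + θ • h • e))
        ∂(Measure.euclideanHausdorffMeasure (d - 1) : Measure (E d)) ≤
      ((1 + K) ^ (d - 1) : ℝ≥0) * (ENNReal.ofReal h⁻¹ * ∫⁻ x in O, g x) := by
  have hm : Measurable (graphMap e γ) := (lipschitzWith_graphMap he hγ).continuous.measurable
  have hgm : Measurable fun z : E d × ℝ => g (z.1 + z.2 • h • e) := hg.comp (by fun_prop)
  refine (lintegral_graph_le he hγ hSr hgm.lintegral_prod_right').trans ?_
  refine mul_le_mul_right ?_ _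
  rw [← lintegral_indicator hO, lintegral_eq_lintegral_orthogonal he (hg.indicator hO),
    ← lintegral_const_mul' _ _ ENNReal.ofReal_ne_top]
  refine (setLIntegral_mono' (hm hS) fun z hz => ?_).trans (setLIntegral_le_lintegral _ _)
  have hfm : Measurable fun τ : ℝ => O.indicator g ((z : E d) + τ • e) :=
    (hg.indicator hO).comp (by fun_prop)
  -- The endpoint `θ = 0` lies on the graph and may fail to be in `O`; it is dropped as a null set.
  -- The substitution `τ = hθ` then produces the factor `h⁻¹`.
  calc ∫⁻ θ in Icc (0 : ℝ) 1, g (graphMap e γ z + θ • h • e)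
      = ∫⁻ θ in Ioc (0 : ℝ) 1, g (graphMap e γ z + θ • h • e) := by
        rw [restrict_Ioc_eq_restrict_Icc]
    _ ≤ ∫⁻ θ in Ioc (0 : ℝ) 1, O.indicator g ((z : E d) + (γ z + h • θ) • e) := by
        refine setLIntegral_mono' measurableSet_Ioc fun θ hθ => ?_
        have h1 : (z : E d) + (γ z + h • θ) • e = graphMap e γ z + θ • h • e := by
          rw [graphMap, smul_eq_mul]
          module
        rw [h1, indicator_of_mem (hSO _ hz θ hθ)]
    _ ≤ ∫⁻ θ, O.indicator g ((z : E d) + (γ z + h • θ) • e) := setLIntegral_le_lintegral _ _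
    _ = ENNReal.ofReal h⁻¹ * ∫⁻ τ, O.indicator g ((z : E d) + (γ z + τ) • e) := by
        have hfm' : Measurable fun τ : ℝ => O.indicator g ((z : E d) + (γ z + τ) • e) :=
          hfm.comp (measurable_const_add (γ z))
        rw [← lintegral_map (f := fun τ : ℝ => O.indicator g ((z : E d) + (γ z + τ) • e))
          (g := fun θ : ℝ => h • θ) hfm' (by fun_prop), Measure.map_addHaar_smul _ hh.ne',
          lintegral_smul_measure]
        simp [abs_of_pos hh]
    _ = _ := by
        rw [lintegral_add_left_eq_self (fun τ => O.indicator g ((z : E d) + τ • e))]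

end Graph

/-! ### Boundary charts and the trace inequality. -/

section LipschitzBoundary

variable {d : ℕ} {Ω : Set (E d)}

/-- A boundary chart of `Ω` at `x` with a uniform radius. -/
theorem HasLipschitzBoundary.exists_chart (h : HasLipschitzBoundary Ω) {x : E d}
    (hx : x ∈ frontier Ω) : ∃ (e : E d) (K : ℝ≥0) (γ : (ℝ ∙ e)ᗮ → ℝ) (R : ℝ), ‖e‖ = 1 ∧
      LipschitzWith K γ ∧ 0 < R ∧ ∀ y ∈ Metric.ball x R,
        (y ∈ Ω ↔ γ ((ℝ ∙ e)ᗮ.orthogonalProjectionOnto y) < inner ℝ e y) := by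
  obtain ⟨e, K, γ, he, hγ, hev⟩ := h x hx
  obtain ⟨R, hR, hball⟩ := Metric.eventually_nhds_iff_ball.1 hev
  exact ⟨e, K, γ, R, he, hγ, hR, hball⟩

theorem inner_add_smul_self {e : E d} (he : ‖e‖ = 1) (y : E d) (t : ℝ) :
    inner ℝ e (y + t • e) = inner ℝ e y + t := by
  rw [inner_add_right, inner_smul_right, real_inner_self_eq_norm_sq, he]
  ring

theorem orthogonalProjectionOnto_add_smul_self {e : E d} (y : E d) (t : ℝ) :
    (ℝ ∙ e)ᗮ.orthogonalProjectionOnto (y + t • e) = (ℝ ∙ e)ᗮ.orthogonalProjectionOnto y := by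
  rw [map_add, map_smul, Submodule.orthogonalProjectionOnto_orthogonalComplement_singleton_eq_zero,
    smul_zero, add_zero]

theorem eq_graphMap {e : E d} (he : ‖e‖ = 1) {γ : (ℝ ∙ e)ᗮ → ℝ} {y : E d}
    (h : γ ((ℝ ∙ e)ᗮ.orthogonalProjectionOnto y) = inner ℝ e y) :
    graphMap e γ ((ℝ ∙ e)ᗮ.orthogonalProjectionOnto y) = y := by
  rw [graphMap, h, Submodule.orthogonalProjectionOnto_orthogonal]
  simp [Submodule.starProjection_unit_singleton ℝ he]

/-- In a boundary chart, boundary points lie on the graph. -/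
theorem chart_eq_of_mem_frontier (hΩ : IsOpen Ω) {e : E d} {K : ℝ≥0} {γ : (ℝ ∙ e)ᗮ → ℝ}
    (hγ : LipschitzWith K γ) {x : E d} {R : ℝ} (hball : ∀ y ∈ Metric.ball x R,
      (y ∈ Ω ↔ γ ((ℝ ∙ e)ᗮ.orthogonalProjectionOnto y) < inner ℝ e y)) {y : E d}
    (hy : y ∈ Metric.ball x R) (hyf : y ∈ frontier Ω) :
    γ ((ℝ ∙ e)ᗮ.orthogonalProjectionOnto y) = inner ℝ e y := by
  rcases lt_trichotomy (γ ((ℝ ∙ e)ᗮ.orthogonalProjectionOnto y)) (inner ℝ e y) with h | h | h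
  · rw [hΩ.frontier_eq] at hyf
    exact absurd ((hball y hy).2 h) hyf.2
  · exact h
  · exfalso
    -- A point strictly below the graph has a neighbourhood below the graph, which misses `Ω`; this
    -- contradicts membership in the closure.
    have h1 : IsOpen {y : E d | inner ℝ e y < γ ((ℝ ∙ e)ᗮ.orthogonalProjectionOnto y)} :=
      isOpen_lt (by fun_prop) (hγ.continuous.comp (by fun_prop))
    obtain ⟨w, hw, hwΩ⟩ := mem_closure_iff.1 (frontier_subset_closure hyf) _
      (h1.inter Metric.isOpen_ball) ⟨h, hy⟩
    exact lt_asymm hw.1 ((hball w hw.2).1 hwΩ)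

theorem add_smul_mem_ball {x y e : E d} (he : ‖e‖ = 1) {r t : ℝ} (hy : y ∈ Metric.ball x r)
    (ht : |t| ≤ r) : y + t • e ∈ Metric.ball x (2 * r) := by
  rw [Metric.mem_ball, dist_eq_norm] at hy ⊢
  have : y + t • e - x = (y - x) + t • e := by abel
  rw [this]
  refine (norm_add_le _ _).trans_lt ?_
  rw [norm_smul, he, Real.norm_eq_abs]
  linarith

theorem rpow_enorm_le_add {p : ℝ} (hp : 1 ≤ p) (a b : ℝ) :
    ‖a‖ₑ ^ p ≤ 2 ^ (p - 1) * (‖b‖ₑ ^ p + ‖b - a‖ₑ ^ p) := by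
  have hp0 : 0 ≤ p := by linarith
  refine le_trans ?_ (ENNReal.rpow_add_le_mul_rpow_add_rpow _ _ hp)
  refine ENNReal.rpow_le_rpow ?_ hp0
  rw [enorm_sub_rev]
  calc ‖a‖ₑ = ‖b + (a - b)‖ₑ := by rw [add_sub_cancel]
    _ ≤ _ := enorm_add_le _ _

/-- Compare `η y` with `η (y + θ • v)` for each `θ`, bound the increment by the gradient along the
segment, and average over `θ`. The average replaces a point value by an integral, which is what a
trace estimate needs. -/
theorem rpow_enorm_le_segment {p : ℝ} (hp : 1 ≤ p) {η : E d → ℝ} (hη : ContDiff ℝ 1 η)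
    (y v : E d) : ‖η y‖ₑ ^ p ≤ 2 ^ (p - 1) * ∫⁻ θ in Icc (0 : ℝ) 1,
      (‖η (y + θ • v)‖ₑ ^ p + ‖v‖ₑ ^ p * ‖gradient η (y + θ • v)‖ₑ ^ p) := by
  have h2 : (2 : ℝ≥0∞) ^ (p - 1) ≠ ⊤ := ENNReal.rpow_ne_top_of_nonneg (by linarith) (by simp)
  have hv : ‖v‖ₑ ^ p ≠ ⊤ := ENNReal.rpow_ne_top_of_nonneg (by linarith) (by simp)
  have hm : Measurable fun θ : ℝ => ‖η (y + θ • v)‖ₑ ^ p :=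
    (hη.continuous.comp (by fun_prop)).measurable.enorm.pow_const p
  rw [lintegral_add_left hm, lintegral_const_mul' _ _ hv]
  set G := ‖v‖ₑ ^ p * ∫⁻ θ in Icc (0 : ℝ) 1, ‖gradient η (y + θ • v)‖ₑ ^ p
  calc ‖η y‖ₑ ^ p = ∫⁻ θ in Icc (0 : ℝ) 1, ‖η y‖ₑ ^ p := by simp
    _ ≤ ∫⁻ θ in Icc (0 : ℝ) 1, 2 ^ (p - 1) * (‖η (y + θ • v)‖ₑ ^ p + G) := by
        refine setLIntegral_mono' measurableSet_Icc fun θ hθ => ?_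
        refine (rpow_enorm_le_add hp (η y) (η (y + θ • v))).trans ?_
        gcongr
        exact enorm_sub_rpow_le_segment hp hη y v hθ
    _ = _ := by
        rw [lintegral_const_mul' _ _ h2, lintegral_add_left hm]
        simp

/-- The `p`-energy of a function on a set. -/
noncomputable def energy (p : ℝ) (O : Set (E d)) (η : E d → ℝ) : ℝ≥0∞ :=
  ∫⁻ x in O, ‖η x‖ₑ ^ p

/-- The `p`-energy of the gradient of a function on a set. -/
noncomputable def gradEnergy (p : ℝ) (O : Set (E d)) (η : E d → ℝ) : ℝ≥0∞ :=
  ∫⁻ x in O, ‖gradient η x‖ₑ ^ p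

/-- Each boundary point near `x` is joined to `Ω` by the segment in the inward direction `e`. Its
value is controlled by the function and its gradient along that segment, and integrating over the
boundary piece turns the segments into a volume integral over part of `Ω`. -/
theorem exists_local_trace_bound (hΩ : IsOpen Ω) (hlip : HasLipschitzBoundary Ω) {p : ℝ}
    (hp : 1 ≤ p) {x : E d} (hx : x ∈ frontier Ω) :
    ∃ N ∈ 𝓝 x, ∃ C : ℝ≥0, ∀ η : E d → ℝ, ContDiff ℝ 1 η →
      ∫⁻ y in N, ‖η y‖ₑ ^ p ∂(surf Ω) ≤ C * (energy p Ω η + gradEnergy p Ω η) := by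
  obtain ⟨e, K, γ, R, he, hγ, hR, hball⟩ := hlip.exists_chart hx
  have h2 : (2 : ℝ≥0∞) ^ (p - 1) ≠ ⊤ := ENNReal.rpow_ne_top_of_nonneg (by linarith) (by simp)
  -- Points of the half ball shifted by at most `R / 2` stay in the ball of radius `R` on which the
  -- chart is valid.
  set h : ℝ := R / 2 with hh
  have hh0 : 0 < h := by positivity
  have hv : ‖h • e‖ₑ ^ p ≠ ⊤ := ENNReal.rpow_ne_top_of_nonneg (by linarith) (by simp)
  have hsub : Metric.ball x h ⊆ Metric.ball x R := Metric.ball_subset_ball (by linarith)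
  set S := Metric.ball x h ∩ frontier Ω with hS
  have hSm : MeasurableSet S := measurableSet_ball.inter isClosed_frontier.measurableSet
  have hgr : ∀ y ∈ S, γ ((ℝ ∙ e)ᗮ.orthogonalProjectionOnto y) = inner ℝ e y := fun y hy =>
    chart_eq_of_mem_frontier hΩ hγ hball (hsub hy.1) hy.2
  have hSr : S ⊆ range (graphMap e γ) := fun y hy => ⟨_, eq_graphMap he (hgr y hy)⟩
  have hSO : ∀ y ∈ S, ∀ θ ∈ Ioc (0 : ℝ) 1, y + θ • h • e ∈ Ω := by
    intro y hy θ hθ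
    rw [smul_smul]
    have hpos : 0 < θ * h := mul_pos hθ.1 hh0
    have hmem : y + (θ * h) • e ∈ Metric.ball x R := by
      have := add_smul_mem_ball he hy.1 (t := θ * h) (by
        rw [abs_of_pos hpos]; nlinarith [hθ.2])
      rwa [hh, mul_div_cancel₀ _ two_ne_zero] at this
    rw [hball _ hmem, orthogonalProjectionOnto_add_smul_self, inner_add_smul_self he, hgr y hy]
    linarith
  set A : ℝ≥0∞ := 2 ^ (p - 1) * (((1 + K) ^ (d - 1) : ℝ≥0) * (ENNReal.ofReal h⁻¹ *
    (1 + ‖h • e‖ₑ ^ p))) with hA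
  have hAtop : A ≠ ⊤ := ENNReal.mul_ne_top h2 (ENNReal.mul_ne_top ENNReal.coe_ne_top
    (ENNReal.mul_ne_top ENNReal.ofReal_ne_top (ENNReal.add_ne_top.2 ⟨ENNReal.one_ne_top, hv⟩)))
  refine ⟨Metric.ball x h, Metric.ball_mem_nhds x hh0, A.toNNReal, fun η hη => ?_⟩
  rw [ENNReal.coe_toNNReal hAtop, Measure.restrict_restrict measurableSet_ball]
  have hm1 : Measurable fun w => ‖η w‖ₑ ^ p := hη.continuous.measurable.enorm.pow_const p
  have hm2 := measurable_enorm_gradient_rpow hη p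
  set g : E d → ℝ≥0∞ := fun w => ‖η w‖ₑ ^ p + ‖h • e‖ₑ ^ p * ‖gradient η w‖ₑ ^ p with hg
  have hgm : Measurable g := hm1.add (hm2.const_mul _)
  calc ∫⁻ y in S, ‖η y‖ₑ ^ p ∂(Measure.euclideanHausdorffMeasure (d - 1) : Measure (E d))
      ≤ ∫⁻ y in S, 2 ^ (p - 1) * (∫⁻ θ in Icc (0 : ℝ) 1, g (y + θ • h • e))
          ∂(Measure.euclideanHausdorffMeasure (d - 1) : Measure (E d)) :=
        lintegral_mono fun y => rpow_enorm_le_segment hp hη y (h • e)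
    _ = 2 ^ (p - 1) * ∫⁻ y in S, (∫⁻ θ in Icc (0 : ℝ) 1, g (y + θ • h • e))
          ∂(Measure.euclideanHausdorffMeasure (d - 1) : Measure (E d)) :=
        lintegral_const_mul' _ _ h2
    _ ≤ 2 ^ (p - 1) * (((1 + K) ^ (d - 1) : ℝ≥0) * (ENNReal.ofReal h⁻¹ * ∫⁻ x in Ω, g x)) :=
        mul_le_mul_right (lintegral_thickened_graph_le he hγ hSm hΩ.measurableSet hSr hh0 hSO
          hgm) _
    _ ≤ 2 ^ (p - 1) * (((1 + K) ^ (d - 1) : ℝ≥0) * (ENNReal.ofReal h⁻¹ *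
          ((1 + ‖h • e‖ₑ ^ p) * (energy p Ω η + gradEnergy p Ω η)))) := by
        gcongr
        rw [hg, lintegral_add_left hm1, lintegral_const_mul' _ _ hv, add_mul]
        refine add_le_add ?_ (mul_le_mul_right le_add_self _)
        rw [one_mul]
        exact le_self_add
    _ = A * (energy p Ω η + gradEnergy p Ω η) := by rw [hA]; ring

/-- The trace inequality for continuously differentiable functions on a Lipschitz domain. -/
theorem exists_trace_bound (hΩ : IsOpen Ω) (hb : Bornology.IsBounded Ω)
    (hlip : HasLipschitzBoundary Ω) {p : ℝ} (hp : 1 ≤ p) :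
    ∃ C : ℝ≥0, ∀ η : E d → ℝ, ContDiff ℝ 1 η →
      ∫⁻ y, ‖η y‖ₑ ^ p ∂(surf Ω) ≤ C * (energy p Ω η + gradEnergy p Ω η) := by
  have hcomp : IsCompact (frontier Ω) := Metric.isCompact_of_isClosed_isBounded isClosed_frontier
    (hb.closure.subset frontier_subset_closure)
  have key : ∃ C : ℝ≥0, ∀ η : E d → ℝ, ContDiff ℝ 1 η →
      ∫⁻ y in frontier Ω, ‖η y‖ₑ ^ p ∂(surf Ω) ≤ C * (energy p Ω η + gradEnergy p Ω η) := by
    -- Having a bound passes to subsets and finite unions and holds locally, so it holds on the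
    -- compact boundary.
    refine hcomp.induction_on (p := fun S => ∃ C : ℝ≥0, ∀ η : E d → ℝ, ContDiff ℝ 1 η →
      ∫⁻ y in S, ‖η y‖ₑ ^ p ∂(surf Ω) ≤ C * (energy p Ω η + gradEnergy p Ω η)) ?_ ?_ ?_ ?_
    · exact ⟨0, fun η _ => by simp⟩
    · rintro S T hST ⟨C, hC⟩
      exact ⟨C, fun η hη => (lintegral_mono_set hST).trans (hC η hη)⟩
    · rintro S T ⟨C, hC⟩ ⟨C', hC'⟩
      refine ⟨C + C', fun η hη => (lintegral_union_le _ _ _).trans ?_⟩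
      rw [ENNReal.coe_add, add_mul]
      exact add_le_add (hC η hη) (hC' η hη)
    · intro x hx
      obtain ⟨N, hN, C, hC⟩ := exists_local_trace_bound hΩ hlip hp hx
      exact ⟨N, mem_nhdsWithin_of_mem_nhds hN, C, hC⟩
  simpa only [Measure.restrict_restrict isClosed_frontier.measurableSet, inter_self] using key

/-- This is the trace inequality with exponent one for the constant function `1`. -/
theorem surf_univ_lt_top (hΩ : IsOpen Ω) (hb : Bornology.IsBounded Ω)
    (hlip : HasLipschitzBoundary Ω) : surf Ω univ < ⊤ := by
  obtain ⟨C, hC⟩ := exists_trace_bound hΩ hb hlip le_rfl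
  have h := hC (fun _ => 1) contDiff_const
  simp only [energy, gradEnergy, gradient_fun_const, enorm_one, lintegral_one,
    enorm_zero, ENNReal.rpow_one, lintegral_zero, add_zero] at h
  refine h.trans_lt (ENNReal.mul_lt_top ENNReal.coe_lt_top ?_)
  rw [Measure.restrict_apply_univ]
  exact hb.measure_lt_top

end LipschitzBoundary

/-! ### The Poincaré–Wirtinger inequality on a connected Lipschitz domain. -/

section Poincare

variable {d : ℕ} {Ω : Set (E d)} {p : ℝ}

theorem energy_mono {A B : Set (E d)} (h : A ⊆ B) (η : E d → ℝ) : energy p A η ≤ energy p B η :=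
  lintegral_mono_set h

theorem gradEnergy_mono {A B : Set (E d)} (h : A ⊆ B) (η : E d → ℝ) :
    gradEnergy p A η ≤ gradEnergy p B η :=
  lintegral_mono_set h

theorem enorm_sub_le_of_mem_ball {z x y : E d} {r : ℝ} (hx : x ∈ Metric.ball z r)
    (hy : y ∈ Metric.ball z r) : ‖y - x‖ₑ ≤ ENNReal.ofReal (2 * r) := by
  rw [← ofReal_norm, ← dist_eq_norm]
  refine ENNReal.ofReal_le_ofReal ?_
  have := dist_triangle_right y x z
  rw [Metric.mem_ball] at hx hy
  linarith

theorem exists_ball_double_integral_bound (hp : 1 ≤ p) (z : E d) (r : ℝ) :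
    ∃ C : ℝ≥0, ∀ η : E d → ℝ, ContDiff ℝ 1 η →
      ∫⁻ x in Metric.ball z r, ∫⁻ y in Metric.ball z r, ‖η y - η x‖ₑ ^ p ≤
        C * gradEnergy p (Metric.ball z r) η := by
  have hD : ENNReal.ofReal (2 * r) ^ p ≠ ⊤ :=
    ENNReal.rpow_ne_top_of_nonneg (by linarith) ENNReal.ofReal_ne_top
  set A : ℝ≥0∞ := ENNReal.ofReal (2 * r) ^ p * (volume (Metric.ball z r) * 2 ^ d) with hA
  have hAtop : A ≠ ⊤ := ENNReal.mul_ne_top hD (ENNReal.mul_ne_top measure_ball_lt_top.ne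
    (ENNReal.pow_ne_top (by simp)))
  refine ⟨A.toNNReal, fun η hη => ?_⟩
  rw [ENNReal.coe_toNNReal hAtop]
  refine (lintegral_lintegral_sub_rpow_le hp hη measurableSet_ball (convex_ball z r)
    ENNReal.ofReal_ne_top fun x hx y hy => enorm_sub_le_of_mem_ball hx hy).trans (le_of_eq ?_)
  rw [hA, gradEnergy]
  ring

/-- On a ball inside the domain, a function is controlled by its values on any nonnegligible
subset together with its gradient. -/
theorem exists_ball_transfer (hp : 1 ≤ p) {z : E d} {r : ℝ} (hz : Metric.ball z r ⊆ Ω)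
    {A : Set (E d)} (hAB : A ⊆ Metric.ball z r) (hA0 : volume A ≠ 0) :
    ∃ C : ℝ≥0, ∀ η : E d → ℝ, ContDiff ℝ 1 η →
      energy p (Metric.ball z r) η ≤ C * (energy p A η + gradEnergy p Ω η) := by
  obtain ⟨C, hC⟩ := exists_ball_double_integral_bound hp z r
  set B := Metric.ball z r with hB
  have hBtop : volume B ≠ ⊤ := measure_ball_lt_top.ne
  have hAtop : volume A ≠ ⊤ := ne_top_of_le_ne_top hBtop (measure_mono hAB)
  have h2 : (2 : ℝ≥0∞) ^ (p - 1) ≠ ⊤ := ENNReal.rpow_ne_top_of_nonneg (by linarith) (by simp)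
  set M : ℝ≥0∞ := (volume A)⁻¹ * (2 ^ (p - 1) * (volume B + C)) with hM
  have hMtop : M ≠ ⊤ := ENNReal.mul_ne_top (ENNReal.inv_ne_top.2 hA0) (ENNReal.mul_ne_top h2
    (ENNReal.add_ne_top.2 ⟨hBtop, ENNReal.coe_ne_top⟩))
  refine ⟨M.toNNReal, fun η hη => ?_⟩
  rw [ENNReal.coe_toNNReal hMtop]
  have hm1 : Measurable fun w => ‖η w‖ₑ ^ p := hη.continuous.measurable.enorm.pow_const p
  -- Integrate `|η y|^p ≤ 2^(p-1) (|η x|^p + |η y - η x|^p)` over `x ∈ A` and `y ∈ B`; the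
  -- increments are handled by the double integral bound on the ball.
  have key : volume A * energy p B η ≤
      2 ^ (p - 1) * (volume B + C) * (energy p A η + gradEnergy p Ω η) := by
    calc volume A * energy p B η = ∫⁻ _ in A, ∫⁻ y in B, ‖η y‖ₑ ^ p := by
          simp [energy, mul_comm]
      _ ≤ ∫⁻ x in A, ∫⁻ y in B, 2 ^ (p - 1) * (‖η x‖ₑ ^ p + ‖η y - η x‖ₑ ^ p) := by
          refine lintegral_mono fun x => lintegral_mono fun y => ?_
          rw [enorm_sub_rev (η y)]
          exact rpow_enorm_le_add hp _ _
      _ = 2 ^ (p - 1) * (volume B * energy p A η +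
            ∫⁻ x in A, ∫⁻ y in B, ‖η y - η x‖ₑ ^ p) := by
          simp_rw [lintegral_const_mul' _ _ h2, lintegral_add_left measurable_const,
            lintegral_const, Measure.restrict_apply_univ]
          rw [lintegral_add_left (hm1.mul_const _), lintegral_mul_const _ hm1, energy,
            mul_comm (volume B)]
      _ ≤ 2 ^ (p - 1) * (volume B * energy p A η + C * gradEnergy p Ω η) := by
          gcongr
          exact (lintegral_mono_set hAB).trans
            ((hC η hη).trans (mul_le_mul_right (gradEnergy_mono hz η) _))
      _ ≤ 2 ^ (p - 1) * ((volume B + C) * energy p A η +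
            (volume B + C) * gradEnergy p Ω η) := by
          gcongr
          · exact le_self_add
          · exact le_add_self
      _ = _ := by ring
  rw [hM, mul_assoc, ← ENNReal.mul_le_iff_le_inv hA0 hAtop]
  exact key

/-- Near the point `x`, functions on `Ω` are controlled by their values on `B` and their
gradient. -/
def ControlledAt (p : ℝ) (Ω B : Set (E d)) (x : E d) : Prop :=
  ∃ N ∈ 𝓝 x, ∃ C : ℝ≥0, ∀ η : E d → ℝ, ContDiff ℝ 1 η →
    energy p (N ∩ Ω) η ≤ C * (energy p B η + gradEnergy p Ω η)

/-- The set of controlled points of `Ω` is open and contains `x₀`; by connectedness it suffices that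
it is relatively closed in `Ω`. -/
theorem controlledAt_of_mem (hp : 1 ≤ p) (hΩ : IsOpen Ω) (hconn : IsPreconnected Ω) {x₀ : E d}
    {r₀ : ℝ} (hr₀ : 0 < r₀) (hB : Metric.ball x₀ r₀ ⊆ Ω) {x : E d} (hx : x ∈ Ω) :
    ControlledAt p Ω (Metric.ball x₀ r₀) x := by
  set U : Set (E d) := {x | x ∈ Ω ∧ ControlledAt p Ω (Metric.ball x₀ r₀) x} with hU
  suffices h : Ω ⊆ U from (h hx).2
  have hx₀ : x₀ ∈ Metric.ball x₀ r₀ := Metric.mem_ball_self hr₀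
  refine hconn.subset_of_closure_inter_subset ?_ ⟨x₀, hB hx₀, hB hx₀, ?_⟩ ?_
  · rw [isOpen_iff_mem_nhds]
    rintro y ⟨hy, N, hN, C, hC⟩
    filter_upwards [hΩ.mem_nhds hy, eventually_mem_nhds_iff.2 hN] with w hw hw'
    exact ⟨hw, N, hw', C, hC⟩
  · refine ⟨Metric.ball x₀ r₀, Metric.ball_mem_nhds x₀ hr₀, 1, fun η _ => ?_⟩
    rw [ENNReal.coe_one, one_mul]
    exact (energy_mono inter_subset_left η).trans le_self_add
  · rintro y ⟨hyc, hyΩ⟩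
    refine ⟨hyΩ, ?_⟩
    obtain ⟨r, hr, hrΩ⟩ := Metric.isOpen_iff.1 hΩ y hyΩ
    obtain ⟨w, hwb, -, N, hN, C, hC⟩ := mem_closure_iff.1 hyc _ Metric.isOpen_ball
      (Metric.mem_ball_self hr)
    -- A ball in `Ω` about the limit point `y` meets the neighbourhood of a controlled point `w` in
    -- a nonempty open set. That set has positive measure, so control spreads from it to the ball.
    have hA : IsOpen (interior N ∩ Metric.ball y r) := isOpen_interior.inter Metric.isOpen_ball
    obtain ⟨C', hC'⟩ := exists_ball_transfer hp hrΩ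
      (inter_subset_right : interior N ∩ Metric.ball y r ⊆ _)
      (hA.measure_pos volume ⟨w, mem_interior_iff_mem_nhds.2 hN, hwb⟩).ne'
    refine ⟨Metric.ball y r, Metric.ball_mem_nhds y hr, C' * (C + 1), fun η hη => ?_⟩
    rw [ENNReal.coe_mul, ENNReal.coe_add, ENNReal.coe_one, mul_assoc]
    refine (energy_mono inter_subset_left η).trans ((hC' η hη).trans (mul_le_mul_right ?_ _))
    rw [add_mul, one_mul]
    refine add_le_add ((energy_mono ?_ η).trans (hC η hη)) le_add_self
    exact fun v hv => ⟨interior_subset hv.1, hrΩ hv.2⟩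

theorem chart_add_smul_mem {e : E d} (he : ‖e‖ = 1) {γ : (ℝ ∙ e)ᗮ → ℝ} {x : E d} {R : ℝ}
    (hball : ∀ y ∈ Metric.ball x R,
      (y ∈ Ω ↔ γ ((ℝ ∙ e)ᗮ.orthogonalProjectionOnto y) < inner ℝ e y)) {y : E d}
    (hy : y ∈ Metric.ball x (R / 2)) {t : ℝ} (ht0 : 0 ≤ t) (ht : t ≤ R / 2)
    (h : γ ((ℝ ∙ e)ᗮ.orthogonalProjectionOnto y) < inner ℝ e y + t) : y + t • e ∈ Ω := by
  have hmem : y + t • e ∈ Metric.ball x R := by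
    have := add_smul_mem_ball he hy (t := t) (by rwa [abs_of_nonneg ht0])
    rwa [mul_div_cancel₀ _ two_ne_zero] at this
  rwa [hball _ hmem, orthogonalProjectionOnto_add_smul_self, inner_add_smul_self he]

/-- Shifting inward by `h • e` carries a neighbourhood of `x` in `Ω` into a neighbourhood of the
interior point `x + h • e`, where control is known. The error of the shift is a translation
increment along segments inside `Ω`, hence bounded by the gradient. -/
theorem controlledAt_of_mem_frontier (hp : 1 ≤ p) (hΩ : IsOpen Ω) (hconn : IsPreconnected Ω)
    (hlip : HasLipschitzBoundary Ω) {x₀ : E d} {r₀ : ℝ} (hr₀ : 0 < r₀)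
    (hB : Metric.ball x₀ r₀ ⊆ Ω) {x : E d} (hx : x ∈ frontier Ω) :
    ControlledAt p Ω (Metric.ball x₀ r₀) x := by
  obtain ⟨e, K, γ, R, he, hγ, hR, hball⟩ := hlip.exists_chart hx
  have h2 : (2 : ℝ≥0∞) ^ (p - 1) ≠ ⊤ := ENNReal.rpow_ne_top_of_nonneg (by linarith) (by simp)
  set h : ℝ := R / 2 with hh
  have hh0 : 0 < h := by positivity
  have hv : ‖h • e‖ₑ ^ p ≠ ⊤ := ENNReal.rpow_ne_top_of_nonneg (by linarith) (by simp)
  have hxe : x + h • e ∈ Ω := by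
    refine chart_add_smul_mem he hball (Metric.mem_ball_self hh0) hh0.le le_rfl ?_
    rw [chart_eq_of_mem_frontier hΩ hγ hball (Metric.mem_ball_self hR) hx]
    linarith
  obtain ⟨N, hN, C, hC⟩ := controlledAt_of_mem hp hΩ hconn hr₀ hB hxe
  obtain ⟨ρ, hρ, hρN⟩ := Metric.mem_nhds_iff.1 (inter_mem hN (hΩ.mem_nhds hxe))
  -- The radius `ρ` makes the shifted points land in `N ∩ Ω`, and `h` keeps the segments inside the
  -- chart.
  set A := Metric.ball x (min ρ h) ∩ Ω with hA
  have hAm : MeasurableSet A := measurableSet_ball.inter hΩ.measurableSet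
  have hseg : ∀ y ∈ A, ∀ θ ∈ Icc (0 : ℝ) 1, y + θ • h • e ∈ Ω := by
    intro y hy θ hθ
    have hyh : y ∈ Metric.ball x h := Metric.ball_subset_ball (min_le_right _ _) hy.1
    have hyR : y ∈ Metric.ball x R := Metric.ball_subset_ball (by linarith) hyh
    rw [smul_smul]
    refine chart_add_smul_mem he hball hyh (mul_nonneg hθ.1 hh0.le) (by nlinarith [hθ.2]) ?_
    have := (hball y hyR).1 hy.2
    have := mul_nonneg hθ.1 hh0.le
    linarith
  set M : ℝ≥0∞ := 2 ^ (p - 1) * (C + ‖h • e‖ₑ ^ p) with hM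
  have hMtop : M ≠ ⊤ := ENNReal.mul_ne_top h2 (ENNReal.add_ne_top.2 ⟨ENNReal.coe_ne_top, hv⟩)
  refine ⟨Metric.ball x (min ρ h), Metric.ball_mem_nhds x (lt_min hρ hh0), M.toNNReal,
    fun η hη => ?_⟩
  rw [ENNReal.coe_toNNReal hMtop]
  have hm1 : Measurable fun w => ‖η w‖ₑ ^ p := hη.continuous.measurable.enorm.pow_const p
  have hmt : Measurable fun w => ‖η (w + h • e)‖ₑ ^ p := hm1.comp (measurable_add_const _)
  have h1 : ∫⁻ y in A, ‖η (y + h • e)‖ₑ ^ p ≤ energy p (N ∩ Ω) η := by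
    rw [energy, ← lintegral_indicator hAm]
    refine le_trans ?_ (lintegral_mono_set hρN)
    rw [← lintegral_indicator measurableSet_ball, ← lintegral_add_right_eq_self
      (μ := (volume : Measure (E d))) ((Metric.ball (x + h • e) ρ).indicator _) (h • e)]
    refine lintegral_mono fun y => ?_
    by_cases hy : y ∈ A
    · rw [indicator_of_mem hy, indicator_of_mem]
      have := Metric.ball_subset_ball (min_le_left ρ h) hy.1
      simpa [Metric.mem_ball] using this
    · rw [indicator_of_notMem hy]
      exact zero_le
  calc energy p A η ≤ ∫⁻ y in A, 2 ^ (p - 1) * (‖η (y + h • e)‖ₑ ^ p +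
        ‖η (y + h • e) - η y‖ₑ ^ p) := lintegral_mono fun y => rpow_enorm_le_add hp _ _
    _ = 2 ^ (p - 1) * ((∫⁻ y in A, ‖η (y + h • e)‖ₑ ^ p) +
        ∫⁻ y in A, ‖η (y + h • e) - η y‖ₑ ^ p) := by
        rw [lintegral_const_mul' _ _ h2, lintegral_add_left hmt]
    _ ≤ 2 ^ (p - 1) * (C * (energy p (Metric.ball x₀ r₀) η + gradEnergy p Ω η) +
        ‖h • e‖ₑ ^ p * gradEnergy p Ω η) := by
        gcongr
        · exact h1.trans (hC η hη)
        · exact lintegral_translate_sub_rpow_le hp hη _ hAm hΩ.measurableSet hseg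
    _ ≤ 2 ^ (p - 1) * (C * (energy p (Metric.ball x₀ r₀) η + gradEnergy p Ω η) +
        ‖h • e‖ₑ ^ p * (energy p (Metric.ball x₀ r₀) η + gradEnergy p Ω η)) := by
        gcongr
        exact le_add_self
    _ = _ := by rw [hM]; ring

/-- Every point of the compact set `closure Ω` is controlled from the fixed ball, so finitely many
neighbourhoods give a single constant. -/
theorem exists_domain_transfer (hp : 1 ≤ p) (hΩ : IsOpen Ω) (hb : Bornology.IsBounded Ω)
    (hconn : IsPreconnected Ω) (hlip : HasLipschitzBoundary Ω) {x₀ : E d} {r₀ : ℝ} (hr₀ : 0 < r₀)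
    (hB : Metric.ball x₀ r₀ ⊆ Ω) : ∃ C : ℝ≥0, ∀ η : E d → ℝ, ContDiff ℝ 1 η →
      energy p Ω η ≤ C * (energy p (Metric.ball x₀ r₀) η + gradEnergy p Ω η) := by
  have hcomp : IsCompact (closure Ω) := hb.isCompact_closure
  have key : ∃ C : ℝ≥0, ∀ η : E d → ℝ, ContDiff ℝ 1 η → energy p (closure Ω ∩ Ω) η ≤
      C * (energy p (Metric.ball x₀ r₀) η + gradEnergy p Ω η) := by
    refine hcomp.induction_on (p := fun S => ∃ C : ℝ≥0, ∀ η : E d → ℝ, ContDiff ℝ 1 η →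
      energy p (S ∩ Ω) η ≤ C * (energy p (Metric.ball x₀ r₀) η + gradEnergy p Ω η)) ?_ ?_ ?_ ?_
    · exact ⟨0, fun η _ => by simp [energy]⟩
    · rintro S T hST ⟨C, hC⟩
      exact ⟨C, fun η hη => (energy_mono (inter_subset_inter_left _ hST) η).trans (hC η hη)⟩
    · rintro S T ⟨C, hC⟩ ⟨C', hC'⟩
      refine ⟨C + C', fun η hη => ?_⟩
      rw [union_inter_distrib_right, ENNReal.coe_add, add_mul]
      exact (lintegral_union_le _ _ _).trans (add_le_add (hC η hη) (hC' η hη))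
    · intro x hx
      have : ControlledAt p Ω (Metric.ball x₀ r₀) x := by
        by_cases hxΩ : x ∈ Ω
        · exact controlledAt_of_mem hp hΩ hconn hr₀ hB hxΩ
        · exact controlledAt_of_mem_frontier hp hΩ hconn hlip hr₀ hB
            (by rw [hΩ.frontier_eq]; exact ⟨hx, hxΩ⟩)
      obtain ⟨N, hN, C, hC⟩ := this
      exact ⟨N, mem_nhdsWithin_of_mem_nhds hN, C, hC⟩
  rwa [inter_eq_self_of_subset_right subset_closure] at key

/-- The Poincaré–Wirtinger inequality on a bounded connected Lipschitz domain, for continuously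
differentiable functions. -/
theorem exists_poincare_wirtinger (hp : 1 ≤ p) (hΩ : IsOpen Ω) (hb : Bornology.IsBounded Ω)
    (hconn : IsConnected Ω) (hlip : HasLipschitzBoundary Ω) :
    ∃ C : ℝ≥0, ∀ η : E d → ℝ, ContDiff ℝ 1 η → ∃ c : ℝ,
      energy p Ω (fun x => η x - c) ≤ C * gradEnergy p Ω η := by
  obtain ⟨x₀, hx₀⟩ := hconn.nonempty
  obtain ⟨r₀, hr₀, hB⟩ := Metric.isOpen_iff.1 hΩ x₀ hx₀
  obtain ⟨C, hC⟩ := exists_domain_transfer hp hΩ hb hconn.isPreconnected hlip hr₀ hB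
  obtain ⟨C', hC'⟩ := exists_ball_double_integral_bound hp x₀ r₀
  set B := Metric.ball x₀ r₀ with hBdef
  have hB0 : volume B ≠ 0 := (Metric.measure_ball_pos volume x₀ hr₀).ne'
  have hBtop : volume B ≠ ⊤ := measure_ball_lt_top.ne
  set M : ℝ≥0∞ := C * ((volume B)⁻¹ * C' + 1) with hM
  have hMtop : M ≠ ⊤ := ENNReal.mul_ne_top ENNReal.coe_ne_top (ENNReal.add_ne_top.2
    ⟨ENNReal.mul_ne_top (ENNReal.inv_ne_top.2 hB0) ENNReal.coe_ne_top, ENNReal.one_ne_top⟩)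
  refine ⟨M.toNNReal, fun η hη => ?_⟩
  rw [ENNReal.coe_toNNReal hMtop]
  have hm : Measurable fun z : E d × E d => ‖η z.2 - η z.1‖ₑ ^ p :=
    ((hη.continuous.comp continuous_snd).sub
      (hη.continuous.comp continuous_fst)).measurable.enorm.pow_const p
  -- The constant subtracted is not a mean but the value `η y` at a point where the inner integral
  -- is at most its average over the ball.
  obtain ⟨y, -, hy⟩ := exists_le_setLAverage (f := fun x => ∫⁻ y in B, ‖η y - η x‖ₑ ^ p) hB0 hBtop
    hm.lintegral_prod_right'.aemeasurable
  refine ⟨η y, (hC (fun x => η x - η y) (hη.sub contDiff_const)).trans ?_⟩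
  have hg : gradEnergy p Ω (fun x => η x - η y) = gradEnergy p Ω η := by
    simp [gradEnergy, enorm_gradient, fderiv_sub_const]
  rw [hg, hM, mul_assoc, add_mul, one_mul, mul_assoc]
  gcongr
  refine hy.trans ?_
  rw [setLAverage_eq, ENNReal.div_eq_inv_mul]
  gcongr
  exact (hC' η hη).trans (mul_le_mul_right (gradEnergy_mono hB η) _)

end Poincare

/-! ### Translation and convolution in `L^s`. -/

section Mollification

open scoped Convolution
open ContinuousLinearMap (lsmul)

variable {d : ℕ} {X : Type*} [NormedAddCommGroup X]

/-- Translations are continuous in the mean. -/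
theorem exists_translate_bound {s : ℝ≥0∞} [Fact (1 ≤ s)] (hs : s ≠ ⊤) {F : E d → X}
    (hF : MemLp F s volume) {ε : ℝ≥0∞} (hε : ε ≠ 0) :
    ∃ ρ > 0, ∀ z : E d, ‖z‖ < ρ → eLpNorm (fun y => F (y - z) - F y) s volume ≤ ε := by
  have hmp : ∀ z : E d, MeasurePreserving (fun y : E d => y - z) volume volume := fun z =>
    measurePreserving_sub_right volume z
  let T : E d → C(E d, E d) := fun z => ⟨fun y => y - z, by fun_prop⟩
  have hT : Continuous T := by
    refine ContinuousMap.continuous_of_continuous_uncurry _ ?_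
    simp only [T, Function.uncurry_def, ContinuousMap.coe_mk]
    fun_prop
  have hcont : Tendsto (fun z : E d => Lp.compMeasurePreserving (T z) (hmp z) (hF.toLp F)) (𝓝 0)
      (𝓝 (Lp.compMeasurePreserving (T 0) (hmp 0) (hF.toLp F))) :=
    tendsto_const_nhds.compMeasurePreservingLp (hT.tendsto 0) hmp (hmp 0) hs
  have hev := hcont.eventually (Metric.closedEBall_mem_nhds _ (pos_iff_ne_zero.2 hε))
  obtain ⟨ρ, hρ, hball⟩ := Metric.eventually_nhds_iff_ball.1 hev
  refine ⟨ρ, hρ, fun z hz => ?_⟩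
  have h := hball z (by simpa using hz)
  rw [Lp.toLp_compMeasurePreserving, Lp.toLp_compMeasurePreserving,
    Lp.edist_toLp_toLp] at h
  refine le_trans (le_of_eq ?_) h
  congr 1
  ext y
  simp [T]

variable [NormedSpace ℝ X] [CompleteSpace X]

/-- Convolving with a probability density moves a function in `L^s` by no more than translations
in the support of the density do. -/
theorem eLpNorm_convolution_sub_le {s : ℝ≥0∞} [hs1 : Fact (1 ≤ s)] (hs : s ≠ ⊤) {F : E d → X}
    (hF : MemLp F s volume) (hFm : StronglyMeasurable F) {ψ : E d → ℝ} (hψ : Continuous ψ)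
    (hψc : HasCompactSupport ψ) (hψ0 : ∀ z, 0 ≤ ψ z) (hψ1 : ∫ z, ψ z = 1) {ε : ℝ≥0∞}
    (h : ∀ z ∈ Function.support ψ, eLpNorm (fun y => F (y - z) - F y) s volume ≤ ε) :
    eLpNorm (fun y => (ψ ⋆[lsmul ℝ ℝ, volume] F) y - F y) s volume ≤ ε := by
  have hs0 : s ≠ 0 := (one_pos.trans_le hs1.out).ne'
  have hp : 1 ≤ s.toReal := by
    rw [← ENNReal.toReal_one]
    exact ENNReal.toReal_mono hs hs1.out
  have hp0 : 0 < s.toReal := by linarith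
  have hψi : Integrable ψ := hψ.integrable_of_hasCompactSupport hψc
  set w : E d → ℝ≥0∞ := fun z => ENNReal.ofReal (ψ z) with hw
  have hwm : Measurable w := hψ.measurable.ennreal_ofReal
  have hw1 : ∫⁻ z, w z = 1 := by
    rw [← ofReal_integral_eq_lintegral_ofReal hψi (Eventually.of_forall hψ0), hψ1,
      ENNReal.ofReal_one]
  -- With `ψ` as the density of a probability measure, the convolution minus `F` is an average of
  -- the increments `F (y - z) - F y`, and Jensen's inequality applies.
  have hν : IsProbabilityMeasure (volume.withDensity w) := ⟨by
    rw [withDensity_apply _ MeasurableSet.univ, Measure.restrict_univ, hw1]⟩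
  have hloc : LocallyIntegrable F volume := hF.locallyIntegrable hs1.out
  have hjm : Measurable fun q : E d × E d => ‖F (q.1 - q.2) - F q.1‖ₑ := by
    have h1 : StronglyMeasurable fun q : E d × E d => F (q.1 - q.2) :=
      hFm.comp_measurable (by fun_prop)
    have h2 : StronglyMeasurable fun q : E d × E d => F q.1 :=
      hFm.comp_measurable measurable_fst
    exact (h1.sub h2).enorm
  have hpt : ∀ y, ‖(ψ ⋆[lsmul ℝ ℝ, volume] F) y - F y‖ₑ ^ s.toReal ≤
      ∫⁻ z, w z * ‖F (y - z) - F y‖ₑ ^ s.toReal := by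
    intro y
    have hi : Integrable fun z => ψ z • F (y - z) :=
      hψc.convolutionExists_left (lsmul ℝ ℝ) hψ hloc y
    have e1 : (ψ ⋆[lsmul ℝ ℝ, volume] F) y - F y = ∫ z, ψ z • (F (y - z) - F y) := by
      simp_rw [smul_sub]
      rw [integral_sub hi (hψi.smul_const _), integral_smul_const, hψ1, one_smul]
      rfl
    have hym : Measurable fun z => ‖F (y - z) - F y‖ₑ := hjm.comp measurable_prodMk_left
    calc ‖(ψ ⋆[lsmul ℝ ℝ, volume] F) y - F y‖ₑ ^ s.toReal
        ≤ (∫⁻ z, w z * ‖F (y - z) - F y‖ₑ) ^ s.toReal := by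
          rw [e1]
          gcongr
          refine (enorm_integral_le_lintegral_enorm _).trans (le_of_eq ?_)
          refine lintegral_congr fun z => ?_
          rw [enorm_smul, Real.enorm_of_nonneg (hψ0 z)]
      _ = (∫⁻ z, ‖F (y - z) - F y‖ₑ ∂(volume.withDensity w)) ^ s.toReal := by
          rw [lintegral_withDensity_eq_lintegral_mul _ hwm hym]
          rfl
      _ ≤ ∫⁻ z, ‖F (y - z) - F y‖ₑ ^ s.toReal ∂(volume.withDensity w) :=
          lintegral_rpow_le_of_prob hp hym.aemeasurable
      _ = _ := by
          rw [lintegral_withDensity_eq_lintegral_mul _ hwm (hym.pow_const _)]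
          rfl
  have hpow : ∀ (f : E d → X), eLpNorm f s volume ^ s.toReal = ∫⁻ y, ‖f y‖ₑ ^ s.toReal := by
    intro f
    rw [eLpNorm_eq_lintegral_rpow_enorm_toReal hs0 hs, ← ENNReal.rpow_mul, one_div,
      inv_mul_cancel₀ hp0.ne', ENNReal.rpow_one]
  rw [← ENNReal.rpow_le_rpow_iff hp0, hpow]
  have hjm2 : Measurable fun q : E d × E d => w q.2 * ‖F (q.1 - q.2) - F q.1‖ₑ ^ s.toReal :=
    (hwm.comp measurable_snd).mul (hjm.pow_const _)
  calc ∫⁻ y, ‖(ψ ⋆[lsmul ℝ ℝ, volume] F) y - F y‖ₑ ^ s.toReal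
      ≤ ∫⁻ y, ∫⁻ z, w z * ‖F (y - z) - F y‖ₑ ^ s.toReal := lintegral_mono hpt
    _ = ∫⁻ z, ∫⁻ y, w z * ‖F (y - z) - F y‖ₑ ^ s.toReal :=
        lintegral_lintegral_swap hjm2.aemeasurable
    _ ≤ ∫⁻ z, w z * ε ^ s.toReal := by
        refine lintegral_mono fun z => ?_
        rw [lintegral_const_mul' _ _ ENNReal.ofReal_ne_top, ← hpow]
        by_cases hz : z ∈ Function.support ψ
        · exact mul_le_mul_right (ENNReal.rpow_le_rpow (h z hz) hp0.le) _
        · rw [Function.notMem_support] at hz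
          simp [hw, hz]
    _ = ε ^ s.toReal := by rw [lintegral_mul_const _ hwm, hw1, one_mul]

theorem gradient_comp_sub_left {ψ : E d → ℝ} (hψ : ContDiff ℝ 1 ψ) (y w : E d) :
    gradient (fun w => ψ (y - w)) w = - gradient ψ (y - w) := by
  have h : HasFDerivAt (fun w => ψ (y - w)) ((fderiv ℝ ψ (y - w)).comp
      (-ContinuousLinearMap.id ℝ (E d))) w :=
    ((hψ.differentiable (by simp)) (y - w)).hasFDerivAt.comp w ((hasFDerivAt_id w).const_sub y)
  rw [gradient, gradient, h.fderiv, ← map_neg]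
  congr 1
  ext v
  simp

theorem inner_gradient (η : E d → ℝ) (x v : E d) :
    inner ℝ v (gradient η x) = fderiv ℝ η x v := by
  rw [real_inner_comm, gradient, InnerProductSpace.toDual_symm_apply]

/-- Where the mollification kernel only sees `Ω`, mollification commutes with taking weak
gradients. -/
theorem gradient_convolution_eq {Ω : Set (E d)} (hΩ : MeasurableSet Ω) {f : E d → ℝ}
    {G : E d → E d} (hw : IsWeakGradient Ω f G) (hf : LocallyIntegrable (Ω.indicator f) volume)
    {ψ : E d → ℝ} (hψ : ContDiff ℝ ∞ ψ)
    (hψc : HasCompactSupport ψ) {y : E d} (hy : ∀ z ∈ tsupport ψ, y - z ∈ Ω) :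
    gradient (ψ ⋆[lsmul ℝ ℝ, volume] (Ω.indicator f)) y =
      (ψ ⋆[lsmul ℝ ℝ, volume] (Ω.indicator G)) y := by
  have hψ1 : ContDiff ℝ 1 ψ := hψ.of_le (by exact_mod_cast le_top)
  have hκ : ContDiff ℝ ∞ fun w => ψ (y - w) := by fun_prop
  have hκc : HasCompactSupport fun w => ψ (y - w) :=
    hψc.comp_homeomorph (Homeomorph.subLeft y)
  have hκt : tsupport (fun w => ψ (y - w)) ⊆ Ω := by
    intro w hw'
    have : tsupport (ψ ∘ (Homeomorph.subLeft y)) = (Homeomorph.subLeft y) ⁻¹' tsupport ψ :=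
      tsupport_comp_eq_preimage ψ (Homeomorph.subLeft y)
    have hw2 : y - w ∈ tsupport ψ := by
      change w ∈ tsupport (ψ ∘ (Homeomorph.subLeft y)) at hw'
      rw [this] at hw'
      exact hw'
    simpa using hy _ hw2
  have hgκ : Continuous (gradient fun w => ψ (y - w)) :=
    continuous_gradient (hκ.of_le (by exact_mod_cast le_top))
  have hgκc : HasCompactSupport (gradient fun w => ψ (y - w)) :=
    (hκc.fderiv ℝ).comp_left (g := (InnerProductSpace.toDual ℝ (E d)).symm) (by simp)
  -- The reflected kernel `w ↦ ψ (y - w)` is an admissible test function on `Ω`. Reflection reverses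
  -- the sign of its gradient, which cancels the minus sign in the weak gradient identity.
  have e0 := hw _ hκ hκc hκt
  have i1 : ∫ x in Ω, f x • gradient (fun w => ψ (y - w)) x =
      ∫ x, Ω.indicator f x • gradient (fun w => ψ (y - w)) x := by
    rw [← integral_indicator hΩ]
    congr 1
    ext1 x
    by_cases hx : x ∈ Ω <;> simp [hx]
  have i2 : ∫ x in Ω, ψ (y - x) • G x = (ψ ⋆[lsmul ℝ ℝ, volume] (Ω.indicator G)) y := by
    rw [convolution_lsmul_swap, ← integral_indicator hΩ]
    congr 1
    ext1 x
    by_cases hx : x ∈ Ω <;> simp [hx]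
  rw [i1, i2] at e0
  refine ext_inner_left ℝ fun v => ?_
  have hder := hψc.hasFDerivAt_convolution_left (lsmul ℝ ℝ) hψ1 hf y
  have hint : Integrable fun x => Ω.indicator f x • gradient (fun w => ψ (y - w)) x :=
    hf.integrable_smul_right_of_hasCompactSupport hgκ hgκc
  have hex := (hψc.fderiv ℝ).convolutionExists_left ((lsmul ℝ ℝ).precompL (E d))
    (hψ1.continuous_fderiv (by simp)) hf y
  rw [inner_gradient, hder.fderiv, convolution_eq_swap, ← neg_inj, ← inner_neg_right, ← e0,
    ← integral_inner hint, ContinuousLinearMap.integral_apply hex.integrable_swap, ← integral_neg]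
  refine integral_congr_ae (Eventually.of_forall fun w => ?_)
  simp [gradient_comp_sub_left hψ1, inner_smul_right, mul_comm]

end Mollification

/-! ### Density of smooth functions in `W^{1,s}`. -/

section Density

open scoped Convolution Manifold
open ContinuousLinearMap (lsmul)

variable {d : ℕ} {Ω : Set (E d)}

/-- Small shifts of `N ∩ Ω`, together with a neighbourhood of them, stay inside `Ω`. -/
def InwardShiftable (Ω N : Set (E d)) : Prop :=
  ∀ ρ > 0, ∃ (c : E d) (δ : ℝ), 0 < δ ∧ ‖c‖ + δ < ρ ∧
    ∀ y ∈ N ∩ Ω, ∀ z ∈ Metric.closedBall c δ, y - z ∈ Ω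

theorem exists_inwardShiftable_of_mem (hΩ : IsOpen Ω) {x : E d} (hx : x ∈ Ω) :
    ∃ N, IsOpen N ∧ x ∈ N ∧ Bornology.IsBounded N ∧ InwardShiftable Ω N := by
  obtain ⟨r, hr, hrΩ⟩ := Metric.isOpen_iff.1 hΩ x hx
  refine ⟨Metric.ball x (r / 2), Metric.isOpen_ball, Metric.mem_ball_self (by positivity),
    Metric.isBounded_ball, fun ρ hρ => ⟨0, min ρ r / 3, by positivity, ?_, ?_⟩⟩
  · rw [norm_zero]
    linarith [min_le_left ρ r]
  · intro y hy z hz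
    refine hrΩ ?_
    have h1 : dist y x < r / 2 := hy.1
    have h2 : ‖z‖ ≤ min ρ r / 3 := by simpa using hz
    have h3 : dist (y - z) x ≤ dist y x + ‖z‖ := by
      rw [dist_eq_norm, dist_eq_norm, sub_right_comm]
      exact norm_sub_le _ _
    rw [Metric.mem_ball]
    linarith [min_le_right ρ r]

/-- Moving up by `t` along `e` with an error of size `δ` gains at least `t - δ` in height, while the
graph rises by at most `K * δ`. The choice `t = (K + 1) * δ` balances the two, and strictness comes
from `y` lying strictly above the graph. -/
theorem exists_inwardShiftable_of_mem_frontier (hlip : HasLipschitzBoundary Ω) {x : E d}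
    (hx : x ∈ frontier Ω) :
    ∃ N, IsOpen N ∧ x ∈ N ∧ Bornology.IsBounded N ∧ InwardShiftable Ω N := by
  obtain ⟨e, K, γ, R, he, hγ, hR, hball⟩ := hlip.exists_chart hx
  refine ⟨Metric.ball x (R / 2), Metric.isOpen_ball, Metric.mem_ball_self (by positivity),
    Metric.isBounded_ball, fun ρ hρ => ?_⟩
  set m : ℝ := min ρ (R / 2) with hm
  have hm0 : 0 < m := lt_min hρ (by positivity)
  have hK : (0 : ℝ) ≤ K := K.2
  -- The total displacement `t + δ = (K + 2) * δ` must be strictly below `m`.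
  set δ : ℝ := m / (K + 3) with hδ
  have hδ0 : 0 < δ := by positivity
  have hδm : δ * (K + 3) = m := div_mul_cancel₀ _ (by positivity)
  set t : ℝ := (K + 1) * δ with ht
  have ht0 : 0 < t := by positivity
  have htδ : t + δ < m := by rw [ht]; linarith
  refine ⟨-(t • e), δ, hδ0, ?_, ?_⟩
  · rw [norm_neg, norm_smul, he, Real.norm_eq_abs, abs_of_pos ht0]
    linarith [min_le_left ρ (R / 2)]
  · intro y hy z hz
    have hz' : ‖z + t • e‖ ≤ δ := by simpa [dist_eq_norm] using hz
    set w := y - z with hw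
    have hwy : y + t • e - w = z + t • e := by rw [hw]; abel
    have hyx : dist y x < R / 2 := hy.1
    have hyR : y ∈ Metric.ball x R := Metric.ball_subset_ball (by linarith) hy.1
    have hwR : w ∈ Metric.ball x R := by
      have h1 : ‖z‖ ≤ t + δ := by
        calc ‖z‖ = ‖(z + t • e) - t • e‖ := by rw [add_sub_cancel_right]
          _ ≤ ‖z + t • e‖ + ‖t • e‖ := norm_sub_le _ _
          _ ≤ t + δ := by
              rw [norm_smul, he, Real.norm_eq_abs, abs_of_pos ht0]
              linarith
      have h3 : dist (y - z) x ≤ dist y x + ‖z‖ := by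
        rw [dist_eq_norm, dist_eq_norm, sub_right_comm]
        exact norm_sub_le _ _
      rw [Metric.mem_ball]
      linarith [min_le_right ρ (R / 2)]
    rw [hball w hwR]
    have h1 := (hball y hyR).1 hy.2
    have h2 : inner ℝ e y + t - inner ℝ e w ≤ δ := by
      rw [← inner_add_smul_self he, ← inner_sub_right, hwy]
      refine (real_inner_le_norm _ _).trans ?_
      rwa [he, one_mul]
    have h3 : γ ((ℝ ∙ e)ᗮ.orthogonalProjectionOnto w) -
        γ ((ℝ ∙ e)ᗮ.orthogonalProjectionOnto y) ≤ K * δ := by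
      refine (le_abs_self _).trans ?_
      rw [← Real.dist_eq]
      refine (hγ.dist_le_mul _ _).trans (mul_le_mul_of_nonneg_left ?_ hK)
      rw [dist_comm, ← orthogonalProjectionOnto_add_smul_self y t, dist_eq_norm, ← map_sub, hwy]
      exact ((ℝ ∙ e)ᗮ.norm_orthogonalProjectionOnto_apply_le _).trans hz'
    have h4 : t = K * δ + δ := by rw [ht]; ring
    linarith

theorem exists_inwardShiftable (hΩ : IsOpen Ω) (hlip : HasLipschitzBoundary Ω) {x : E d}
    (hx : x ∈ closure Ω) :
    ∃ N, IsOpen N ∧ x ∈ N ∧ Bornology.IsBounded N ∧ InwardShiftable Ω N := by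
  by_cases hxΩ : x ∈ Ω
  · exact exists_inwardShiftable_of_mem hΩ hxΩ
  · exact exists_inwardShiftable_of_mem_frontier hlip (by rw [hΩ.frontier_eq]; exact ⟨hx, hxΩ⟩)

/-- Local approximation in `W^{1,s}` by functions smooth on the whole space. -/
theorem exists_local_smooth_approx {s : ℝ≥0∞} [hs1 : Fact (1 ≤ s)] (hs : s ≠ ⊤) (hΩ : IsOpen Ω)
    (ξ : sobolev Ω s) {N : Set (E d)} (hNo : IsOpen N) (hN : InwardShiftable Ω N) {ε : ℝ≥0∞}
    (hε : ε ≠ 0) : ∃ η : E d → ℝ, ContDiff ℝ ∞ η ∧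
      eLpNorm (fun x => η x - fn ξ x) s ((vol Ω).restrict N) ≤ ε ∧
      eLpNorm (fun x => gradient η x - grad ξ x) s ((vol Ω).restrict N) ≤ ε := by
  have hΩm := hΩ.measurableSet
  -- The extension by zero need not be weakly differentiable across the boundary. This is harmless
  -- because the kernel, centred at `c` instead of the origin, samples only `Ω` when evaluated on `N
  -- ∩ Ω`.
  set f : E d → ℝ := Ω.indicator (fn ξ) with hf
  set G : E d → E d := Ω.indicator (grad ξ) with hG
  have hfm : StronglyMeasurable f := (Lp.stronglyMeasurable (fn ξ)).indicator hΩm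
  have hGm : StronglyMeasurable G := (Lp.stronglyMeasurable (grad ξ)).indicator hΩm
  have hfL : MemLp f s volume := (memLp_indicator_iff_restrict hΩm).2 (Lp.memLp (fn ξ))
  have hGL : MemLp G s volume := (memLp_indicator_iff_restrict hΩm).2 (Lp.memLp (grad ξ))
  obtain ⟨ρ₁, hρ₁, h₁⟩ := exists_translate_bound hs hfL hε
  obtain ⟨ρ₂, hρ₂, h₂⟩ := exists_translate_bound hs hGL hε
  obtain ⟨c, δ, hδ, hcδ, hshift⟩ := hN (min ρ₁ ρ₂) (lt_min hρ₁ hρ₂)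
  let φ : ContDiffBump c := ⟨δ / 2, δ, half_pos hδ, half_lt_self hδ⟩
  set ψ : E d → ℝ := φ.normed volume with hψ
  have hψs : ContDiff ℝ ∞ ψ := φ.contDiff_normed
  have hψc : HasCompactSupport ψ := φ.hasCompactSupport_normed
  have hψt : tsupport ψ = Metric.closedBall c δ := φ.tsupport_normed_eq
  have hz : ∀ z ∈ Function.support ψ, ‖z‖ < min ρ₁ ρ₂ := by
    intro z hz
    have h1 : z ∈ Metric.closedBall c δ := hψt ▸ subset_tsupport ψ hz
    have h2 : ‖z‖ ≤ ‖c‖ + δ := by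
      rw [mem_closedBall_iff_norm] at h1
      calc ‖z‖ = ‖c + (z - c)‖ := by rw [add_sub_cancel]
        _ ≤ ‖c‖ + ‖z - c‖ := norm_add_le _ _
        _ ≤ _ := by linarith
    linarith
  have hmeas : (vol Ω).restrict N = (volume : Measure (E d)).restrict (N ∩ Ω) :=
    Measure.restrict_restrict hNo.measurableSet
  have hNΩ : MeasurableSet (N ∩ Ω) := hNo.measurableSet.inter hΩm
  have hloc : LocallyIntegrable f volume := hfL.locallyIntegrable hs1.out
  refine ⟨ψ ⋆[lsmul ℝ ℝ, volume] f, hψc.contDiff_convolution_left _ hψs hloc, ?_, ?_⟩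
  · refine le_trans ?_ (eLpNorm_convolution_sub_le hs hfL hfm hψs.continuous hψc φ.nonneg_normed
      φ.integral_normed fun z hz' => h₁ z ((hz z hz').trans_le (min_le_left _ _)))
    rw [hmeas]
    refine le_trans (le_of_eq (eLpNorm_congr_ae ?_)) (eLpNorm_restrict_le _ _ _ (N ∩ Ω))
    filter_upwards [ae_restrict_mem hNΩ] with y hy
    rw [hf, indicator_of_mem hy.2]
  · refine le_trans ?_ (eLpNorm_convolution_sub_le hs hGL hGm hψs.continuous hψc φ.nonneg_normed
      φ.integral_normed fun z hz' => h₂ z ((hz z hz').trans_le (min_le_right _ _)))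
    rw [hmeas]
    refine le_trans (le_of_eq (eLpNorm_congr_ae ?_)) (eLpNorm_restrict_le _ _ _ (N ∩ Ω))
    filter_upwards [ae_restrict_mem hNΩ] with y hy
    have hgr := gradient_convolution_eq hΩm ξ.2 hloc hψs hψc (y := y)
      (fun z hz' => hshift y hy z (hψt ▸ hz'))
    rw [hf]
    refine (congrArg (· - _) hgr).trans ?_
    simp only [hG]
    rw [indicator_of_mem hy.2]
    rfl

theorem gradient_sum_mul {ι : Type*} [Fintype ι] {a b : ι → E d → ℝ}
    (ha : ∀ i, Differentiable ℝ (a i)) (hb : ∀ i, Differentiable ℝ (b i)) (x : E d) :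
    gradient (fun x => ∑ i, a i x * b i x) x =
      ∑ i, (a i x • gradient (b i) x + b i x • gradient (a i) x) := by
  refine ext_inner_left ℝ fun v => ?_
  rw [inner_gradient, fderiv_fun_sum fun i _ => (ha i x).fun_mul (hb i x),
    inner_sum, sum_apply]
  refine Finset.sum_congr rfl fun i _ => ?_
  rw [fderiv_fun_mul (ha i).differentiableAt (hb i).differentiableAt, inner_add_right,
    inner_smul_right, inner_smul_right, inner_gradient, inner_gradient]
  rfl

theorem gradient_sum {ι : Type*} [Fintype ι] {a : ι → E d → ℝ}
    (ha : ∀ i, Differentiable ℝ (a i)) (x : E d) :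
    gradient (fun x => ∑ i, a i x) x = ∑ i, gradient (a i) x := by
  have h := gradient_sum_mul ha (b := fun _ _ => 1) (fun _ => differentiable_const 1) x
  simpa using h

/-- A finite smooth partition of unity on a compact set, with bounded gradients. -/
theorem exists_finite_partition {S : Set (E d)} (hS : IsCompact S) {P : Set (E d) → Prop}
    (hP : ∀ x ∈ S, ∃ N, IsOpen N ∧ x ∈ N ∧ Bornology.IsBounded N ∧ P N) :
    ∃ (n : ℕ) (N : Fin n → Set (E d)) (a : Fin n → E d → ℝ) (M : ℝ≥0),
      (∀ i, IsOpen (N i) ∧ P (N i) ∧ ContDiff ℝ ∞ (a i)) ∧ (∀ x ∈ S, ∑ i, a i x = 1) ∧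
      ∀ i x, ‖a i x‖ ≤ (N i).indicator (fun _ => 1) x ∧
        ‖gradient (a i) x‖ ≤ (N i).indicator (fun _ => (M : ℝ)) x := by
  choose! N hNo hxN hNb hNP using hP
  obtain ⟨t, htS, ht⟩ := hS.elim_nhds_subcover N fun x hx => (hNo x hx).mem_nhds (hxN x hx)
  set n := t.card
  let eq := t.equivFin
  let U : Fin n → Set (E d) := fun i => N (eq.symm i)
  have hmem : ∀ i, ((eq.symm i : t) : E d) ∈ S := fun i => htS _ (eq.symm i).2
  have hUo : ∀ i, IsOpen (U i) := fun i => hNo _ (hmem i)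
  have hcov : S ⊆ ⋃ i, U i := by
    intro x hx
    obtain ⟨y, hy, hxy⟩ := mem_iUnion₂.1 (ht hx)
    refine mem_iUnion.2 ⟨eq ⟨y, hy⟩, ?_⟩
    simpa [U] using hxy
  obtain ⟨f, hf⟩ := SmoothPartitionOfUnity.exists_isSubordinate 𝓘(ℝ, E d) hS.isClosed U hUo hcov
  have hfs : ∀ i, ContDiff ℝ ∞ (f i) := fun i => (f i).contMDiff.contDiff
  have hsub : ∀ i, tsupport (f i) ⊆ U i := hf
  -- Boundedness of the sets `N` is used here: compact support makes the gradients bounded.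
  have hcs : ∀ i, HasCompactSupport (f i) := fun i =>
    Metric.isCompact_of_isClosed_isBounded (isClosed_tsupport _)
      ((hNb _ (hmem i)).subset (hsub i))
  have hbd : ∀ i, ∃ M : ℝ≥0, ∀ x, ‖gradient (f i) x‖ ≤ M := by
    intro i
    have hc : Continuous (gradient (f i)) :=
      continuous_gradient ((hfs i).of_le (by exact_mod_cast le_top))
    have hgc : HasCompactSupport (gradient (f i)) :=
      ((hcs i).fderiv ℝ).comp_left (g := (InnerProductSpace.toDual ℝ (E d)).symm) (by simp)
    obtain ⟨C, hC⟩ := hgc.exists_bound_of_continuous hc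
    exact ⟨C.toNNReal, fun x => (hC x).trans (Real.le_coe_toNNReal C)⟩
  choose M hM using hbd
  refine ⟨n, U, fun i => f i, ∑ i, M i, fun i => ⟨hUo i, hNP _ (hmem i), hfs i⟩, ?_, ?_⟩
  · intro x hx
    rw [← f.sum_eq_one hx, finsum_eq_sum_of_fintype]
  · intro i x
    by_cases hx : x ∈ U i
    · rw [indicator_of_mem hx, indicator_of_mem hx]
      refine ⟨by rw [Real.norm_of_nonneg (f.nonneg i x)]; exact f.le_one i x, (hM i x).trans ?_⟩
      exact_mod_cast Finset.single_le_sum (f := M) (fun j _ => zero_le) (Finset.mem_univ i)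
    · rw [indicator_of_notMem hx, indicator_of_notMem hx]
      have hx' : x ∉ tsupport (f i) := fun h => hx (hsub i h)
      have h1 : f i x = 0 := image_eq_zero_of_notMem_tsupport hx'
      have h2 : fderiv ℝ (f i) x = 0 := fderiv_of_notMem_tsupport ℝ hx'
      simp [h1, gradient, h2]

theorem eLpNorm_indicator_restrict {X : Type*} [NormedAddCommGroup X] {s : ℝ≥0∞} {N : Set (E d)}
    (hN : MeasurableSet N) {u : E d → X} {ε : ℝ≥0∞}
    (h : eLpNorm u s ((vol Ω).restrict N) ≤ ε) : eLpNorm (N.indicator u) s (vol Ω) ≤ ε := by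
  rwa [eLpNorm_indicator_eq_eLpNorm_restrict hN]

/-- On a bounded Lipschitz domain, restrictions of smooth functions are dense in `W^{1,s}`. -/
theorem exists_smooth_approx {s : ℝ≥0∞} [hs1 : Fact (1 ≤ s)] (hs : s ≠ ⊤) (hΩ : IsOpen Ω)
    (hb : Bornology.IsBounded Ω) (hlip : HasLipschitzBoundary Ω) (ξ : sobolev Ω s) {ε : ℝ≥0∞}
    (hε : ε ≠ 0) : ∃ η : E d → ℝ, ContDiff ℝ ∞ η ∧
      eLpNorm (fun x => η x - fn ξ x) s (vol Ω) ≤ ε ∧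
      eLpNorm (fun x => gradient η x - grad ξ x) s (vol Ω) ≤ ε := by
  obtain ⟨n, N, a, M, hN, hsum, hbd⟩ := exists_finite_partition hb.isCompact_closure
    (P := InwardShiftable Ω) fun x hx => exists_inwardShiftable hΩ hlip hx
  -- Each of the `n` pieces costs at most `(1 + M)` times the local error in the gradient; the final
  -- `1` keeps `k` nonzero when `n = 0`.
  set k : ℝ≥0∞ := n * (1 + M) + 1 with hk
  have hk0 : k ≠ 0 := by simp [hk]
  have hktop : k ≠ ⊤ := by simp [hk, ENNReal.mul_eq_top]
  have hε' : ε / k ≠ 0 := (ENNReal.div_pos hε hktop).ne'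
  choose η hηs hη1 hη2 using fun i =>
    exists_local_smooth_approx hs hΩ ξ (hN i).1 (hN i).2.1 hε'
  have hNm : ∀ i, MeasurableSet (N i) := fun i => (hN i).1.measurableSet
  have ha1 : ∀ i, ContDiff ℝ 1 (a i) := fun i => (hN i).2.2.of_le (by exact_mod_cast le_top)
  have hη1' : ∀ i, ContDiff ℝ 1 (η i) := fun i => (hηs i).of_le (by exact_mod_cast le_top)
  have had : ∀ i, Differentiable ℝ (a i) := fun i => (ha1 i).differentiable (by simp)
  have hηd : ∀ i, Differentiable ℝ (η i) := fun i => (hη1' i).differentiable (by simp)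
  have hsumΩ : ∀ x ∈ Ω, ∑ i, a i x = 1 := fun x hx => hsum x (subset_closure hx)
  -- Since the gradients cancel on `Ω`, `fn ξ x` may be subtracted from `η i x` in the product rule
  -- terms, leaving only approximation errors.
  have hgsum : ∀ x ∈ Ω, ∑ i, gradient (a i) x = 0 := by
    intro x hx
    rw [← gradient_sum had]
    have : (fun x => ∑ i, a i x) =ᶠ[𝓝 x] fun _ => 1 := by
      filter_upwards [hΩ.mem_nhds hx] with y hy using hsumΩ y hy
    rw [this.gradient_eq, gradient_fun_const]
  have hfm := (Lp.memLp (fn ξ)).aestronglyMeasurable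
  have hGm := (Lp.memLp (grad ξ)).aestronglyMeasurable
  have hu : ∀ i, AEStronglyMeasurable (fun x => η i x - fn ξ x) (vol Ω) := fun i =>
    (hηs i).continuous.aestronglyMeasurable.sub hfm
  have hv : ∀ i, AEStronglyMeasurable (fun x => gradient (η i) x - grad ξ x) (vol Ω) := fun i =>
    (continuous_gradient (hη1' i)).aestronglyMeasurable.sub hGm
  have hau : ∀ i, eLpNorm (fun x => a i x * (η i x - fn ξ x)) s (vol Ω) ≤ ε / k := by
    intro i
    refine le_trans (eLpNorm_mono fun x => ?_) (eLpNorm_indicator_restrict (hNm i) (hη1 i))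
    have h := (hbd i x).1
    by_cases hx : x ∈ N i
    · rw [indicator_of_mem hx] at h ⊢
      rw [norm_mul]
      exact mul_le_of_le_one_left (norm_nonneg _) h
    · rw [indicator_of_notMem hx] at h ⊢
      simp [norm_le_zero_iff.1 h]
  have hav : ∀ i, eLpNorm (fun x => a i x • (gradient (η i) x - grad ξ x)) s (vol Ω) ≤ ε / k := by
    intro i
    refine le_trans (eLpNorm_mono fun x => ?_) (eLpNorm_indicator_restrict (hNm i) (hη2 i))
    have h := (hbd i x).1
    by_cases hx : x ∈ N i
    · rw [indicator_of_mem hx] at h ⊢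
      rw [norm_smul]
      exact mul_le_of_le_one_left (norm_nonneg _) h
    · rw [indicator_of_notMem hx] at h ⊢
      simp [norm_le_zero_iff.1 h]
  have hgu : ∀ i, eLpNorm (fun x => (η i x - fn ξ x) • gradient (a i) x) s (vol Ω) ≤
      M * (ε / k) := by
    intro i
    refine le_trans (eLpNorm_le_nnreal_smul_eLpNorm_of_ae_le_mul
      (g := (N i).indicator fun x => η i x - fn ξ x) (c := M) (Eventually.of_forall fun x => ?_) s)
      ?_
    · rw [← NNReal.coe_le_coe, NNReal.coe_mul, coe_nnnorm, coe_nnnorm]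
      have h := (hbd i x).2
      by_cases hx : x ∈ N i
      · rw [indicator_of_mem hx] at h ⊢
        rw [norm_smul, mul_comm]
        exact mul_le_mul_of_nonneg_right h (norm_nonneg _)
      · rw [indicator_of_notMem hx] at h ⊢
        simp [norm_le_zero_iff.1 h]
    · rw [ENNReal.smul_def, smul_eq_mul]
      exact mul_le_mul_right (eLpNorm_indicator_restrict (hNm i) (hη1 i)) _
  refine ⟨fun x => ∑ i, a i x * η i x,
    ContDiff.sum fun i _ => (hN i).2.2.mul (hηs i), ?_, ?_⟩
  · have e : (fun x => (∑ i, a i x * η i x) - fn ξ x) =ᵐ[vol Ω]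
        ∑ i, fun x => a i x * (η i x - fn ξ x) := by
      filter_upwards [ae_restrict_mem hΩ.measurableSet] with x hx
      simp only [Finset.sum_apply, mul_sub, Finset.sum_sub_distrib, ← Finset.sum_mul, hsumΩ x hx,
        one_mul]
    rw [eLpNorm_congr_ae e]
    refine (eLpNorm_sum_le (fun i _ =>
      (ha1 i).continuous.aestronglyMeasurable.mul (hu i)) hs1.out).trans ?_
    calc ∑ i, eLpNorm (fun x => a i x * (η i x - fn ξ x)) s (vol Ω)
        ≤ ∑ _i : Fin n, ε / k := Finset.sum_le_sum fun i _ => hau i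
      _ = n * (ε / k) := by simp
      _ ≤ k * (ε / k) := by
          gcongr
          rw [hk, mul_add, mul_one, add_assoc]
          exact le_self_add
      _ ≤ ε := ENNReal.mul_div_le
  · have e : (fun x => gradient (fun x => ∑ i, a i x * η i x) x - grad ξ x) =ᵐ[vol Ω]
        ∑ i, ((fun x => a i x • (gradient (η i) x - grad ξ x)) +
          fun x => (η i x - fn ξ x) • gradient (a i) x) := by
      filter_upwards [ae_restrict_mem hΩ.measurableSet] with x hx
      rw [gradient_sum_mul had hηd]
      simp only [Finset.sum_apply, Pi.add_apply, smul_sub, sub_smul, Finset.sum_sub_distrib,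
        Finset.sum_add_distrib, ← Finset.sum_smul, ← Finset.smul_sum, hsumΩ x hx, hgsum x hx,
        one_smul, smul_zero]
      abel
    rw [eLpNorm_congr_ae e]
    have hm1 : ∀ i, AEStronglyMeasurable (fun x => a i x • (gradient (η i) x - grad ξ x))
        (vol Ω) := fun i => (ha1 i).continuous.aestronglyMeasurable.smul (hv i)
    have hm2 : ∀ i, AEStronglyMeasurable (fun x => (η i x - fn ξ x) • gradient (a i) x)
        (vol Ω) := fun i =>
      (hu i).smul (continuous_gradient (ha1 i)).aestronglyMeasurable
    refine (eLpNorm_sum_le (fun i _ => (hm1 i).add (hm2 i)) hs1.out).trans ?_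
    calc _ ≤ ∑ _i : Fin n, (ε / k + M * (ε / k)) := Finset.sum_le_sum fun i _ =>
          (eLpNorm_add_le (hm1 i) (hm2 i) hs1.out).trans (add_le_add (hav i) (hgu i))
      _ = n * (1 + M) * (ε / k) := by
          rw [Finset.sum_const, Finset.card_univ, Fintype.card_fin, nsmul_eq_mul]
          ring
      _ ≤ k * (ε / k) := by
          gcongr
          exact le_self_add
      _ ≤ ε := ENNReal.mul_div_le

end Density

theorem eLpNorm_sub_comm_fun {s : ℝ≥0∞} {α X : Type*} [MeasurableSpace α] {μ : Measure α}
    [NormedAddCommGroup X] (u v : α → X) :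
    eLpNorm (fun x => u x - v x) s μ = eLpNorm (fun x => v x - u x) s μ :=
  eLpNorm_sub_comm u v s μ

/-! ### Existence and uniqueness of traces. -/

section Trace

variable {d : ℕ} {Ω : Set (E d)} {s : ℝ≥0∞} [hs1 : Fact (1 ≤ s)]

theorem one_le_toReal_exponent (hs : s ≠ ⊤) : 1 ≤ s.toReal := by
  rw [← ENNReal.toReal_one]
  exact ENNReal.toReal_mono hs hs1.out

theorem eLpNorm_rpow_toReal (hs : s ≠ ⊤) {α X : Type*} [MeasurableSpace α] {μ : Measure α}
    [NormedAddCommGroup X] (f : α → X) :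
    eLpNorm f s μ ^ s.toReal = ∫⁻ y, ‖f y‖ₑ ^ s.toReal ∂μ := by
  have hp0 : 0 < s.toReal := one_pos.trans_le (one_le_toReal_exponent hs)
  rw [eLpNorm_eq_lintegral_rpow_enorm_toReal (one_pos.trans_le hs1.out).ne' hs, ← ENNReal.rpow_mul,
    one_div, inv_mul_cancel₀ hp0.ne', ENNReal.rpow_one]

theorem le_rpow_inv_mul {p : ℝ} (hp : 0 < p) {a b : ℝ≥0∞} {C : ℝ≥0} (h : a ^ p ≤ C * b ^ p) :
    a ≤ (C ^ p⁻¹ : ℝ≥0) * b := by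
  rw [← ENNReal.rpow_le_rpow_iff hp, ENNReal.mul_rpow_of_nonneg _ _ hp.le,
    ← ENNReal.coe_rpow_of_nonneg _ hp.le, ← NNReal.rpow_mul, inv_mul_cancel₀ hp.ne',
    NNReal.rpow_one]
  exact h

theorem exists_trace_bound_eLpNorm (hs : s ≠ ⊤) (hΩ : IsOpen Ω) (hb : Bornology.IsBounded Ω)
    (hlip : HasLipschitzBoundary Ω) :
    ∃ C : ℝ≥0, ∀ η : E d → ℝ, ContDiff ℝ 1 η → eLpNorm η s (surf Ω) ≤
      C * (eLpNorm η s (vol Ω) + eLpNorm (gradient η) s (vol Ω)) := by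
  have hp := one_le_toReal_exponent hs
  obtain ⟨C, hC⟩ := exists_trace_bound hΩ hb hlip hp
  refine ⟨C ^ s.toReal⁻¹, fun η hη => le_rpow_inv_mul (by linarith) ?_⟩
  rw [eLpNorm_rpow_toReal hs]
  refine (hC η hη).trans (mul_le_mul_right ?_ _)
  refine le_trans (le_of_eq ?_) (ENNReal.add_rpow_le_rpow_add _ _ hp)
  rw [eLpNorm_rpow_toReal hs, eLpNorm_rpow_toReal hs, energy, gradEnergy]

theorem exists_poincare_wirtinger_eLpNorm (hs : s ≠ ⊤) (hΩ : IsOpen Ω)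
    (hb : Bornology.IsBounded Ω) (hconn : IsConnected Ω) (hlip : HasLipschitzBoundary Ω) :
    ∃ C : ℝ≥0, ∀ η : E d → ℝ, ContDiff ℝ 1 η → ∃ c : ℝ,
      eLpNorm (fun x => η x - c) s (vol Ω) ≤ C * eLpNorm (gradient η) s (vol Ω) := by
  have hp := one_le_toReal_exponent hs
  obtain ⟨C, hC⟩ := exists_poincare_wirtinger hp hΩ hb hconn hlip
  refine ⟨C ^ s.toReal⁻¹, fun η hη => ?_⟩
  obtain ⟨c, hc⟩ := hC η hη
  refine ⟨c, le_rpow_inv_mul (by linarith) ?_⟩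
  rw [eLpNorm_rpow_toReal hs, eLpNorm_rpow_toReal hs]
  exact hc

theorem eLpNorm_sub_triangle {α X : Type*} [MeasurableSpace α] {μ : Measure α}
    [NormedAddCommGroup X] {u v w : α → X} (hu : AEStronglyMeasurable u μ)
    (hv : AEStronglyMeasurable v μ) (hw : AEStronglyMeasurable w μ) :
    eLpNorm (fun x => u x - w x) s μ ≤
      eLpNorm (fun x => u x - v x) s μ + eLpNorm (fun x => v x - w x) s μ := by
  refine le_trans (le_of_eq ?_) (eLpNorm_add_le (hu.sub hv) (hv.sub hw) hs1.out)
  congr 1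
  ext1 x
  simp

theorem eLpNorm_le_sub_add {α X : Type*} [MeasurableSpace α] {μ : Measure α}
    [NormedAddCommGroup X] {u v : α → X} (hu : AEStronglyMeasurable u μ)
    (hv : AEStronglyMeasurable v μ) :
    eLpNorm u s μ ≤ eLpNorm (fun x => u x - v x) s μ + eLpNorm v s μ := by
  simpa using eLpNorm_sub_triangle hu hv (aestronglyMeasurable_zero (β := X))

theorem tendsto_eLpNorm_add_smul {α X : Type*} [MeasurableSpace α] {μ : Measure α}
    [NormedAddCommGroup X] [NormedSpace ℝ X] {u v w : ℕ → α → X} (c : ℝ)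
    (hum : ∀ n, AEStronglyMeasurable (u n) μ) (hvm : ∀ n, AEStronglyMeasurable (v n) μ)
    (hw : ∀ n, w n =ᵐ[μ] u n + c • v n)
    (hu : Tendsto (fun n => eLpNorm (u n) s μ) atTop (𝓝 0))
    (hv : Tendsto (fun n => eLpNorm (v n) s μ) atTop (𝓝 0)) :
    Tendsto (fun n => eLpNorm (w n) s μ) atTop (𝓝 0) := by
  have h : Tendsto (fun n => eLpNorm (u n) s μ + ‖c‖ₑ * eLpNorm (v n) s μ) atTop (𝓝 0) := by
    have := hu.add (ENNReal.Tendsto.const_mul (a := ‖c‖ₑ) hv (Or.inr (by simp)))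
    simpa using this
  refine tendsto_of_tendsto_of_tendsto_of_le_of_le tendsto_const_nhds h (fun _ => zero_le)
    fun n => ?_
  change eLpNorm (w n) s μ ≤ eLpNorm (u n) s μ + ‖c‖ₑ * eLpNorm (v n) s μ
  rw [eLpNorm_congr_ae (hw n)]
  refine (eLpNorm_add_le (hum n) ((hvm n).const_smul c) hs1.out).trans (add_le_add_right ?_ _)
  rw [eLpNorm_const_smul]

theorem IsTrace.add_smul {ξ ξ' : sobolev Ω s} {g g' : Lp ℝ s (surf Ω)} (h : IsTrace ξ g)
    (h' : IsTrace ξ' g') (c : ℝ) : IsTrace (ξ + c • ξ') (g + c • g') := by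
  obtain ⟨η, hη, h1, h2, h3⟩ := h
  obtain ⟨η', hη', h1', h2', h3'⟩ := h'
  have hm : ∀ (η : ℕ → E d → ℝ) (_ : ∀ n, ContDiff ℝ ∞ (η n)) (μ : Measure (E d)) (f : Lp ℝ s μ)
      (n : ℕ), AEStronglyMeasurable (fun x => η n x - f x) μ := fun η hη μ f n =>
    (hη n).continuous.aestronglyMeasurable.sub (Lp.memLp f).aestronglyMeasurable
  have hgm : ∀ (η : ℕ → E d → ℝ) (_ : ∀ n, ContDiff ℝ ∞ (η n)) (f : Lp (E d) s (vol Ω))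
      (n : ℕ), AEStronglyMeasurable (fun x => gradient (η n) x - f x) (vol Ω) := fun η hη f n =>
    (continuous_gradient ((hη n).of_le (by exact_mod_cast le_top))).aestronglyMeasurable.sub
      (Lp.memLp f).aestronglyMeasurable
  refine ⟨fun n => η n + c • η' n, fun n => (hη n).add ((hη' n).const_smul c), ?_, ?_, ?_⟩
  · refine tendsto_eLpNorm_add_smul c (hm η hη _ (fn ξ)) (hm η' hη' _ (fn ξ')) (fun n => ?_) h1 h1'
    change (fun x => (η n + c • η' n) x - (fn ξ + c • fn ξ' : Lp ℝ s (vol Ω)) x) =ᵐ[vol Ω] _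
    filter_upwards [Lp.coeFn_add (fn ξ) (c • fn ξ'), Lp.coeFn_smul c (fn ξ')] with x e1 e2
    simp only [e1, e2, Pi.add_apply, Pi.smul_apply, smul_eq_mul]
    ring
  · refine tendsto_eLpNorm_add_smul c (hgm η hη (grad ξ)) (hgm η' hη' (grad ξ')) (fun n => ?_)
      h2 h2'
    change (fun x => gradient (η n + c • η' n) x -
      (grad ξ + c • grad ξ' : Lp (E d) s (vol Ω)) x) =ᵐ[vol Ω] _
    filter_upwards [Lp.coeFn_add (grad ξ) (c • grad ξ'), Lp.coeFn_smul c (grad ξ')] with x e1 e2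
    have hd : DifferentiableAt ℝ (η n) x := (hη n).differentiable (by simp) x
    have hd' : DifferentiableAt ℝ (η' n) x := (hη' n).differentiable (by simp) x
    have e3 : gradient (η n + c • η' n) x = gradient (η n) x + c • gradient (η' n) x := by
      refine ext_inner_left ℝ fun v => ?_
      rw [inner_gradient, fderiv_add hd (hd'.const_smul c), fderiv_const_smul hd', inner_add_right,
        inner_smul_right, inner_gradient, inner_gradient]
      rfl
    simp only [e1, e2, e3, Pi.add_apply, Pi.smul_apply, smul_sub]
    abel
  · refine tendsto_eLpNorm_add_smul c (hm η hη _ g) (hm η' hη' _ g') (fun n => ?_) h3 h3'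
    filter_upwards [Lp.coeFn_add g (c • g'), Lp.coeFn_smul c g'] with x e1 e2
    simp only [e1, e2, Pi.add_apply, Pi.smul_apply, smul_eq_mul]
    ring

/-- Apply the trace inequality to the approximants minus `c` and pass to the limit. With `c = 0`
this gives uniqueness and boundedness of the trace; general `c` is needed for Poincaré's inequality
with zero trace. -/
theorem exists_isTrace_bound (hs : s ≠ ⊤) (hΩ : IsOpen Ω) (hb : Bornology.IsBounded Ω)
    (hlip : HasLipschitzBoundary Ω) :
    ∃ C : ℝ≥0, ∀ (ξ : sobolev Ω s) (g : Lp ℝ s (surf Ω)), IsTrace ξ g → ∀ c : ℝ,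
      eLpNorm (fun x => g x - c) s (surf Ω) ≤
        C * (eLpNorm (fun x => fn ξ x - c) s (vol Ω) + eLpNorm (grad ξ) s (vol Ω)) := by
  obtain ⟨C, hC⟩ := exists_trace_bound_eLpNorm hs hΩ hb hlip
  refine ⟨C, fun ξ g ⟨η, hη, h1, h2, h3⟩ c => ?_⟩
  set F := eLpNorm (fun x => fn ξ x - c) s (vol Ω)
  set G := eLpNorm (grad ξ) s (vol Ω)
  have hlim : Tendsto (fun n => eLpNorm (fun x => η n x - g x) s (surf Ω) +
      C * ((eLpNorm (fun x => η n x - fn ξ x) s (vol Ω) + F) +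
        (eLpNorm (fun x => gradient (η n) x - grad ξ x) s (vol Ω) + G))) atTop
      (𝓝 (C * (F + G))) := by
    have := h3.add (ENNReal.Tendsto.const_mul (a := C) ((h1.add_const F).add (h2.add_const G))
      (Or.inr (by simp)))
    simpa using this
  refine ge_of_tendsto' hlim fun n => ?_
  have hη1 : ContDiff ℝ 1 (η n) := (hη n).of_le (by exact_mod_cast le_top)
  have hgm := (Lp.memLp g).aestronglyMeasurable
  have hfm := (Lp.memLp (fn ξ)).aestronglyMeasurable
  have hGm := (Lp.memLp (grad ξ)).aestronglyMeasurable
  have hηm : ∀ μ : Measure (E d), AEStronglyMeasurable (η n) μ := fun μ =>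
    (hη n).continuous.aestronglyMeasurable
  have e1 : eLpNorm (fun x => g x - c) s (surf Ω) ≤
      eLpNorm (fun x => η n x - g x) s (surf Ω) + eLpNorm (fun x => η n x - c) s (surf Ω) := by
    rw [eLpNorm_sub_comm_fun (η n) g]
    exact eLpNorm_sub_triangle hgm (hηm _) aestronglyMeasurable_const
  have e2 : eLpNorm (fun x => η n x - c) s (vol Ω) ≤
      eLpNorm (fun x => η n x - fn ξ x) s (vol Ω) + F := by
    exact eLpNorm_sub_triangle (hηm _) hfm aestronglyMeasurable_const
  have hgr : gradient (fun x => η n x - c) = gradient (η n) := by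
    ext1 x
    rw [gradient, gradient, fderiv_sub_const]
  have e3 : eLpNorm (gradient (η n)) s (vol Ω) ≤
      eLpNorm (fun x => gradient (η n) x - grad ξ x) s (vol Ω) + G := by
    exact eLpNorm_le_sub_add (continuous_gradient hη1).aestronglyMeasurable hGm
  have e4 := hC (fun x => η n x - c) (hη1.sub contDiff_const)
  rw [hgr] at e4
  calc _ ≤ _ := e1
    _ ≤ _ := add_le_add_right (e4.trans (mul_le_mul_right (add_le_add e2 e3) _)) _

theorem IsTrace.unique (hs : s ≠ ⊤) (hΩ : IsOpen Ω) (hb : Bornology.IsBounded Ω)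
    (hlip : HasLipschitzBoundary Ω) {ξ : sobolev Ω s} {g g' : Lp ℝ s (surf Ω)}
    (h : IsTrace ξ g) (h' : IsTrace ξ g') : g = g' := by
  obtain ⟨C, hC⟩ := exists_isTrace_bound hs hΩ hb hlip
  -- The difference of two traces of `ξ` is a trace of `0`, which the bound forces to vanish.
  have h0 := hC _ _ (h.add_smul h' (-1)) 0
  have e : ξ + (-1 : ℝ) • ξ = 0 := by module
  have e1 : g + (-1 : ℝ) • g' = g - g' := by module
  have z1 : eLpNorm (fn (0 : sobolev Ω s)) s (vol Ω) = 0 := by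
    change eLpNorm ((0 : Lp ℝ s (vol Ω)) : E d → ℝ) s (vol Ω) = 0
    rw [← Lp.enorm_def, enorm_zero]
  have z2 : eLpNorm (grad (0 : sobolev Ω s)) s (vol Ω) = 0 := by
    change eLpNorm ((0 : Lp (E d) s (vol Ω)) : E d → E d) s (vol Ω) = 0
    rw [← Lp.enorm_def, enorm_zero]
  simp only [e, e1, sub_zero] at h0
  change eLpNorm (g - g' : Lp ℝ s (surf Ω)) s (surf Ω) ≤
    C * (eLpNorm (fn (0 : sobolev Ω s)) s (vol Ω) + eLpNorm (grad (0 : sobolev Ω s)) s (vol Ω))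
    at h0
  rw [z1, z2, add_zero, mul_zero, ← Lp.enorm_def, nonpos_iff_eq_zero, enorm_eq_zero] at h0
  exact sub_eq_zero.1 h0

/-- By the trace inequality, smooth functions converging in `W^{1,s}(Ω)` have boundary values that
form a Cauchy sequence in `L^s(∂Ω)`; the limit is the trace. -/
theorem exists_isTrace (hs : s ≠ ⊤) (hΩ : IsOpen Ω) (hb : Bornology.IsBounded Ω)
    (hlip : HasLipschitzBoundary Ω) (ξ : sobolev Ω s) : ∃ g, IsTrace ξ g := by
  obtain ⟨C, hC⟩ := exists_trace_bound_eLpNorm hs hΩ hb hlip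
  have hε : ∀ n : ℕ, ((n : ℝ≥0∞) + 1)⁻¹ ≠ 0 := fun n => by simp
  have hε0 : Tendsto (fun n : ℕ => ((n : ℝ≥0∞) + 1)⁻¹) atTop (𝓝 0) := by
    have := (tendsto_add_atTop_iff_nat 1).2 ENNReal.tendsto_inv_nat_nhds_zero
    simpa using this
  choose η hη h1 h2 using fun n => exists_smooth_approx hs hΩ hb hlip ξ (hε n)
  have hη1 : ∀ n, ContDiff ℝ 1 (η n) := fun n => (hη n).of_le (by exact_mod_cast le_top)
  have hηm : ∀ n (μ : Measure (E d)), AEStronglyMeasurable (η n) μ := fun n μ =>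
    (hη n).continuous.aestronglyMeasurable
  have hgm : ∀ n, AEStronglyMeasurable (gradient (η n)) (vol Ω) := fun n =>
    (continuous_gradient (hη1 n)).aestronglyMeasurable
  have hfm := (Lp.memLp (fn ξ)).aestronglyMeasurable
  have hGm := (Lp.memLp (grad ξ)).aestronglyMeasurable
  have t1 : Tendsto (fun n => eLpNorm (fun x => η n x - fn ξ x) s (vol Ω)) atTop (𝓝 0) :=
    tendsto_of_tendsto_of_tendsto_of_le_of_le tendsto_const_nhds hε0 (fun _ => zero_le) h1
  have t2 : Tendsto (fun n => eLpNorm (fun x => gradient (η n) x - grad ξ x) s (vol Ω)) atTop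
      (𝓝 0) :=
    tendsto_of_tendsto_of_tendsto_of_le_of_le tendsto_const_nhds hε0 (fun _ => zero_le) h2
  have hmem : ∀ n, MemLp (η n) s (surf Ω) := by
    intro n
    refine ⟨hηm n _, (hC (η n) (hη1 n)).trans_lt (ENNReal.mul_lt_top ENNReal.coe_lt_top
      (ENNReal.add_lt_top.2 ⟨?_, ?_⟩))⟩
    · have hm : MemLp (fun x => η n x - fn ξ x) s (vol Ω) :=
        ⟨(hηm n _).sub hfm, (h1 n).trans_lt (ENNReal.inv_lt_top.2 (by simp))⟩
      have := (hm.add (Lp.memLp (fn ξ))).2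
      refine lt_of_le_of_lt (le_of_eq ?_) this
      congr 1
      ext x
      simp
    · have hm : MemLp (fun x => gradient (η n) x - grad ξ x) s (vol Ω) :=
        ⟨(hgm n).sub hGm, (h2 n).trans_lt (ENNReal.inv_lt_top.2 (by simp))⟩
      have := (hm.add (Lp.memLp (grad ξ))).2
      refine lt_of_le_of_lt (le_of_eq ?_) this
      congr 1
      ext1 x
      simp
  have hdiff : ∀ n m, eLpNorm (η n - η m) s (surf Ω) ≤
      C * (((n : ℝ≥0∞) + 1)⁻¹ + ((m : ℝ≥0∞) + 1)⁻¹ +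
        (((n : ℝ≥0∞) + 1)⁻¹ + ((m : ℝ≥0∞) + 1)⁻¹)) := by
    intro n m
    refine (hC _ ((hη1 n).sub (hη1 m))).trans (mul_le_mul_right (add_le_add ?_ ?_) _)
    · refine (eLpNorm_sub_triangle (hηm n _) hfm (hηm m _)).trans (add_le_add (h1 n) ?_)
      rw [eLpNorm_sub_comm_fun]
      exact h1 m
    · have e : (gradient fun x => η n x - η m x) =
          fun x => gradient (η n) x - gradient (η m) x := by
        ext1 x
        rw [gradient, gradient, gradient, fderiv_fun_sub ((hη1 n).differentiable (by simp) x)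
          ((hη1 m).differentiable (by simp) x), map_sub]
      rw [e]
      refine (eLpNorm_sub_triangle (hgm n) hGm (hgm m)).trans (add_le_add (h2 n) ?_)
      rw [eLpNorm_sub_comm_fun]
      exact h2 m
  have hcau : CauchySeq fun n => (hmem n).toLp (η n) := by
    rw [EMetric.cauchySeq_iff_le_tendsto_0]
    have hanti : Antitone fun n : ℕ => ((n : ℝ≥0∞) + 1)⁻¹ := fun a b hab => by
      exact ENNReal.inv_le_inv.2 (add_le_add_left (Nat.cast_le.2 hab) 1)
    refine ⟨fun n => C * (((n : ℝ≥0∞) + 1)⁻¹ + ((n : ℝ≥0∞) + 1)⁻¹ +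
      (((n : ℝ≥0∞) + 1)⁻¹ + ((n : ℝ≥0∞) + 1)⁻¹)), fun n m k hn hm => ?_, ?_⟩
    · rw [Lp.edist_toLp_toLp]
      refine (hdiff n m).trans ?_
      have a := add_le_add (hanti hn) (hanti hm)
      exact mul_le_mul_right (add_le_add a a) _
    · have := ENNReal.Tendsto.const_mul (a := (C : ℝ≥0∞)) ((hε0.add hε0).add (hε0.add hε0))
        (Or.inr (by simp))
      simpa using this
  obtain ⟨g, hg⟩ := cauchySeq_tendsto_of_complete hcau
  refine ⟨g, η, hη, t1, t2, ?_⟩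
  rw [tendsto_iff_edist_tendsto_0] at hg
  refine hg.congr fun n => ?_
  rw [Lp.edist_def]
  refine eLpNorm_congr_ae ?_
  filter_upwards [(hmem n).coeFn_toLp] with x hx
  simp [hx]

theorem isTrace_trace (hs : s ≠ ⊤) (hΩ : IsOpen Ω) (hb : Bornology.IsBounded Ω)
    (hlip : HasLipschitzBoundary Ω) (ξ : sobolev Ω s) : IsTrace ξ (trace ξ) := by
  have h := exists_isTrace hs hΩ hb hlip ξ
  rw [trace, dif_pos h]
  exact h.choose_spec

end Trace

/-! ### Completeness of `W^{1,s}`, and `W_0^{1,s}` as a closed subspace. -/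

section Completeness

variable {d : ℕ} {Ω : Set (E d)} {s : ℝ≥0∞} [hs1 : Fact (1 ≤ s)]

theorem exists_holderConjugate (s : ℝ≥0∞) [Fact (1 ≤ s)] :
    ∃ r : ℝ≥0∞, 1 ≤ r ∧ ENNReal.HolderConjugate s r :=
  ⟨s.conjExponent, le_self_add,
    ENNReal.HolderConjugate.conjExponent Fact.out⟩

/-- Weak gradients are stable under convergence in `L^s`. -/
theorem isClosed_sobolev (Ω : Set (E d)) (s : ℝ≥0∞) [hs1 : Fact (1 ≤ s)] :
    IsClosed (sobolev Ω s : Set (Lp ℝ s (vol Ω) × Lp (E d) s (vol Ω))) := by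
  obtain ⟨r, hr1, hconj⟩ := exists_holderConjugate s
  have : Fact (1 ≤ r) := ⟨hr1⟩
  rw [← isSeqClosed_iff_isClosed]
  intro ξ ζ hξ hlim η hη hηc hηt
  have hη1 : ContDiff ℝ 1 η := hη.of_le (by exact_mod_cast le_top)
  have hgc : HasCompactSupport (gradient η) :=
    (hηc.fderiv ℝ).comp_left (g := (InnerProductSpace.toDual ℝ (E d)).symm) (by simp)
  have m1 : MemLp η r (vol Ω) := hη.continuous.memLp_of_hasCompactSupport hηc
  have m2 : MemLp (gradient η) r (vol Ω) :=
    (continuous_gradient hη1).memLp_of_hasCompactSupport hgc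
  -- For a fixed test function both sides of the weak gradient identity are continuous in `L^s` by
  -- Hölder, since the test function and its gradient lie in the conjugate space.
  let A : Lp ℝ s (vol Ω) →L[ℝ] E d :=
    ((ContinuousLinearMap.lsmul ℝ ℝ).lpPairing (vol Ω) s r).flip (m2.toLp _)
  let B : Lp (E d) s (vol Ω) →L[ℝ] E d :=
    ((ContinuousLinearMap.lsmul ℝ ℝ).flip.lpPairing (vol Ω) s r).flip (m1.toLp _)
  have hA : ∀ f : Lp ℝ s (vol Ω), A f = ∫ x in Ω, f x • gradient η x := by
    intro f
    simp only [A, ContinuousLinearMap.flip_apply, ContinuousLinearMap.lpPairing_eq_integral]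
    refine integral_congr_ae ?_
    filter_upwards [m2.coeFn_toLp] with x hx
    simp [hx]
  have hB : ∀ G : Lp (E d) s (vol Ω), B G = ∫ x in Ω, η x • G x := by
    intro G
    simp only [B, ContinuousLinearMap.flip_apply, ContinuousLinearMap.lpPairing_eq_integral]
    refine integral_congr_ae ?_
    filter_upwards [m1.coeFn_toLp] with x hx
    simp [hx]
  have hl1 : Tendsto (fun n => A (ξ n).1) atTop (𝓝 (A ζ.1)) :=
    (A.continuous.tendsto _).comp (hlim.fst_nhds)
  have hl2 : Tendsto (fun n => - B (ξ n).2) atTop (𝓝 (- B ζ.2)) :=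
    ((B.continuous.tendsto _).comp (hlim.snd_nhds)).neg
  have heq : ∀ n, A (ξ n).1 = - B (ξ n).2 := fun n => by
    rw [hA, hB]
    exact hξ n η hη hηc hηt
  simp_rw [heq] at hl1
  have := tendsto_nhds_unique hl1 hl2
  rwa [hA, hB] at this

theorem completeSpace_sobolev (Ω : Set (E d)) (s : ℝ≥0∞) [hs1 : Fact (1 ≤ s)] :
    CompleteSpace (sobolev Ω s) :=
  (isClosed_sobolev Ω s).completeSpace_coe

/-- The function underlying a Sobolev function, as a continuous linear map. -/
noncomputable def fnL (Ω : Set (E d)) (s : ℝ≥0∞) [Fact (1 ≤ s)] :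
    sobolev Ω s →L[ℝ] Lp ℝ s (vol Ω) :=
  (ContinuousLinearMap.fst ℝ _ _).comp (sobolev Ω s).subtypeL

/-- The weak gradient as a continuous linear map. -/
noncomputable def gradL (Ω : Set (E d)) (s : ℝ≥0∞) [Fact (1 ≤ s)] :
    sobolev Ω s →L[ℝ] Lp (E d) s (vol Ω) :=
  (ContinuousLinearMap.snd ℝ _ _).comp (sobolev Ω s).subtypeL

@[simp] theorem fnL_apply (ξ : sobolev Ω s) : fnL Ω s ξ = fn ξ := rfl

@[simp] theorem gradL_apply (ξ : sobolev Ω s) : gradL Ω s ξ = grad ξ := rfl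

theorem norm_fn_le (ξ : sobolev Ω s) : ‖fn ξ‖ ≤ ‖ξ‖ := norm_fst_le ξ.1

theorem norm_grad_le (ξ : sobolev Ω s) : ‖grad ξ‖ ≤ ‖ξ‖ := norm_snd_le ξ.1

theorem norm_sobolev (ξ : sobolev Ω s) : ‖ξ‖ = max ‖fn ξ‖ ‖grad ξ‖ := rfl

theorem trace_add_smul (hs : s ≠ ⊤) (hΩ : IsOpen Ω) (hb : Bornology.IsBounded Ω)
    (hlip : HasLipschitzBoundary Ω) (ξ ξ' : sobolev Ω s) (c : ℝ) :
    trace (ξ + c • ξ') = trace ξ + c • trace ξ' :=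
  (isTrace_trace hs hΩ hb hlip _).unique hs hΩ hb hlip
    ((isTrace_trace hs hΩ hb hlip ξ).add_smul (isTrace_trace hs hΩ hb hlip ξ') c)

theorem trace_zero (hs : s ≠ ⊤) (hΩ : IsOpen Ω) (hb : Bornology.IsBounded Ω)
    (hlip : HasLipschitzBoundary Ω) : trace (0 : sobolev Ω s) = 0 := by
  have h := trace_add_smul hs hΩ hb hlip (0 : sobolev Ω s) 0 1
  simpa using h

theorem exists_norm_trace_le (hs : s ≠ ⊤) (hΩ : IsOpen Ω) (hb : Bornology.IsBounded Ω)
    (hlip : HasLipschitzBoundary Ω) : ∃ C : ℝ, ∀ ξ : sobolev Ω s, ‖trace ξ‖ ≤ C * ‖ξ‖ := by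
  obtain ⟨C, hC⟩ := exists_isTrace_bound hs hΩ hb hlip
  refine ⟨C * 2, fun ξ => ?_⟩
  have h := hC ξ (trace ξ) (isTrace_trace hs hΩ hb hlip ξ) 0
  simp only [sub_zero] at h
  rw [← Lp.enorm_def, ← Lp.enorm_def, ← Lp.enorm_def (grad ξ)] at h
  have h2 : ‖trace ξ‖ₑ ≤ C * (‖fn ξ‖ₑ + ‖grad ξ‖ₑ) := h
  rw [← ofReal_norm, ← ofReal_norm, ← ofReal_norm,
    ← ENNReal.ofReal_add (norm_nonneg _) (norm_nonneg _), ← ENNReal.ofReal_coe_nnreal,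
    ← ENNReal.ofReal_mul (NNReal.coe_nonneg C), ENNReal.ofReal_le_ofReal_iff (by positivity)] at h2
  refine h2.trans ?_
  rw [mul_assoc, two_mul]
  exact mul_le_mul_of_nonneg_left (add_le_add (norm_fn_le ξ) (norm_grad_le ξ)) C.2

/-- The trace operator as a continuous linear map. -/
theorem exists_traceL (hs : s ≠ ⊤) (hΩ : IsOpen Ω) (hb : Bornology.IsBounded Ω)
    (hlip : HasLipschitzBoundary Ω) :
    ∃ T : sobolev Ω s →L[ℝ] Lp ℝ s (surf Ω), ∀ ξ, T ξ = trace ξ := by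
  obtain ⟨C, hC⟩ := exists_norm_trace_le (s := s) hs hΩ hb hlip
  let T : sobolev Ω s →ₗ[ℝ] Lp ℝ s (surf Ω) :=
    { toFun := trace
      map_add' := fun ξ ξ' => by
        have := trace_add_smul hs hΩ hb hlip ξ ξ' 1
        rwa [one_smul, one_smul] at this
      map_smul' := fun c ξ => by
        have := trace_add_smul hs hΩ hb hlip 0 ξ c
        rwa [zero_add, trace_zero hs hΩ hb hlip, zero_add] at this }
  exact ⟨T.mkContinuous C hC, fun ξ => rfl⟩

theorem isFiniteMeasure_vol (hb : Bornology.IsBounded Ω) : IsFiniteMeasure (vol Ω) :=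
  ⟨by rw [Measure.restrict_apply_univ]; exact hb.measure_lt_top⟩

/-- The mean value as a continuous linear functional. -/
theorem exists_meanL (hb : Bornology.IsBounded Ω) :
    ∃ m : sobolev Ω s →L[ℝ] ℝ, ∀ ξ, m ξ = ∫ x in Ω, fn ξ x := by
  have := isFiniteMeasure_vol hb
  obtain ⟨r, hr1, hconj⟩ := exists_holderConjugate s
  have : Fact (1 ≤ r) := ⟨hr1⟩
  have m1 : MemLp (fun _ : E d => (1 : ℝ)) r (vol Ω) := memLp_const 1
  let A : Lp ℝ s (vol Ω) →L[ℝ] ℝ :=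
    ((ContinuousLinearMap.lsmul ℝ ℝ).lpPairing (vol Ω) s r).flip (m1.toLp _)
  refine ⟨A.comp (fnL Ω s), fun ξ => ?_⟩
  simp only [A, ContinuousLinearMap.comp_apply, ContinuousLinearMap.flip_apply,
    ContinuousLinearMap.lpPairing_eq_integral, fnL_apply]
  refine integral_congr_ae ?_
  filter_upwards [m1.coeFn_toLp] with x hx
  rw [ContinuousLinearMap.lsmul_apply, hx, smul_eq_mul, mul_one]

/-- `W_0^{1,s}(Ω)` is a closed subspace of `W^{1,s}(Ω)`. -/
theorem exists_sobolevZero_submodule (hs : s ≠ ⊤) (hΩ : IsOpen Ω) (hb : Bornology.IsBounded Ω)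
    (hlip : HasLipschitzBoundary Ω) (Sp : Set (E d)) :
    ∃ W : Submodule ℝ (sobolev Ω s), (W : Set (sobolev Ω s)) = sobolevZero Ω s Sp ∧
      IsClosed (W : Set (sobolev Ω s)) := by
  obtain ⟨T, hT⟩ := exists_traceL (s := s) hs hΩ hb hlip
  obtain ⟨m, hm⟩ := exists_meanL (Ω := Ω) (s := s) hb
  by_cases h0 : surf Ω Sp = 0
  · refine ⟨m.ker, ?_, m.isClosed_ker⟩
    ext ξ
    simp [sobolevZero, h0, hm]
  -- In both cases the space is the kernel of a continuous map: the mean value above, the trace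
  -- restricted to `Sp` here.
  · let R := (LpToLpRestrictCLM (E d) ℝ ℝ (surf Ω) s Sp).comp T
    refine ⟨R.ker, ?_, R.isClosed_ker⟩
    ext ξ
    simp only [sobolevZero, h0, false_imp_iff, true_and, pos_iff_ne_zero, ne_eq,
      not_false_eq_true, true_imp_iff, SetLike.mem_coe, LinearMap.mem_ker, mem_ofPred_eq]
    have e := LpToLpRestrictCLM_coeFn (𝕜 := ℝ) Sp (trace ξ)
    change R ξ = 0 ↔ _
    have hR : R ξ = LpToLpRestrictCLM (E d) ℝ ℝ (surf Ω) s Sp (trace ξ) := by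
      simp [R, hT]
    rw [hR, Lp.eq_zero_iff_ae_eq_zero]
    constructor
    · intro h
      filter_upwards [h, e] with x h1 h2
      rw [← h2, h1]
      rfl
    · intro h
      filter_upwards [h, e] with x h1 h2
      rw [h2, h1]
      rfl

end Completeness

/-! ### Poincaré's inequality on `W_0^{1,s}`. -/

section PoincareZero

variable {d : ℕ} {Ω : Set (E d)} {s : ℝ≥0∞} [hs1 : Fact (1 ≤ s)]

theorem eLpNorm_const_real_eq {α : Type*} [MeasurableSpace α] {μ : Measure α} (hs : s ≠ ⊤)
    (c : ℝ) : eLpNorm (fun _ : α => c) s μ = ‖c‖ₑ * μ univ ^ (1 / s.toReal) :=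
  eLpNorm_const' c (one_pos.trans_le hs1.out).ne' hs

/-- Elements of `W_0^{1,s}` close to a constant force that constant to be small. -/
theorem exists_const_bound (hs : s ≠ ⊤) (hΩ : IsOpen Ω) (hb : Bornology.IsBounded Ω)
    (hne : Ω.Nonempty) (hlip : HasLipschitzBoundary Ω) (Sp : Set (E d)) :
    ∃ K : ℝ≥0, ∀ ξ ∈ sobolevZero Ω s Sp, ∀ c : ℝ, ‖c‖ₑ ≤
      K * (eLpNorm (fun x => fn ξ x - c) s (vol Ω) + eLpNorm (grad ξ) s (vol Ω)) := by
  have hp := one_le_toReal_exponent (s := s) hs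
  have := isFiniteMeasure_vol hb
  by_cases h0 : surf Ω Sp = 0
  · have hv0 : volume Ω ≠ 0 := (hΩ.measure_pos volume hne).ne'
    have hvt : volume Ω ≠ ⊤ := hb.measure_lt_top.ne
    set A : ℝ≥0∞ := (volume Ω)⁻¹ * volume Ω ^ (1 / (1 : ℝ≥0∞).toReal - 1 / s.toReal) with hA
    have hAt : A ≠ ⊤ := by
      refine ENNReal.mul_ne_top (ENNReal.inv_ne_top.2 hv0)
        (ENNReal.rpow_ne_top_of_nonneg ?_ hvt)
      rw [ENNReal.toReal_one, sub_nonneg, one_div_one]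
      exact (div_le_one (by linarith)).2 hp
    refine ⟨A.toNNReal, fun ξ hξ c => ?_⟩
    rw [ENNReal.coe_toNNReal hAt]
    have hmean := hξ.1 h0
    have hfi : Integrable (fn ξ) (vol Ω) := (Lp.memLp (fn ξ)).integrable hs1.out
    -- For zero mean, the integral of `fn ξ - c` sees only `c`, and Hölder compares it with the
    -- `L^s` norm.
    have h1 : ∫ x in Ω, (fn ξ x - c) = - (volume Ω).toReal * c := by
      rw [integral_sub hfi (integrable_const c), hmean]
      simp [Measure.real]
    have h2 : ‖c‖ₑ * volume Ω ≤
        eLpNorm (fun x => fn ξ x - c) s (vol Ω) *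
          volume Ω ^ (1 / (1 : ℝ≥0∞).toReal - 1 / s.toReal) := by
      have e : ‖∫ x in Ω, (fn ξ x - c)‖ₑ = ‖c‖ₑ * volume Ω := by
        rw [h1, enorm_mul, enorm_neg, Real.enorm_of_nonneg ENNReal.toReal_nonneg,
          ENNReal.ofReal_toReal hvt, mul_comm]
      rw [← e]
      refine (enorm_integral_le_lintegral_enorm _).trans ?_
      rw [← eLpNorm_one_eq_lintegral_enorm]
      have := eLpNorm_le_eLpNorm_mul_rpow_measure_univ hs1.out (μ := vol Ω)
        (f := fun x => fn ξ x - c) ((Lp.memLp (fn ξ)).aestronglyMeasurable.sub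
          aestronglyMeasurable_const)
      rwa [Measure.restrict_apply_univ] at this
    rw [mul_comm, ENNReal.mul_le_iff_le_inv hv0 hvt] at h2
    refine h2.trans ?_
    rw [hA, mul_assoc]
    refine mul_le_mul_right ?_ _
    rw [mul_comm]
    exact mul_le_mul_right le_self_add _
  · obtain ⟨C, hC⟩ := exists_isTrace_bound (s := s) hs hΩ hb hlip
    have hpos : 0 < 1 / s.toReal := by positivity
    set v : ℝ≥0∞ := surf Ω Sp ^ (1 / s.toReal) with hv
    have hSt : surf Ω Sp ≠ ⊤ :=
      ((measure_mono (subset_univ _)).trans_lt (surf_univ_lt_top hΩ hb hlip)).ne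
    have hv0 : v ≠ 0 := (ENNReal.rpow_pos (pos_iff_ne_zero.2 h0) hSt).ne'
    have hvt : v ≠ ⊤ := ENNReal.rpow_ne_top_of_nonneg hpos.le hSt
    have hAt : v⁻¹ * C ≠ ⊤ := ENNReal.mul_ne_top (ENNReal.inv_ne_top.2 hv0) ENNReal.coe_ne_top
    refine ⟨(v⁻¹ * C).toNNReal, fun ξ hξ c => ?_⟩
    rw [ENNReal.coe_toNNReal hAt, mul_assoc, ← ENNReal.mul_le_iff_le_inv hv0 hvt]
    refine le_trans ?_ (hC ξ (trace ξ) (isTrace_trace hs hΩ hb hlip ξ) c)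
    refine le_trans (le_of_eq ?_) (eLpNorm_restrict_le _ _ _ Sp)
    -- For zero trace on `Sp`, `trace ξ - c` is the constant `-c` there, so its norm on `Sp` is
    -- `|c|` times a power of the finite, nonzero measure of `Sp`.
    have e : (fun x => trace ξ x - c) =ᵐ[(surf Ω).restrict Sp] fun _ => -c := by
      filter_upwards [hξ.2 (pos_iff_ne_zero.2 h0)] with x hx
      rw [hx, zero_sub]
    rw [eLpNorm_congr_ae e, eLpNorm_const_real_eq hs, enorm_neg, Measure.restrict_apply_univ,
      mul_comm]

/-- Poincaré's inequality on `W_0^{1,s}(Ω)`. -/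
theorem exists_poincare_sobolevZero (hs : s ≠ ⊤) (hΩ : IsOpen Ω) (hb : Bornology.IsBounded Ω)
    (hconn : IsConnected Ω) (hlip : HasLipschitzBoundary Ω) (Sp : Set (E d)) :
    ∃ K : ℝ≥0, ∀ ξ ∈ sobolevZero Ω s Sp, ‖fn ξ‖ ≤ K * ‖grad ξ‖ := by
  have hp := one_le_toReal_exponent (s := s) hs
  have := isFiniteMeasure_vol hb
  obtain ⟨C, hC⟩ := exists_poincare_wirtinger_eLpNorm (s := s) hs hΩ hb hconn hlip
  obtain ⟨K, hK⟩ := exists_const_bound (s := s) hs hΩ hb hconn.nonempty hlip Sp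
  set v : ℝ≥0∞ := volume Ω ^ (1 / s.toReal) with hv
  have hvt : v ≠ ⊤ := ENNReal.rpow_ne_top_of_nonneg (by positivity) hb.measure_lt_top.ne
  have key : ∀ ξ ∈ sobolevZero Ω s Sp, eLpNorm (fn ξ) s (vol Ω) ≤
      ((1 + K * v) * C + K * v) * eLpNorm (grad ξ) s (vol Ω) := by
    intro ξ hξ
    set G := eLpNorm (grad ξ) s (vol Ω) with hG
    have hfm := (Lp.memLp (fn ξ)).aestronglyMeasurable
    have hGm := (Lp.memLp (grad ξ)).aestronglyMeasurable
    have hstep : ∀ n : ℕ, eLpNorm (fn ξ) s (vol Ω) ≤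
        (1 + K * v) * (((n : ℝ≥0∞) + 1)⁻¹ + C * (((n : ℝ≥0∞) + 1)⁻¹ + G)) + K * v * G := by
      intro n
      obtain ⟨η, hη, h1, h2⟩ := exists_smooth_approx hs hΩ hb hlip ξ
        (ε := ((n : ℝ≥0∞) + 1)⁻¹) (by simp)
      have hη1 : ContDiff ℝ 1 η := hη.of_le (by exact_mod_cast le_top)
      have hηm : AEStronglyMeasurable η (vol Ω) := hη.continuous.aestronglyMeasurable
      have hgm : AEStronglyMeasurable (gradient η) (vol Ω) :=
        (continuous_gradient hη1).aestronglyMeasurable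
      -- The constant belongs to the smooth approximant, which need not satisfy the side condition;
      -- the side condition on `ξ` then bounds `c`.
      obtain ⟨c, hc⟩ := hC η hη1
      have b1 : eLpNorm (fun x => fn ξ x - c) s (vol Ω) ≤
          ((n : ℝ≥0∞) + 1)⁻¹ + C * (((n : ℝ≥0∞) + 1)⁻¹ + G) := by
        refine (eLpNorm_sub_triangle hfm hηm aestronglyMeasurable_const).trans ?_
        rw [eLpNorm_sub_comm_fun]
        refine add_le_add h1 (hc.trans (mul_le_mul_right ?_ _))
        exact (eLpNorm_le_sub_add hgm hGm).trans (add_le_add_left h2 _)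
      have b2 := hK ξ hξ c
      calc eLpNorm (fn ξ) s (vol Ω)
          ≤ eLpNorm (fun x => fn ξ x - c) s (vol Ω) + eLpNorm (fun _ : E d => c) s (vol Ω) :=
            eLpNorm_le_sub_add hfm aestronglyMeasurable_const
        _ = eLpNorm (fun x => fn ξ x - c) s (vol Ω) + ‖c‖ₑ * v := by
            rw [eLpNorm_const_real_eq hs, Measure.restrict_apply_univ]
        _ ≤ eLpNorm (fun x => fn ξ x - c) s (vol Ω) +
            K * (eLpNorm (fun x => fn ξ x - c) s (vol Ω) + G) * v := by gcongr
        _ = (1 + K * v) * eLpNorm (fun x => fn ξ x - c) s (vol Ω) + K * v * G := by ring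
        _ ≤ _ := by gcongr
    have hε0 : Tendsto (fun n : ℕ => ((n : ℝ≥0∞) + 1)⁻¹) atTop (𝓝 0) := by
      have := (tendsto_add_atTop_iff_nat 1).2 ENNReal.tendsto_inv_nat_nhds_zero
      simpa using this
    have hKv : 1 + K * v ≠ ⊤ :=
      ENNReal.add_ne_top.2 ⟨ENNReal.one_ne_top, ENNReal.mul_ne_top ENNReal.coe_ne_top hvt⟩
    have hlim : Tendsto (fun n : ℕ => (1 + K * v) * (((n : ℝ≥0∞) + 1)⁻¹ +
        C * (((n : ℝ≥0∞) + 1)⁻¹ + G)) + K * v * G) atTop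
        (𝓝 ((1 + K * v) * (0 + C * (0 + G)) + K * v * G)) :=
      (ENNReal.Tendsto.const_mul (hε0.add (ENNReal.Tendsto.const_mul (hε0.add_const G)
        (Or.inr ENNReal.coe_ne_top))) (Or.inr hKv)).add_const _
    refine (ge_of_tendsto' hlim hstep).trans (le_of_eq ?_)
    ring
  have hMt : (1 + K * v) * C + K * v ≠ ⊤ := by
    have h1 : K * v ≠ ⊤ := ENNReal.mul_ne_top ENNReal.coe_ne_top hvt
    exact ENNReal.add_ne_top.2 ⟨ENNReal.mul_ne_top (ENNReal.add_ne_top.2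
      ⟨ENNReal.one_ne_top, h1⟩) ENNReal.coe_ne_top, h1⟩
  refine ⟨((1 + K * v) * C + K * v).toNNReal, fun ξ hξ => ?_⟩
  have h := ENNReal.toReal_mono (ENNReal.mul_ne_top hMt (Lp.memLp (grad ξ)).2.ne) (key ξ hξ)
  rwa [ENNReal.toReal_mul, ← Lp.norm_def, ← Lp.norm_def] at h

end PoincareZero

/-! ### Riesz representation of functionals on `L^s`. -/

section Riesz

variable {α X : Type*} [MeasurableSpace α] {μ : Measure α} [NormedAddCommGroup X]
  [InnerProductSpace ℝ X]

theorem exists_inclusionL [IsFiniteMeasure μ] {p q : ℝ≥0∞} [Fact (1 ≤ p)] [Fact (1 ≤ q)]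
    (hpq : p ≤ q) (hq : q ≠ ⊤) : ∃ J : Lp X q μ →L[ℝ] Lp X p μ, ∀ f, J f =ᵐ[μ] f := by
  have hmem : ∀ f : Lp X q μ, MemLp f p μ := fun f => (Lp.memLp f).mono_exponent hpq
  let c : ℝ≥0∞ := μ univ ^ (1 / p.toReal - 1 / q.toReal)
  have hc : c ≠ ⊤ := by
    refine ENNReal.rpow_ne_top_of_nonneg (sub_nonneg.2 ?_) (measure_ne_top _ _)
    have h1 : 1 ≤ p.toReal := one_le_toReal_exponent (ne_top_of_le_ne_top hq hpq)
    exact one_div_le_one_div_of_le (zero_lt_one.trans_le h1) (ENNReal.toReal_mono hq hpq)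
  let J : Lp X q μ →ₗ[ℝ] Lp X p μ :=
    { toFun := fun f => (hmem f).toLp f
      map_add' := fun f g => by
        refine Lp.ext ?_
        filter_upwards [(hmem (f + g)).coeFn_toLp, Lp.coeFn_add f g, (hmem f).coeFn_toLp,
          (hmem g).coeFn_toLp, Lp.coeFn_add ((hmem f).toLp f) ((hmem g).toLp g)]
          with x h1 h2 h3 h4 h5
        rw [h1, h2, h5, Pi.add_apply, Pi.add_apply, h3, h4]
      map_smul' := fun a f => by
        refine Lp.ext ?_
        filter_upwards [(hmem (a • f)).coeFn_toLp, Lp.coeFn_smul a f, (hmem f).coeFn_toLp,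
          Lp.coeFn_smul a ((hmem f).toLp f)] with x h1 h2 h3 h4
        rw [h1, h2, RingHom.id_apply, h4, Pi.smul_apply, Pi.smul_apply, h3] }
  refine ⟨J.mkContinuous c.toReal fun f => ?_, fun f => (hmem f).coeFn_toLp⟩
  have h := eLpNorm_le_eLpNorm_mul_rpow_measure_univ hpq (Lp.memLp f).aestronglyMeasurable
  have h' := ENNReal.toReal_mono (ENNReal.mul_ne_top (Lp.memLp f).2.ne hc) h
  rw [ENNReal.toReal_mul, ← Lp.norm_def, mul_comm] at h'
  change ‖(hmem f).toLp f‖ ≤ _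
  rwa [Lp.norm_toLp]

/-- Divide by `a ^ (1 / S)`, which leaves `a ^ (1 / R)`. Finiteness of `a` is essential, which is
why the estimate below is first made on truncations. -/
theorem le_rpow_of_le_mul_rpow {a N S R : ℝ} (ha : 0 ≤ a) (hN : 0 ≤ N)
    (hSR : S.HolderConjugate R) (h : a ≤ N * a ^ (1 / S)) : a ≤ N ^ R := by
  rcases ha.eq_or_lt with rfl | ha
  · positivity
  have h1 : a ^ (1 / R) ≤ N := by
    have h2 : a ^ (1 / S) * a ^ (1 / R) = a := by
      rw [← Real.rpow_add ha, one_div, one_div, hSR.inv_add_inv_eq_one, Real.rpow_one]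
    have h3 : 0 < a ^ (1 / S) := by positivity
    refine le_of_mul_le_mul_left ?_ h3
    rw [h2, mul_comm]; exact h
  calc a = (a ^ (1 / R)) ^ R := by
        rw [← Real.rpow_mul ha.le, one_div, inv_mul_cancel₀ hSR.symm.ne_zero, Real.rpow_one]
    _ ≤ N ^ R := Real.rpow_le_rpow (by positivity) h1 hSR.symm.nonneg

theorem norm_rpow_sub_two_smul {R : ℝ} (hR : 2 ≤ R) (v : X) :
    ‖‖v‖ ^ (R - 2) • v‖ = ‖v‖ ^ (R - 1) := by
  rw [norm_smul, Real.norm_of_nonneg (by positivity)]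
  rcases eq_or_ne ‖v‖ 0 with h | h
  · rw [h, mul_zero, Real.zero_rpow (by linarith)]
  · have h' : 0 < ‖v‖ := lt_of_le_of_ne (norm_nonneg _) h.symm
    rw [← Real.rpow_add_one h]; congr 1; ring

/-- Test `F` with `‖φ‖^(r-2) φ` truncated to `{‖φ‖ ≤ n}`. The pairing is `I`, the truncated integral
of `‖φ‖^r`, while the `L^s` norm of the test field is `I^(1/s)` because `(r - 1) s = r`. Hence `I ≤
‖F‖ I^(1/s)`, and the resulting bound does not depend on `n`. -/
theorem integral_norm_rpow_le_of_dual [IsFiniteMeasure μ] {s r : ℝ≥0∞} [Fact (1 ≤ s)]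
    (hs : s ≠ ⊤) (hr : 2 ≤ r) (hr_top : r ≠ ⊤) (hSR : s.toReal.HolderConjugate r.toReal)
    (F : Lp X s μ →L[ℝ] ℝ) (J : Lp X 2 μ →L[ℝ] Lp X s μ) (hJ : ∀ f, J f =ᵐ[μ] f)
    (φ : Lp X 2 μ) (hφ : ∀ f, F (J f) = ∫ x, inner ℝ (f x) (φ x) ∂μ) (n : ℕ) :
    ∫⁻ x in {x | ‖φ x‖ ≤ n}, ‖φ x‖ₑ ^ r.toReal ∂μ ≤ ENNReal.ofReal (‖F‖ ^ r.toReal) := by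
  set S := s.toReal
  set R := r.toReal
  have hR : 2 ≤ R := by
    have := ENNReal.toReal_mono hr_top hr
    simpa using this
  have hsm := Lp.stronglyMeasurable φ
  set A : Set α := {x | ‖φ x‖ ≤ n}
  have hA : MeasurableSet A := measurableSet_le hsm.norm.measurable measurable_const
  have hgm : StronglyMeasurable (A.indicator fun x => ‖φ x‖ ^ (R - 2) • φ x) :=
    ((hsm.norm.measurable.pow_const (R - 2)).stronglyMeasurable.smul hsm).indicator hA
  have hnorm : ∀ x, ‖A.indicator (fun x => ‖φ x‖ ^ (R - 2) • φ x) x‖ =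
      A.indicator (fun x => ‖φ x‖ ^ (R - 1)) x := fun x => by
    by_cases hx : x ∈ A <;> simp [hx, norm_rpow_sub_two_smul hR]
  have hmem : MemLp (A.indicator fun x => ‖φ x‖ ^ (R - 2) • φ x) 2 μ := by
    refine MemLp.of_bound hgm.aestronglyMeasurable ((n : ℝ) ^ (R - 1)) (.of_forall fun x => ?_)
    rw [hnorm]
    by_cases hx : x ∈ A
    · rw [indicator_of_mem hx]
      exact Real.rpow_le_rpow (norm_nonneg _) hx (by linarith)
    · rw [indicator_of_notMem hx]; positivity
  set h : α → ℝ := A.indicator fun x => ‖φ x‖ ^ R with hh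
  have hh0 : ∀ x, 0 ≤ h x := fun x => indicator_nonneg (fun _ _ => by positivity) x
  have hhm : StronglyMeasurable h :=
    ((hsm.norm.measurable.pow_const R).stronglyMeasurable).indicator hA
  have hhi : Integrable h μ := by
    refine Integrable.of_bound hhm.aestronglyMeasurable ((n : ℝ) ^ R) (.of_forall fun x => ?_)
    rw [Real.norm_of_nonneg (hh0 x), hh]
    by_cases hx : x ∈ A
    · rw [indicator_of_mem hx]
      exact Real.rpow_le_rpow (norm_nonneg _) hx (by linarith)
    · rw [indicator_of_notMem hx]; positivity
  set g := hmem.toLp _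
  have hg : g =ᵐ[μ] A.indicator fun x => ‖φ x‖ ^ (R - 2) • φ x := hmem.coeFn_toLp
  have e1 : F (J g) = ∫ x, h x ∂μ := by
    rw [hφ]
    refine integral_congr_ae ?_
    filter_upwards [hg] with x hx
    rw [hx, hh]
    by_cases hxA : x ∈ A
    · rw [indicator_of_mem hxA, indicator_of_mem hxA, real_inner_smul_left,
        real_inner_self_eq_norm_sq]
      rcases eq_or_ne ‖φ x‖ 0 with h0 | h0
      · rw [h0, Real.zero_rpow (by linarith : R ≠ 0)]; simp
      · have h' : 0 < ‖φ x‖ := lt_of_le_of_ne (norm_nonneg _) h0.symm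
        rw [← Real.rpow_natCast, ← Real.rpow_add h']; congr 1; push_cast; ring
    · rw [indicator_of_notMem hxA, indicator_of_notMem hxA, inner_zero_left]
  have e2 : ‖J g‖ = (∫ x, h x ∂μ) ^ (1 / S) := by
    rw [Lp.norm_def, eLpNorm_congr_ae ((hJ g).trans hg),
      eLpNorm_eq_lintegral_rpow_enorm_toReal (zero_lt_one.trans_le Fact.out).ne' hs,
      ← ENNReal.toReal_rpow, integral_eq_lintegral_of_nonneg_ae (.of_forall hh0)
        hhm.aestronglyMeasurable]
    congr 2
    refine lintegral_congr fun x => ?_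
    rw [← ofReal_norm, hnorm, ENNReal.ofReal_rpow_of_nonneg
      (indicator_nonneg (fun _ _ => by positivity) x) hSR.nonneg, hh]
    congr 1
    by_cases hxA : x ∈ A
    · rw [indicator_of_mem hxA, indicator_of_mem hxA, ← Real.rpow_mul (norm_nonneg _)]
      congr 1
      have := hSR.symm.sub_one_mul_conj
      linarith
    · rw [indicator_of_notMem hxA, indicator_of_notMem hxA, Real.zero_rpow hSR.ne_zero]
  have e3 : ∫ x, h x ∂μ ≤ ‖F‖ ^ R := by
    refine le_rpow_of_le_mul_rpow (integral_nonneg hh0) (norm_nonneg F) hSR ?_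
    rw [← e2]
    calc ∫ x, h x ∂μ = F (J g) := e1.symm
      _ ≤ ‖F (J g)‖ := Real.le_norm_self _
      _ ≤ ‖F‖ * ‖J g‖ := F.le_opNorm _
  calc ∫⁻ x in A, ‖φ x‖ₑ ^ R ∂μ = ∫⁻ x, ENNReal.ofReal (h x) ∂μ := by
        rw [← lintegral_indicator hA]
        refine lintegral_congr fun x => ?_
        by_cases hxA : x ∈ A
        · rw [hh, indicator_of_mem hxA, indicator_of_mem hxA, ← ofReal_norm,
            ENNReal.ofReal_rpow_of_nonneg (norm_nonneg _) (by linarith)]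
        · rw [hh, indicator_of_notMem hxA, indicator_of_notMem hxA, ENNReal.ofReal_zero]
    _ = ENNReal.ofReal (∫ x, h x ∂μ) :=
        (ofReal_integral_eq_lintegral_ofReal hhi (.of_forall hh0)).symm
    _ ≤ _ := ENNReal.ofReal_le_ofReal e3

theorem memLp_of_dual [IsFiniteMeasure μ] {s r : ℝ≥0∞} [Fact (1 ≤ s)]
    (hs : s ≠ ⊤) (hr : 2 ≤ r) (hr_top : r ≠ ⊤) (hSR : s.toReal.HolderConjugate r.toReal)
    (F : Lp X s μ →L[ℝ] ℝ) (J : Lp X 2 μ →L[ℝ] Lp X s μ) (hJ : ∀ f, J f =ᵐ[μ] f)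
    (φ : Lp X 2 μ) (hφ : ∀ f, F (J f) = ∫ x, inner ℝ (f x) (φ x) ∂μ) : MemLp φ r μ := by
  refine ⟨(Lp.memLp φ).aestronglyMeasurable, ?_⟩
  have hr0 : r ≠ 0 := (zero_lt_two.trans_le hr).ne'
  rw [eLpNorm_lt_top_iff_lintegral_rpow_enorm_lt_top hr0 hr_top]
  have hU : (⋃ n : ℕ, {x | ‖φ x‖ ≤ n}) = univ := by
    refine eq_univ_of_forall fun x => mem_iUnion.2 ?_
    exact exists_nat_ge ‖φ x‖
  have hmono : Monotone fun n : ℕ => {x | ‖φ x‖ ≤ n} := fun m n hmn x hx =>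
    le_trans (show ‖φ x‖ ≤ m from hx) (by exact_mod_cast hmn)
  rw [← setLIntegral_univ, ← hU, setLIntegral_iUnion_of_directed _ hmono.directed_le]
  exact (iSup_le (integral_norm_rpow_le_of_dual hs hr hr_top hSR F J hJ φ hφ)).trans_lt
    ENNReal.ofReal_lt_top

/-- Riesz representation of the dual of `L^s` for `1 < s ≤ 2` on a finite measure space. -/
theorem exists_lpPairing_eq [CompleteSpace X] [IsFiniteMeasure μ] {s r : ℝ≥0∞} [Fact (1 ≤ s)] [Fact (1 ≤ r)]
    [hsr : ENNReal.HolderConjugate s r] (hs : s ≤ 2) (hr : 2 ≤ r) (hr_top : r ≠ ⊤)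
    (F : Lp X s μ →L[ℝ] ℝ) :
    ∃ φ : Lp X r μ, ∀ g, F g = (innerSL ℝ).lpPairing μ s r g φ := by
  have hs_top : s ≠ ⊤ := ne_top_of_le_ne_top ENNReal.ofNat_ne_top hs
  have hSR : s.toReal.HolderConjugate r.toReal :=
    ENNReal.HolderConjugate.toReal_of_ne_top hs_top hr_top
  -- On a finite measure space `L^2` embeds in `L^s`, so the Hilbert space representation gives a
  -- candidate in `L^2`. It is then shown to lie in `L^r`, and the identity extends from simple
  -- functions by density.
  obtain ⟨J, hJ⟩ := exists_inclusionL (X := X) (μ := μ) hs ENNReal.ofNat_ne_top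
  set φ₂ : Lp X 2 μ := (InnerProductSpace.toDual ℝ _).symm (F ∘L J) with hφ₂
  have hφ : ∀ f, F (J f) = ∫ x, inner ℝ (f x) (φ₂ x) ∂μ := fun f => by
    rw [← L2.inner_def, real_inner_comm, hφ₂, InnerProductSpace.toDual_symm_apply]
    rfl
  have hmem := memLp_of_dual hs_top hr hr_top hSR F J hJ φ₂ hφ
  set φ := hmem.toLp φ₂
  have hφφ : φ =ᵐ[μ] φ₂ := hmem.coeFn_toLp
  refine ⟨φ, fun g => ?_⟩
  set P : Lp X s μ →L[ℝ] ℝ := ((innerSL ℝ).lpPairing μ s r).flip φ with hP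
  have hPJ : ∀ f, F (J f) = P (J f) := fun f => by
    rw [hφ, hP, ContinuousLinearMap.flip_apply, ContinuousLinearMap.lpPairing_eq_integral]
    refine integral_congr_ae ?_
    filter_upwards [hJ f, hφφ] with x h1 h2
    rw [h1, h2]
    rfl
  change F g = P g
  refine Lp.induction hs_top (motive := fun g => F g = P g) ?_ ?_ ?_ g
  · intro c t ht hμt
    rw [Lp.simpleFunc.coe_indicatorConst]
    have : indicatorConstLp s ht hμt.ne c = J (indicatorConstLp 2 ht hμt.ne c) := by
      refine Lp.ext ?_
      exact indicatorConstLp_coeFn.trans (((hJ _).trans indicatorConstLp_coeFn).symm)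
    rw [this, hPJ]
  · intro f g hf hg _ h1 h2
    rw [map_add, map_add, h1, h2]
  · exact isClosed_eq F.continuous P.continuous

end Riesz

/-! ### Hahn–Banach and operators bounded below on a closed subspace. -/

section FunctionalAnalysis

variable {X Y : Type*} [NormedAddCommGroup X] [NormedSpace ℝ X] [NormedAddCommGroup Y]
  [NormedSpace ℝ Y]

theorem exists_dual_vanishing_of_notMem (M : Submodule ℝ Y) (hM : IsClosed (M : Set Y)) {y : Y}
    (hy : y ∉ M) : ∃ F : Y →L[ℝ] ℝ, (∀ m ∈ M, F m = 0) ∧ F y ≠ 0 := by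
  obtain ⟨F, u, hu, hF⟩ := geometric_hahn_banach_point_closed M.convex hM hy
  have hu0 : u < 0 := by simpa using hF 0 M.zero_mem
  refine ⟨F, fun m hm => ?_, (hu.trans hu0).ne⟩
  -- A nonzero value `F m` could be rescaled to equal `u` exactly, but `F` is strictly above `u` on
  -- the subspace.
  by_contra h
  have := hF _ (M.smul_mem (u / F m) hm)
  rw [map_smul, smul_eq_mul, div_mul_cancel₀ _ h] at this
  exact this.false

theorem antilipschitz_comp_subtypeL (W : Submodule ℝ X) (G : X →L[ℝ] Y) {K : ℝ≥0}
    (hG : ∀ x ∈ W, ‖x‖ ≤ K * ‖G x‖) : AntilipschitzWith K (G ∘L W.subtypeL) :=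
  ContinuousLinearMap.antilipschitz_of_bound _ fun x => hG x x.2

variable [CompleteSpace X]

/-- The bound makes `G` antilipschitz on the complete space `W`, so its image is closed. -/
theorem isClosed_map_of_bound (W : Submodule ℝ X) (hW : IsClosed (W : Set X)) (G : X →L[ℝ] Y)
    {K : ℝ≥0} (hG : ∀ x ∈ W, ‖x‖ ≤ K * ‖G x‖) :
    IsClosed ((W.map (G : X →ₗ[ℝ] Y) : Submodule ℝ Y) : Set Y) := by
  have := hW.completeSpace_coe
  convert! (antilipschitz_comp_subtypeL W G hG).isClosed_range
    (G ∘L W.subtypeL).uniformContinuous using 1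
  ext y
  simp

/-- On the closed range `G(W)` the functional `ℓ ∘ G⁻¹` is well defined and continuous; Hahn–Banach
extends it to `Y`. -/
theorem exists_dual_comp_eq_of_bound [CompleteSpace Y] (W : Submodule ℝ X)
    (hW : IsClosed (W : Set X)) (G : X →L[ℝ] Y) {K : ℝ≥0} (hG : ∀ x ∈ W, ‖x‖ ≤ K * ‖G x‖)
    (ℓ : X →L[ℝ] ℝ) : ∃ F : Y →L[ℝ] ℝ, ∀ x ∈ W, F (G x) = ℓ x := by
  have := hW.completeSpace_coe
  have hanti := antilipschitz_comp_subtypeL W G hG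
  have hcl : IsClosed (range (G ∘L W.subtypeL)) := hanti.isClosed_range
    (G ∘L W.subtypeL).uniformContinuous
  let e := (G ∘L W.subtypeL).equivRange hanti.injective hcl
  obtain ⟨F, hF, -⟩ := exists_extension_norm_eq (𝕜 := ℝ) (G ∘L W.subtypeL).range
    (ℓ ∘L W.subtypeL ∘L e.symm.toContinuousLinearMap)
  refine ⟨F, fun x hx => ?_⟩
  have h1 := hF (e ⟨x, hx⟩)
  have h2 : ((e ⟨x, hx⟩ : (G ∘L W.subtypeL).range) : Y) = G x := rfl
  rw [← h2, h1]
  exact congrArg (fun w : W => ℓ w) (e.symm_apply_apply ⟨x, hx⟩)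

end FunctionalAnalysis

/-! ### Gradients as the annihilator of `V`, lifts, and the pressure. -/

section Duality

variable {d : ℕ} {Ω : Set (E d)} {r s : ℝ≥0∞} [Fact (1 ≤ r)] [Fact (1 ≤ s)]
  [ENNReal.HolderConjugate s r]

theorem exponent_le_two {r s : ℝ≥0∞} [ENNReal.HolderConjugate s r] (hr : 2 ≤ r) : s ≤ 2 := by
  have h := ENNReal.HolderConjugate.inv_add_inv_eq_one s r
  have h1 : r⁻¹ ≤ 2⁻¹ := ENNReal.inv_le_inv.2 hr
  rw [← ENNReal.inv_le_inv]
  by_contra hlt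
  rw [not_le] at hlt
  have : s⁻¹ + r⁻¹ < 2⁻¹ + 2⁻¹ := ENNReal.add_lt_add_of_lt_of_le
    (ne_top_of_le_ne_top (by simp) h1) hlt h1
  rw [h, ENNReal.inv_two_add_inv_two] at this
  exact this.false

theorem exists_pairing_eq (hb : Bornology.IsBounded Ω) (hr : 2 ≤ r) (hr_top : r ≠ ⊤)
    (F : Lp (E d) s (vol Ω) →L[ℝ] ℝ) : ∃ φ : Lp (E d) r (vol Ω), ∀ g, F g = pairing g φ := by
  have := isFiniteMeasure_vol hb
  exact exists_lpPairing_eq (exponent_le_two hr) hr hr_top F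

theorem eq_of_forall_pairing_eq (hb : Bornology.IsBounded Ω) (hr : 2 ≤ r) (hr_top : r ≠ ⊤)
    {g g' : Lp (E d) s (vol Ω)} (h : ∀ φ : Lp (E d) r (vol Ω), pairing g φ = pairing g' φ) :
    g = g' := by
  by_contra hne
  obtain ⟨F, -, hF⟩ := exists_dual_vanishing_of_notMem (⊥ : Submodule ℝ (Lp (E d) s (vol Ω)))
    isClosed_singleton (y := g - g') (by simpa [sub_eq_zero] using hne)
  obtain ⟨φ, hφ⟩ := exists_pairing_eq hb hr hr_top F
  rw [map_sub, hφ, hφ, h φ, sub_self] at hF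
  exact hF rfl

/-- Both terms are Hölder pairings, the second composed with the bounded trace operator. -/
theorem exists_dataFunctionalL (hs : s ≠ ⊤) (hΩ : IsOpen Ω) (hb : Bornology.IsBounded Ω)
    (hlip : HasLipschitzBoundary Ω) (Sv : Set (E d)) (q : Lp ℝ r (vol Ω))
    (u₀ : Lp ℝ r ((surf Ω).restrict Sv)) :
    ∃ ℓ : sobolev Ω s →L[ℝ] ℝ, ∀ ψ, ℓ ψ = dataFunctional Sv q u₀ ψ := by
  obtain ⟨T, hT⟩ := exists_traceL (s := s) hs hΩ hb hlip
  let A : Lp ℝ s (vol Ω) →L[ℝ] ℝ := ((ContinuousLinearMap.mul ℝ ℝ).lpPairing (vol Ω) s r).flip q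
  let B : Lp ℝ s ((surf Ω).restrict Sv) →L[ℝ] ℝ :=
    ((ContinuousLinearMap.mul ℝ ℝ).lpPairing ((surf Ω).restrict Sv) s r).flip u₀
  refine ⟨-(A ∘L fnL Ω s) + B ∘L LpToLpRestrictCLM (E d) ℝ ℝ (surf Ω) s Sv ∘L T, fun ψ => ?_⟩
  have hA : A (fn ψ) = ∫ x in Ω, q x * fn ψ x := by
    simp only [A, ContinuousLinearMap.flip_apply, ContinuousLinearMap.lpPairing_eq_integral,
      ContinuousLinearMap.mul_apply']
    exact integral_congr_ae (.of_forall fun x => mul_comm _ _)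
  have hB : B (LpToLpRestrictCLM (E d) ℝ ℝ (surf Ω) s Sv (trace ψ)) =
      ∫ x, u₀ x * trace ψ x ∂((surf Ω).restrict Sv) := by
    simp only [B, ContinuousLinearMap.flip_apply, ContinuousLinearMap.lpPairing_eq_integral,
      ContinuousLinearMap.mul_apply']
    refine integral_congr_ae ?_
    filter_upwards [LpToLpRestrictCLM_coeFn (p := s) ℝ Sv (trace ψ)] with x hx
    rw [hx, mul_comm]
  rw [dataFunctional, ← hA, ← hB, ← hT]
  rfl

theorem exists_sobolevZero_submodule_bound (hs : s ≠ ⊤) (hΩ : IsOpen Ω)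
    (hb : Bornology.IsBounded Ω) (hconn : IsConnected Ω) (hlip : HasLipschitzBoundary Ω)
    (Sp : Set (E d)) :
    ∃ W : Submodule ℝ (sobolev Ω s), (W : Set (sobolev Ω s)) = sobolevZero Ω s Sp ∧
      IsClosed (W : Set (sobolev Ω s)) ∧ ∃ K : ℝ≥0, ∀ ξ ∈ W, ‖ξ‖ ≤ K * ‖gradL Ω s ξ‖ := by
  obtain ⟨W, hW, hcl⟩ := exists_sobolevZero_submodule (s := s) hs hΩ hb hlip Sp
  obtain ⟨K, hK⟩ := exists_poincare_sobolevZero (s := s) hs hΩ hb hconn hlip Sp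
  -- The Sobolev norm is the maximum of the norms of the function and of the gradient: `K` serves
  -- the first and `1` the second.
  refine ⟨W, hW, hcl, max K 1, fun ξ hξ => ?_⟩
  rw [norm_sobolev, NNReal.coe_max, NNReal.coe_one, gradL_apply]
  refine max_le ((hK _ (hW ▸ hξ)).trans ?_) ?_
  · gcongr
    exact le_max_left _ _
  · exact le_mul_of_one_le_left (norm_nonneg _) (le_max_right _ _)

theorem zero_mem_sobolevZero (hs : s ≠ ⊤) (hΩ : IsOpen Ω) (hb : Bornology.IsBounded Ω)
    (hlip : HasLipschitzBoundary Ω) (Sp : Set (E d)) :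
    (0 : sobolev Ω s) ∈ sobolevZero Ω s Sp := by
  obtain ⟨W, hW, -⟩ := exists_sobolevZero_submodule (s := s) hs hΩ hb hlip Sp
  exact hW ▸ W.zero_mem

theorem grad_injOn_sobolevZero (hs : s ≠ ⊤) (hΩ : IsOpen Ω) (hb : Bornology.IsBounded Ω)
    (hconn : IsConnected Ω) (hlip : HasLipschitzBoundary Ω) (Sp : Set (E d)) :
    InjOn (grad (Ω := Ω) (s := s)) (sobolevZero Ω s Sp) := by
  obtain ⟨W, hW, -, K, hK⟩ := exists_sobolevZero_submodule_bound (s := s) hs hΩ hb hconn hlip Sp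
  rw [← hW]
  intro ξ hξ ξ' hξ' h
  have := hK (ξ - ξ') (W.sub_mem hξ hξ')
  rw [map_sub, gradL_apply, gradL_apply, h, sub_self, norm_zero, mul_zero, norm_le_zero_iff,
    sub_eq_zero] at this
  exact this

/-- A field in `L^s` that annihilates `V` is the gradient of an element of `W_0^{1,s}`. -/
theorem exists_grad_eq_of_annihilates (hΩ : IsOpen Ω) (hb : Bornology.IsBounded Ω)
    (hconn : IsConnected Ω) (hlip : HasLipschitzBoundary Ω) (Sp : Set (E d)) (hr : 2 ≤ r)
    (hr_top : r ≠ ⊤) (g : Lp (E d) s (vol Ω)) (hg : ∀ φ ∈ V Ω r s Sp, pairing g φ = 0) :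
    ∃ p ∈ sobolevZero Ω s Sp, grad p = g := by
  have hs : s ≠ ⊤ := ne_top_of_le_ne_top ENNReal.ofNat_ne_top (exponent_le_two (s := s) hr)
  have := completeSpace_sobolev Ω s
  obtain ⟨W, hW, hcl, K, hK⟩ :=
    exists_sobolevZero_submodule_bound (s := s) hs hΩ hb hconn hlip Sp
  by_contra hne
  have hgG : g ∉ W.map (gradL Ω s : sobolev Ω s →ₗ[ℝ] Lp (E d) s (vol Ω)) := by
    rintro ⟨ξ, hξ, hg⟩
    exact hne ⟨ξ, hW ▸ hξ, hg⟩
  -- If `g` were not a gradient, a functional would separate it from the closed space of gradients.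
  -- The field representing that functional lies in `V` but does not annihilate `g`.
  obtain ⟨F, hF0, hFg⟩ := exists_dual_vanishing_of_notMem _
    (isClosed_map_of_bound W hcl (gradL Ω s) hK) hgG
  obtain ⟨φ, hφ⟩ := exists_pairing_eq hb hr hr_top F
  refine hFg ((hφ g).trans (hg φ fun ψ hψ => ?_))
  rw [← hφ]
  have hψW : ψ ∈ W := by rwa [← SetLike.mem_coe, hW]
  exact hF0 _ ⟨ψ, hψW, rfl⟩

/-- The data functional depends on `ψ ∈ W_0^{1,s}` only through `∇ψ`, and boundedly so by Poincaré.
Its extension to `L^s` is represented by the required field. -/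
theorem exists_isLift (hΩ : IsOpen Ω) (hb : Bornology.IsBounded Ω)
    (hconn : IsConnected Ω) (hlip : HasLipschitzBoundary Ω) (Sv Sp : Set (E d)) (hr : 2 ≤ r)
    (hr_top : r ≠ ⊤) (q : Lp ℝ r (vol Ω)) (u₀ : Lp ℝ r ((surf Ω).restrict Sv)) :
    ∃ u, IsLift s Sv Sp q u₀ u := by
  have hs : s ≠ ⊤ := ne_top_of_le_ne_top ENNReal.ofNat_ne_top (exponent_le_two (s := s) hr)
  have := completeSpace_sobolev Ω s
  obtain ⟨W, hW, hcl, K, hK⟩ :=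
    exists_sobolevZero_submodule_bound (s := s) hs hΩ hb hconn hlip Sp
  obtain ⟨ℓ, hℓ⟩ := exists_dataFunctionalL (s := s) hs hΩ hb hlip Sv q u₀
  obtain ⟨F, hF⟩ := exists_dual_comp_eq_of_bound W hcl (gradL Ω s) hK ℓ
  obtain ⟨u, hu⟩ := exists_pairing_eq hb hr hr_top F
  refine ⟨u, fun ψ hψ => ?_⟩
  have hψW : ψ ∈ W := by rwa [← SetLike.mem_coe, hW]
  rw [← hu, ← hℓ]
  exact hF ψ hψW

variable {Sv Sp : Set (E d)} {q : Lp ℝ r (vol Ω)} {u₀ : Lp ℝ r ((surf Ω).restrict Sv)}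
  {f₀ : Lp (E d) s (vol Ω)} {u uhat v : Lp (E d) r (vol Ω)}

theorem IsLift.sub_mem (hu : IsLift s Sv Sp q u₀ u) (huhat : IsLift s Sv Sp q u₀ uhat) :
    u - uhat ∈ V Ω r s Sp := fun ψ hψ => by
  rw [map_sub, hu ψ hψ, huhat ψ hψ, sub_self]

theorem IsLift.add_left (hv : v ∈ V Ω r s Sp) (huhat : IsLift s Sv Sp q u₀ uhat) :
    IsLift s Sv Sp q u₀ (v + uhat) := fun ψ hψ => by
  rw [map_add, hv ψ hψ, zero_add, huhat ψ hψ]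

/-- The first equation is tested against all of `L^r`, which separates points of `L^s`, so it is an
identity of fields. -/
theorem solvesMixedWith_iff (hΩ : IsOpen Ω) (hb : Bornology.IsBounded Ω)
    (hlip : HasLipschitzBoundary Ω) (hr : 2 ≤ r) (hr_top : r ≠ ⊤)
    (Λu : Lp (E d) s (vol Ω)) (p : sobolev Ω s) :
    SolvesMixedWith Sv Sp q u₀ f₀ Λu u p ↔ grad p = f₀ - Λu ∧ IsLift s Sv Sp q u₀ u := by
  have hs : s ≠ ⊤ := ne_top_of_le_ne_top ENNReal.ofNat_ne_top (exponent_le_two (s := s) hr)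
  constructor
  · intro h
    -- The two equations are quantified jointly over `φ` and `ψ`. Each is isolated by putting zero
    -- in the other slot, which needs `0 ∈ W_0^{1,s}`.
    refine ⟨eq_of_forall_pairing_eq hb hr hr_top fun φ => ?_, fun ψ hψ => (h 0 ψ hψ).2⟩
    have := (h φ 0 (zero_mem_sobolevZero hs hΩ hb hlip Sp)).1
    rw [map_sub, sub_apply, this]
    ring
  · rintro ⟨hp, hu⟩ φ ψ hψ
    refine ⟨?_, hu ψ hψ⟩
    rw [hp, map_sub, sub_apply]
    ring

/-- Two lifts differ by an element of `V`, and adding an element of `V` preserves lifts, so the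
lifts form exactly one coset. Uniqueness uses that every class has a representative. -/
theorem existsUnique_lift_class (hΩ : IsOpen Ω) (hb : Bornology.IsBounded Ω)
    (hconn : IsConnected Ω) (hlip : HasLipschitzBoundary Ω) (Sv Sp : Set (E d)) (hr : 2 ≤ r)
    (hr_top : r ≠ ⊤) (q : Lp ℝ r (vol Ω)) (u₀ : Lp ℝ r ((surf Ω).restrict Sv)) :
    ∃! U : Lp (E d) r (vol Ω) ⧸ V Ω r s Sp, ∀ uhat : Lp (E d) r (vol Ω),
      (Submodule.Quotient.mk uhat : _ ⧸ V Ω r s Sp) = U → IsLift s Sv Sp q u₀ uhat := by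
  obtain ⟨u, hu⟩ := exists_isLift (s := s) hΩ hb hconn hlip Sv Sp hr hr_top q u₀
  refine ⟨Submodule.Quotient.mk u, fun uhat h => ?_, fun U' hU' => ?_⟩
  · have := hu.add_left ((Submodule.Quotient.eq _).1 h)
    rwa [sub_add_cancel] at this
  · obtain ⟨u', rfl⟩ := Submodule.Quotient.mk_surjective _ U'
    exact (Submodule.Quotient.eq _).2 ((hU' u' rfl).sub_mem hu)

/-- The residual `f₀ - Λv` annihilates `V`, so it is a gradient, and injectivity of the gradient on
`W_0^{1,s}` leaves one choice. -/
theorem existsUnique_pressure (hΩ : IsOpen Ω) (hb : Bornology.IsBounded Ω)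
    (hconn : IsConnected Ω) (hlip : HasLipschitzBoundary Ω) (hr : 2 ≤ r) (hr_top : r ≠ ⊤)
    (huhat : IsLift s Sv Sp q u₀ uhat) (hv : v ∈ V Ω r s Sp) (Λv : Lp (E d) s (vol Ω))
    (hΛ : ∀ φ ∈ V Ω r s Sp, pairing Λv φ = pairing f₀ φ) :
    ∃! p : sobolev Ω s, p ∈ sobolevZero Ω s Sp ∧
      SolvesMixedWith Sv Sp q u₀ f₀ Λv (v + uhat) p := by
  have hs : s ≠ ⊤ := ne_top_of_le_ne_top ENNReal.ofNat_ne_top (exponent_le_two (s := s) hr)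
  obtain ⟨p, hp, hgp⟩ := exists_grad_eq_of_annihilates hΩ hb hconn hlip Sp hr hr_top (f₀ - Λv)
    fun φ hφ => by rw [map_sub, sub_apply, hΛ φ hφ, sub_self]
  simp only [solvesMixedWith_iff hΩ hb hlip hr hr_top]
  exact ⟨p, ⟨hp, hgp, huhat.add_left hv⟩, fun p' hp' =>
    grad_injOn_sobolevZero hs hΩ hb hconn hlip Sp hp'.1 hp (hp'.2.1.trans hgp.symm)⟩

/-- By definition fields of `V` annihilate `grad p`, so the pressure drops out of the first
equation. -/
theorem SolvesMixed.solvesReduced {φ₁ φ₂ : ℝ≥0 → ℝ≥0} {p : sobolev Ω s} (hΩ : IsOpen Ω)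
    (hb : Bornology.IsBounded Ω) (hlip : HasLipschitzBoundary Ω) (hr : 2 ≤ r) (hr_top : r ≠ ⊤)
    (huhat : IsLift s Sv Sp q u₀ uhat) (h : SolvesMixed Sv Sp φ₁ φ₂ q u₀ f₀ u p) :
    SolvesReduced Sp φ₁ φ₂ f₀ uhat (u - uhat) := by
  obtain ⟨hp, Λu, hΛ, hsol⟩ := h
  obtain ⟨hgp, hu⟩ := (solvesMixedWith_iff hΩ hb hlip hr hr_top _ _).1 hsol
  refine ⟨hu.sub_mem huhat, Λu, by rwa [sub_add_cancel], fun φ hφ => ?_⟩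
  have := hφ p hp
  rw [hgp, map_sub, sub_apply] at this
  linarith

end Duality

end Fracture

/-! ### The equivalence of the mixed and the reduced problem. -/

theorem lemma4p3 {d : ℕ} (hd : 1 ≤ d)
    (Ω Sv Sp : Set (Fracture.E d))
    (hΩ_open : IsOpen Ω) (hΩ_bdd : Bornology.IsBounded Ω) (hΩ_conn : IsConnected Ω)
    (hΩ_lip : Fracture.HasLipschitzBoundary Ω)
    (hSv : Fracture.IsRelOpenInBoundary Ω Sv) (hSp : Fracture.IsRelOpenInBoundary Ω Sp)
    (hdisj : Disjoint Sv Sp) (hcover : frontier Ω = closure (Sv ∪ Sp))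
    {r s : ℝ≥0∞} [Fact (1 ≤ r)] [Fact (1 ≤ s)] [ENNReal.HolderConjugate s r]
    (hr : 2 ≤ r) (hr_top : r ≠ ⊤)
    (φ₁ φ₂ : ℝ≥0 → ℝ≥0) (hφ : Fracture.IsAdmissible r φ₁ φ₂)
    (q : Lp ℝ r (Fracture.vol Ω)) (u₀ : Lp ℝ r ((Fracture.surf Ω).restrict Sv))
    (f₀ : Lp (Fracture.E d) s (Fracture.vol Ω)) :
    -- existence and uniqueness of the lift in the quotient space
    (∃! U : Lp (Fracture.E d) r (Fracture.vol Ω) ⧸ Fracture.V Ω r s Sp,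
      ∀ uhat : Lp (Fracture.E d) r (Fracture.vol Ω),
        (Submodule.Quotient.mk uhat : _ ⧸ Fracture.V Ω r s Sp) = U →
          Fracture.IsLift s Sv Sp q u₀ uhat) ∧
    ∀ uhat : Lp (Fracture.E d) r (Fracture.vol Ω), Fracture.IsLift s Sv Sp q u₀ uhat →
      -- a solution of the mixed problem gives one of the reduced problem
      (∀ (u : Lp (Fracture.E d) r (Fracture.vol Ω)) (p : Fracture.sobolev Ω s),
        Fracture.SolvesMixed Sv Sp φ₁ φ₂ q u₀ f₀ u p →
          Fracture.SolvesReduced Sp φ₁ φ₂ f₀ uhat (u - uhat)) ∧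
      -- a solution of the reduced problem gives one of the mixed problem
      (∀ v : Lp (Fracture.E d) r (Fracture.vol Ω),
        Fracture.SolvesReduced Sp φ₁ φ₂ f₀ uhat v →
          ∃ p : Fracture.sobolev Ω s, Fracture.SolvesMixed Sv Sp φ₁ φ₂ q u₀ f₀ (v + uhat) p) ∧
      -- for each admissible selection, the pressure is unique
      (∀ v ∈ Fracture.V Ω r s Sp, ∀ Λv ∈ Fracture.law s φ₁ φ₂ (v + uhat),
        (∀ φ ∈ Fracture.V Ω r s Sp, Fracture.pairing Λv φ = Fracture.pairing f₀ φ) →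
          ∃! p : Fracture.sobolev Ω s, p ∈ Fracture.sobolevZero Ω s Sp ∧
            Fracture.SolvesMixedWith Sv Sp q u₀ f₀ Λv (v + uhat) p) := by

  refine ⟨Fracture.existsUnique_lift_class hΩ_open hΩ_bdd hΩ_conn hΩ_lip Sv Sp hr hr_top q u₀,
    fun uhat huhat => ⟨fun u p h => h.solvesReduced hΩ_open hΩ_bdd hΩ_lip hr hr_top huhat,
      ?_, fun v hv Λv _ hΛ => Fracture.existsUnique_pressure hΩ_open hΩ_bdd hΩ_conn hΩ_lip hr
        hr_top huhat hv Λv hΛ⟩⟩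
  rintro v ⟨hv, Λv, hΛv, hΛ⟩
  obtain ⟨p, ⟨hp, hsol⟩, -⟩ := Fracture.existsUnique_pressure hΩ_open hΩ_bdd hΩ_conn hΩ_lip hr
    hr_top huhat hv Λv hΛ
  exact ⟨p, hp, Λv, hΛv, hsol⟩
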